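/- **Setting.** Let $n_+,n_-\ge 1$ be integers and let $\chi(z)=(1,z,\dots,z^{n_+-1},z^{-1},\dots,z^{-n_-},z^{n_+},z^{n_++1},\dots)^\top$ be the sequence in which $n_+$ increasing non-negative powers of $z$ alternate with $n_-$ decreasing negative powers; put $\chi^*(z)=z^{-1}\chi(z^{-1})$. For $k\ge 0$ let $e_1(k)$ (resp. $e_2(k)$) be the canonical basis vector at the place of $z^k$ (resp. $z^{-k-1}$) in $\chi$, let $\Lambda_a=\sum_k e_a(k)e_a(k+1)^\top$, $\Lambda=\sum_j E_{j,j+1}$ and $\Upsilon=\Lambda_1+\Lambda_2^\top+E_{n_+,n_+}(\Lambda^\top)^{n_+}$ (semi-infinite matrices, rows and columns indexed by $0,1,2,\dots$), so that $\Upsilon\chi(z)=z\chi(z)$. Let $\mu$ be a complex Borel measure on the unit circle $\mathbb T$, with Fourier coefficients $c_n=\frac1{2\pi}\oint_{\mathbb T}z^{-n}\,d\mu(z)$ and moment matrix $g=\oint_{\mathbb T}\chi(z)\chi(z)^\dagger\,d\mu(z)$. Let $t=(t_{1j},t_{2j})_{j\ge1}$ be complex times with $\sum_j(|t_{1j}|+|t_{2j}|)<\infty$,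 and put $$W_{1,0}(t)=\exp\Big(\sum_{j\ge1}t_{1j}\Upsilon^j\Big),\quad W_{2,0}(t)=\exp\Big(\sum_{j\ge1}t_{2j}(\Upsilon^\top)^j\Big),\quad g(t)=W_{1,0}(t)\,g\,W_{2,0}(t)^{-1},$$ where $W_{1,0}(t)^{-1}$, $W_{2,0}(t)^{-1}$ are the exponentials of the opposite sums. Suppose that at the given $t$ all leading principal minors of $g(t)$ are nonzero. Let $g(t)=S_1(t)^{-1}S_2(t)$ be the Gauss–Borel factorization, $S_1$ lower triangular with unit diagonal and $S_2$ upper triangular and invertible. (Each entry of $S_1,S_2$ and of their triangular inverses $S_1^{-1},S_2^{-1}$ is a rational function of finitely many entries of $g(t)$ whose denominator is a leading principal minor: the row $l$ of $S_1$ left of the diagonal is $-(g_{l,0},\dots,g_{l,l-1})(g^{[l]})^{-1}$, the column $l$ of $S_2^{-1}$ is the last column of $(g^{[l+1]})^{-1}$, $g^{[l]}$ being the leading $l\times l$ block, and $S_2=S_1g(t)$, $S_1^{-1}=g(t)S_2^{-1}$ on and above, resp. on and below, the diagonal. Hence each entry is defined for times near $t$ in each coordinate direction.) Put $$W_a=S_aW_{a,0},\qquad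 W_a^{-1}=W_{a,0}^{-1}S_a^{-1},\qquad L_1=S_1\Upsilon S_1^{-1},\qquad L_2=S_2\Upsilon^\top S_2^{-1},$$ $$B_{1,j}=(L_1^j)_+,\qquad B_{2,j}=(L_2^j)_-,$$ with $+$ the projection onto the upper triangular matrices (diagonal included) and $-$ the projection onto the strictly lower triangular ones, and $$\Psi_1=W_1\chi(z),\quad \Psi_1^*=(W_1^{-1})^\dagger\chi^*(z),\quad \Psi_2=W_2\chi^*(z),\quad \Psi_2^*=(W_2^{-1})^\dagger\chi(z).$$ **Theorem.** All the series defining the entries of these matrices converge absolutely; $W_{a,0}W_{a,0}^{-1}=W_{a,0}^{-1}W_{a,0}=\mathbb I$ and $W_aW_a^{-1}=\mathbb I$ ($a=1,2$); the Gauss–Borel factorization of $g(t)$ exists and is unique, with the factors and inverses above; the rows of $L_1$, the columns of $L_2$, and the rows and the columns of all $B_{a,j}$ have finitely many nonzero entries. Moreover, for all $j,j'\ge1$ and $a,a',b\in\{1,2\}$, the following derivatives exist at $t$, entry by entry, and the following relations hold. 1. Auxiliary linear systems: $\dfrac{\partial W_b}{\partial t_{aj}}=B_{a,j}W_b$. 2.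 Linear systems for the wave and adjoint wave functions. For the coefficients of the adjoint ones, $\dfrac{\partial (W_b^{-1})^\dagger}{\partial\bar t_{aj}}=-B_{a,j}^\dagger(W_b^{-1})^\dagger$. As functions at a point $z\ne0$: - if $\sum_j|t_{1j}||z|^j<\infty$, then the series $\Psi_1(z,t)$ converges absolutely and $\dfrac{\partial\Psi_1}{\partial t_{aj}}=B_{a,j}\Psi_1$; - if $\sum_j|t_{2j}||z|^j<\infty$, then the series $\Psi_2^*(z,t)$ converges absolutely and $\dfrac{\partial\Psi_2^*}{\partial\bar t_{aj}}=-B_{a,j}^\dagger\Psi_2^*$; - if $\sum_j|t_{2j}||z|^{-j}<\infty$ and $\sum_{n\in\mathbb Z}|c_n||z|^n<\infty$, then the series $\Psi_1^*(z,t)$ converges absolutely and $\dfrac{\partial\Psi_1^*}{\partial\bar t_{aj}}=-B_{a,j}^\dagger\Psi_1^*$; - if $\sum_j|t_{1j}||z|^{-j}<\infty$ and $\sum_{n\in\mathbb Z}|c_n||z|^{-n}<\infty$, then the series $\Psi_2(z,t)$ converges absolutely and $\dfrac{\partial\Psi_2}{\partial t_{aj}}=B_{a,j}\Psi_2$. Here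 $\partial/\partial\bar t_{aj}$ is the complex derivative of the function regarded as a function of $\bar t_{aj}$ (of which it is a complex differentiable function at that point); for real variations of $t_{aj}$ it is the ordinary derivative. 3. Lax equations: $\dfrac{\partial L_b}{\partial t_{aj}}=[B_{a,j},L_b]$. 4. Zakharov–Shabat equations: $\dfrac{\partial B_{a,j}}{\partial t_{a'j'}}-\dfrac{\partial B_{a',j'}}{\partial t_{aj}}+[B_{a,j},B_{a',j'}]=0$. -/

import Mathlib

noncomputable section

namespace CMVToda

/-! ### Semi-infinite matrices and vectors

Rows and columns are indexed by `ℕ`.  Products are given by the (in general infinite) sums of the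
products of the entries. -/

/-- Semi-infinite complex matrices. -/
abbrev Mat := Matrix ℕ ℕ ℂ

/-- Product of semi-infinite matrices, `(A B)_{ik} = ∑_j A_{ij} B_{jk}`. -/
def mul (A B : Mat) : Mat := Matrix.of fun i k => ∑' j, A i j * B j k

/-- All the series defining the entries of the product `A B` converge (absolutely). -/
def MulSummable (A B : Mat) : Prop := ∀ i k, Summable fun j => A i j * B j k

/-- Product of a semi-infinite matrix and a semi-infinite vector. -/
def mulVec (A : Mat) (v : ℕ → ℂ) : ℕ → ℂ := fun i => ∑' k, A i k * v k

/-- All the series defining the entries of the vector `A v` converge (absolutely). -/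
def MulVecSummable (A : Mat) (v : ℕ → ℂ) : Prop := ∀ i, Summable fun k => A i k * v k

/-- Powers of a semi-infinite matrix. -/
def mpow (A : Mat) : ℕ → Mat
  | 0 => 1
  | n + 1 => mul (mpow A n) A

/-- Commutator of semi-infinite matrices. -/
def comm (A B : Mat) : Mat := mul A B - mul B A

/-- Exponential of a semi-infinite matrix, `exp A = ∑_n A ^ n / n!`, entry by entry. -/
def mexp (A : Mat) : Mat := Matrix.of fun i k => ∑' n : ℕ, ((n.factorial : ℂ)⁻¹) * mpow A n i k

/-- All the series needed to form the exponential of `A` converge. -/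
def ExpSummable (A : Mat) : Prop :=
  (∀ n, MulSummable (mpow A n) A) ∧
    ∀ i k, Summable fun n : ℕ => ((n.factorial : ℂ)⁻¹) * mpow A n i k

/-- Projection onto the upper triangular matrices (main diagonal included). -/
def upper (A : Mat) : Mat := Matrix.of fun i k => if i ≤ k then A i k else 0

/-- Projection onto the strictly lower triangular matrices. -/
def strictLower (A : Mat) : Mat := Matrix.of fun i k => if k < i then A i k else 0

/-- Every row of `A` has only finitely many nonzero entries. -/
def RowFinite (A : Mat) : Prop := ∀ i, {k | A i k ≠ 0}.Finite

/-- Every column of `A` has only finitely many nonzero entries. -/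
def ColFinite (A : Mat) : Prop := ∀ k, {i | A i k ≠ 0}.Finite

/-! ### Gauss--Borel factorization -/

/-- The truncation `g^{[l]}`: the leading `l × l` block. -/
def trunc (g : Mat) (l : ℕ) : Matrix (Fin l) (Fin l) ℂ := Matrix.of fun i j => g i j

/-- All leading principal minors of `g` are nonzero. -/
def NonzeroMinors (g : Mat) : Prop := ∀ l, (trunc g l).det ≠ 0

/-- `g = S₁⁻¹ S₂` with `S₁` lower triangular with unit diagonal and `S₂` upper triangular and
invertible; `S₁i` and `S₂i` are the (triangular) inverses of `S₁` and `S₂`.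
All the products involved are finite sums, by triangularity. -/
structure IsGaussBorel (g S₁ S₁i S₂ S₂i : Mat) : Prop where
  lower : ∀ i k, i < k → S₁ i k = 0
  unit_diag : ∀ i, S₁ i i = 1
  lower_inv : ∀ i k, i < k → S₁i i k = 0
  upper : ∀ i k, k < i → S₂ i k = 0
  upper_inv : ∀ i k, k < i → S₂i i k = 0
  mul_inv_one : mul S₁ S₁i = 1
  inv_mul_one : mul S₁i S₁ = 1
  mul_inv_two : mul S₂ S₂i = 1
  inv_mul_two : mul S₂i S₂ = 1
  factor : g = mul S₁i S₂

/-- The lower triangular factor `S₁` of `g`, written out row by row: the part of the row `l` to the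
left of the diagonal is `-(g_{l,0}, …, g_{l,l-1}) (g^{[l]})⁻¹`.  The row `l` only
involves `g^{[l]}` and the row `l` of `g`. -/
def gaussS₁ (g : Mat) : Mat := Matrix.of fun l k =>
  if h : k < l then - ∑ j : Fin l, g l j * (trunc g l)⁻¹ j ⟨k, h⟩
  else if k = l then 1 else 0

/-- The inverse of the upper triangular factor: the column `l` of `S₂⁻¹` is the last column of
`(g^{[l+1]})⁻¹`. -/
def gaussS₂Inv (g : Mat) : Mat := Matrix.of fun k l =>
  if h : k ≤ l then (trunc g (l + 1))⁻¹ ⟨k, Nat.lt_succ_of_le h⟩ (Fin.last l) else 0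

/-- The upper triangular factor `S₂ = S₁ g` (whose entries below the diagonal vanish when the
leading minors do not). -/
def gaussS₂ (g : Mat) : Mat := Matrix.of fun l k =>
  if l ≤ k then ∑ j ∈ Finset.range (l + 1), gaussS₁ g l j * g j k else 0

/-- The inverse `S₁⁻¹ = g S₂⁻¹` of the lower triangular factor (whose entries above the diagonal
vanish when the leading minors do not). -/
def gaussS₁Inv (g : Mat) : Mat := Matrix.of fun k l =>
  if l ≤ k then ∑ j ∈ Finset.range (l + 1), g k j * gaussS₂Inv g j l else 0

/-! ### The extended CMV ordering, the moment matrix and the shift matrix -/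

/-- The unit circle carries its Borel `σ`-algebra. -/
instance circleMeasurableSpace : MeasurableSpace Circle := borel Circle

instance circleBorelSpace : BorelSpace Circle := ⟨rfl⟩

/-- The data: the pair `(n₊, n₋)` of positive integers fixing the ordering of the Laurent
monomials, and a complex Borel measure on the unit circle. -/
structure Data where
  np : ℕ
  nm : ℕ
  np_pos : 0 < np
  nm_pos : 0 < nm
  μ : MeasureTheory.ComplexMeasure Circle

/-- Complex times: `t (0, j)` is `t_{1j}` and `t (1, j)` is `t_{2j}`, for `j = 1, 2, …`. -/
abbrev Times := Fin 2 × ℕ+ → ℂ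

namespace Data

variable (d : Data)

/-- The exponent of the `l`-th monomial of the sequence
`1, z, …, z^{n₊-1}, z⁻¹, …, z^{-n₋}, z^{n₊}, …`. -/
def expo (l : ℕ) : ℤ :=
  if l % (d.np + d.nm) < d.np then
    ((l / (d.np + d.nm)) * d.np + l % (d.np + d.nm) : ℕ)
  else
    -((l / (d.np + d.nm)) * d.nm + (l % (d.np + d.nm) - d.np) + 1 : ℕ)

/-- The vector `χ(z)` of Laurent monomials. -/
def chi (z : ℂ) : ℕ → ℂ := fun l => z ^ d.expo l

/-- The vector `χ^*(z) = z⁻¹ χ(z⁻¹)`. -/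
def chiStar (z : ℂ) : ℕ → ℂ := fun l => z⁻¹ * d.chi z⁻¹ l

/-- The moment matrix `g = ∮ χ(z) χ(z)† dμ(z)`. -/
def g : Mat := Matrix.of fun i k =>
  d.μ.integral (fun z : Circle => d.chi (z : ℂ) i * (starRingEnd ℂ) (d.chi (z : ℂ) k))
    (ContinuousLinearMap.mul ℝ ℂ)

/-- The Fourier coefficients `c_n = (2π)⁻¹ ∮ z^{-n} dμ(z)` of the measure. -/
def fourierCoeff (n : ℤ) : ℂ :=
  (2 * (Real.pi : ℂ))⁻¹ *
    d.μ.integral (fun z : Circle => (z : ℂ) ^ (-n)) (ContinuousLinearMap.mul ℝ ℂ)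

/-- The place of `z^k` in the sequence. -/
def pos₁ (k : ℕ) : ℕ := (k / d.np) * (d.np + d.nm) + k % d.np

/-- The place of `z^{-k-1}` in the sequence. -/
def pos₂ (k : ℕ) : ℕ := (k / d.nm) * (d.np + d.nm) + d.np + k % d.nm

open scoped Classical in
/-- `Λ₁ = ∑_k e_1(k) e_1(k+1)^⊤`, with `e_1(k)` the basis vector at the place of `z^k`. -/
def Lam₁ : Mat := Matrix.of fun i m =>
  if ∃ k, i = d.pos₁ k ∧ m = d.pos₁ (k + 1) then 1 else 0

open scoped Classical in
/-- `Λ₂ = ∑_k e_2(k) e_2(k+1)^⊤`, with `e_2(k)` the basis vector at the place of `z^{-k-1}`. -/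
def Lam₂ : Mat := Matrix.of fun i m =>
  if ∃ k, i = d.pos₂ k ∧ m = d.pos₂ (k + 1) then 1 else 0

/-- `Υ = Λ₁ + Λ₂^⊤ + E_{n₊,n₊} (Λ^⊤)^{n₊}`; as `Λ^⊤ = ∑_j E_{j+1,j}`, the last term is the matrix
unit `E_{n₊,0}`. -/
def Ups : Mat := d.Lam₁ + d.Lam₂.transpose + Matrix.single d.np 0 1

/-! ### Deformation, wave, Lax and Zakharov--Shabat matrices -/

/-- `∑_j t_{1j} Υ^j`. -/
def A₁ (t : Times) : Mat := Matrix.of fun i k => ∑' j : ℕ+, t (0, j) * mpow d.Ups j i k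

/-- `∑_j t_{2j} (Υ^⊤)^j`. -/
def A₂ (t : Times) : Mat := Matrix.of fun i k => ∑' j : ℕ+, t (1, j) * mpow d.Ups.transpose j i k

/-- `W_{1,0}(t) = exp (∑_j t_{1j} Υ^j)`. -/
def W₁₀ (t : Times) : Mat := mexp (d.A₁ t)

/-- `W_{1,0}(t)⁻¹`. -/
def W₁₀Inv (t : Times) : Mat := mexp (-d.A₁ t)

/-- `W_{2,0}(t) = exp (∑_j t_{2j} (Υ^⊤)^j)`. -/
def W₂₀ (t : Times) : Mat := mexp (d.A₂ t)

/-- `W_{2,0}(t)⁻¹`. -/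
def W₂₀Inv (t : Times) : Mat := mexp (-d.A₂ t)

/-- The deformed moment matrix `g(t) = W_{1,0}(t) g W_{2,0}(t)⁻¹`. -/
def gt (t : Times) : Mat := mul (mul (d.W₁₀ t) d.g) (d.W₂₀Inv t)

def S₁ (t : Times) : Mat := gaussS₁ (d.gt t)

def S₁Inv (t : Times) : Mat := gaussS₁Inv (d.gt t)

def S₂ (t : Times) : Mat := gaussS₂ (d.gt t)

def S₂Inv (t : Times) : Mat := gaussS₂Inv (d.gt t)

/-- The wave matrix `W₁ = S₁ W_{1,0}`. -/
def W₁ (t : Times) : Mat := mul (d.S₁ t) (d.W₁₀ t)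

/-- The wave matrix `W₂ = S₂ W_{2,0}`. -/
def W₂ (t : Times) : Mat := mul (d.S₂ t) (d.W₂₀ t)

/-- `W₁⁻¹ = W_{1,0}⁻¹ S₁⁻¹`. -/
def W₁Inv (t : Times) : Mat := mul (d.W₁₀Inv t) (d.S₁Inv t)

/-- `W₂⁻¹ = W_{2,0}⁻¹ S₂⁻¹`. -/
def W₂Inv (t : Times) : Mat := mul (d.W₂₀Inv t) (d.S₂Inv t)

/-- The Lax matrix `L₁ = S₁ Υ S₁⁻¹`. -/
def L₁ (t : Times) : Mat := mul (mul (d.S₁ t) d.Ups) (d.S₁Inv t)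

/-- The Lax matrix `L₂ = S₂ Υ^⊤ S₂⁻¹`. -/
def L₂ (t : Times) : Mat := mul (mul (d.S₂ t) d.Ups.transpose) (d.S₂Inv t)

/-- The Zakharov--Shabat matrices: `B (0, j) = B_{1,j} = (L₁^j)_+` and
`B (1, j) = B_{2,j} = (L₂^j)_-`. -/
def B (p : Fin 2 × ℕ+) (t : Times) : Mat :=
  if p.1 = 0 then upper (mpow (d.L₁ t) p.2) else strictLower (mpow (d.L₂ t) p.2)

/-- The wave function `Ψ₁(z,t) = W₁(t) χ(z)`. -/
def Ψ₁ (z : ℂ) (t : Times) : ℕ → ℂ := mulVec (d.W₁ t) (d.chi z)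

/-- The adjoint wave function `Ψ₁^*(z,t) = (W₁(t)⁻¹)† χ^*(z)`. -/
def Ψ₁Star (z : ℂ) (t : Times) : ℕ → ℂ := mulVec (d.W₁Inv t).conjTranspose (d.chiStar z)

/-- The wave function `Ψ₂(z,t) = W₂(t) χ^*(z)`. -/
def Ψ₂ (z : ℂ) (t : Times) : ℕ → ℂ := mulVec (d.W₂ t) (d.chiStar z)

/-- The adjoint wave function `Ψ₂^*(z,t) = (W₂(t)⁻¹)† χ(z)`. -/
def Ψ₂Star (z : ℂ) (t : Times) : ℕ → ℂ := mulVec (d.W₂Inv t).conjTranspose (d.chi z)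

end Data

/-! ### Partial derivatives with respect to the times -/

/-- At `t`, the function `F` of the times has the (complex) partial derivative `D` with respect to
the time `t p`. -/
def HasPartial (F : Times → ℂ) (p : Fin 2 × ℕ+) (D : ℂ) (t : Times) : Prop :=
  HasDerivAt (fun s : ℂ => F (Function.update t p s)) D (t p)

/-- At `t`, the function `F` of the times is complex differentiable as a function of the complex
conjugate of the time `t p`, with derivative `D`. -/
def HasConjPartial (F : Times → ℂ) (p : Fin 2 × ℕ+) (D : ℂ) (t : Times) : Prop :=
  HasDerivAt (fun s : ℂ => F (Function.update t p ((starRingEnd ℂ) s))) D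
    ((starRingEnd ℂ) (t p))

/-- Entrywise partial derivative of a matrix function of the times. -/
def HasPartialM (F : Times → Mat) (p : Fin 2 × ℕ+) (D : Mat) (t : Times) : Prop :=
  ∀ i k, HasPartial (fun t' => F t' i k) p (D i k) t

/-- Entrywise derivative of a matrix function with respect to the conjugate of a time. -/
def HasConjPartialM (F : Times → Mat) (p : Fin 2 × ℕ+) (D : Mat) (t : Times) : Prop :=
  ∀ i k, HasConjPartial (fun t' => F t' i k) p (D i k) t

/-- Entrywise partial derivative of a vector function of the times. -/
def HasPartialV (F : Times → ℕ → ℂ) (p : Fin 2 × ℕ+) (D : ℕ → ℂ) (t : Times) : Prop :=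
  ∀ i, HasPartial (fun t' => F t' i) p (D i) t

/-- Entrywise derivative of a vector function with respect to the conjugate of a time. -/
def HasConjPartialV (F : Times → ℕ → ℂ) (p : Fin 2 × ℕ+) (D : ℕ → ℂ) (t : Times) : Prop :=
  ∀ i, HasConjPartial (fun t' => F t' i) p (D i) t

end CMVToda

end

open CMVToda

namespace CMVToda

open Matrix Filter Topology

/-! ### Algebra of semi-infinite matrices -/

/-! In the CMV ordering `Ups` carries $z^n$ to $z^{n+1}$, so its transpose is the matrix of an
isometric permutation operator $U$ of $\ell^1$. Absolutely summable times make $\sum_j t_{aj}U^j$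
bounded, and the exponentials exhibit the rows of $W_{1,0}^{\pm1}$ and the columns of
$W_{2,0}^{\pm1}$ as $\ell^1$ vectors, differentiable in each time. The moment matrix has bounded
entries, so it pairs with these vectors. This yields convergence, the associativity that is needed,
and the derivatives $\Upsilon^j g(t)$ and $-g(t)(\Upsilon^\top)^j$ of $g(t)$ (`hasPartialM_gt`).

The factor $S_1$ is determined by the vanishing of $S_1g(t)$ below the diagonal, and $S_2^{-1}$ by
the agreement of $g(t)S_2^{-1}$ with the identity on and above it. Differentiating these conditions
gives linear systems with at most one triangular solution, because the minors do not vanish. The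
expected derivatives of $S_1$, namely $BS_1-S_1\Upsilon^j$ for $t_{1j}$ and $BS_1$ for $t_{2j}$, and
their analogues for $S_2^{-1}$, are solutions: splitting $L_a^j$ into its two triangular parts gives
both the shape of the candidate and the vanishing of the residue (`hasPartialM_S₁`,
`hasPartialM_S₂Inv`). No neighbourhood of $t$ on which all minors are nonzero is used: each row or
column depends on a single minor, and identities near $t$ are used row by row or column by column.

The rest follows from the product rules `hasPartialM_S₁_mul` and `hasPartialM_mul_S₂Inv`, in which
the powers of $\Upsilon$ cancel. The first covers $W_1=S_1W_{1,0}$, $W_2=S_1(W_{1,0}g)$,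
$S_2=S_1g(t)$ and $L_1=S_1(\Upsilon S_1^{-1})$; the second covers $W_2^{-1}=W_{2,0}^{-1}S_2^{-1}$,
$W_1^{-1}=(gW_{2,0}^{-1})S_2^{-1}$, $S_1^{-1}=g(t)S_2^{-1}$ and $L_2=(S_2\Upsilon^\top)S_2^{-1}$.
With a vector of monomials attached on the outer side they give the wave functions: conjugation by
the powers of $z$ replaces $t_j$ by $t_jz^j$, and where $g$ intervenes its Toeplitz structure in the
exponents gives a Schur bound. The Zakharov–Shabat equations are then algebra, since both triangular
classes are closed under commutators. -/

theorem mul_apply_eq (A B : Mat) (i k : ℕ) : mul A B i k = ∑' j, A i j * B j k := rfl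

theorem RowFinite.exists_finset {A : Mat} (hA : RowFinite A) (i : ℕ) :
    ∃ s : Finset ℕ, ∀ j ∉ s, A i j = 0 :=
  ⟨(hA i).toFinset, fun j hj => by simpa using hj⟩

theorem ColFinite.exists_finset {A : Mat} (hA : ColFinite A) (k : ℕ) :
    ∃ s : Finset ℕ, ∀ j ∉ s, A j k = 0 :=
  ⟨(hA k).toFinset, fun j hj => by simpa using hj⟩

theorem rowFinite_of_forall {A : Mat} (h : ∀ i, ∃ s : Finset ℕ, ∀ j ∉ s, A i j = 0) :
    RowFinite A := fun i => by
  obtain ⟨s, hs⟩ := h i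
  exact s.finite_toSet.subset fun j hj => by
    by_contra hjs
    exact hj (hs j hjs)

theorem rowFinite_transpose {A : Mat} : RowFinite Aᵀ ↔ ColFinite A := Iff.rfl

theorem colFinite_transpose {A : Mat} : ColFinite Aᵀ ↔ RowFinite A := Iff.rfl

theorem transpose_mul' (A B : Mat) : (mul A B)ᵀ = mul Bᵀ Aᵀ := by
  ext i k
  exact tsum_congr fun j => mul_comm _ _

theorem MulSummable.transpose {A B : Mat} (h : MulSummable A B) : MulSummable Bᵀ Aᵀ :=
  fun i k => (h k i).congr fun _ => mul_comm _ _

theorem MulSummable.of_rowFinite {A : Mat} (hA : RowFinite A) (B : Mat) : MulSummable A B := by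
  intro i k
  obtain ⟨s, hs⟩ := hA.exists_finset i
  exact summable_of_ne_finset_zero (s := s) fun j hj => by rw [hs j hj, zero_mul]

theorem MulSummable.of_colFinite (A : Mat) {B : Mat} (hB : ColFinite B) : MulSummable A B :=
  (MulSummable.of_rowFinite (rowFinite_transpose.2 hB) Aᵀ).transpose

/-- Associativity can fail for infinite matrices. Here the sum over the row of `A` is finite and
therefore commutes with the remaining convergent series. -/
theorem mul_assoc_of_rowFinite {A B C : Mat} (hA : RowFinite A) (h : MulSummable B C) :
    mul (mul A B) C = mul A (mul B C) := by
  ext i l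
  obtain ⟨s, hs⟩ := hA.exists_finset i
  have h1 : ∀ X : Mat, ∀ k, mul A X i k = ∑ j ∈ s, A i j * X j k := fun X k =>
    tsum_eq_sum fun j hj => by rw [hs j hj, zero_mul]
  rw [h1, mul_apply_eq]
  simp only [h1, Finset.sum_mul, mul_apply_eq, ← tsum_mul_left]
  rw [Summable.tsum_finsetSum]
  · simp only [mul_assoc]
  · intro j _
    simpa only [mul_assoc] using (h j l).mul_left (A i j)

theorem MulSummable.mul_left_of_rowFinite {A B C : Mat} (hA : RowFinite A) (h : MulSummable B C) :
    MulSummable (mul A B) C := by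
  intro i l
  obtain ⟨s, hs⟩ := hA.exists_finset i
  have h1 : ∀ k, mul A B i k = ∑ j ∈ s, A i j * B j k := fun k =>
    tsum_eq_sum fun j hj => by rw [hs j hj, zero_mul]
  simp only [h1, Finset.sum_mul]
  exact summable_sum fun j _ => by simpa only [mul_assoc] using (h j l).mul_left (A i j)

theorem mul_assoc_of_colFinite {A B C : Mat} (hC : ColFinite C) (h : MulSummable A B) :
    mul (mul A B) C = mul A (mul B C) := by
  apply Matrix.transpose_injective
  simp only [transpose_mul']
  exact (mul_assoc_of_rowFinite (rowFinite_transpose.2 hC) h.transpose).symm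

theorem MulSummable.mul_right_of_colFinite {A B C : Mat} (hC : ColFinite C) (h : MulSummable A B) :
    MulSummable A (mul B C) := by
  have := (MulSummable.mul_left_of_rowFinite (rowFinite_transpose.2 hC) h.transpose).transpose
  rwa [← transpose_mul', transpose_transpose, transpose_transpose] at this

theorem RowFinite.mul {A B : Mat} (hA : RowFinite A) (hB : RowFinite B) : RowFinite (mul A B) := by
  refine rowFinite_of_forall fun i => ?_
  obtain ⟨s, hs⟩ := hA.exists_finset i
  choose f hf using hB.exists_finset
  refine ⟨s.biUnion f, fun k hk => ?_⟩
  rw [mul_apply_eq]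
  refine (tsum_congr fun j => ?_).trans tsum_zero
  by_cases hj : j ∈ s
  · rw [hf j k fun h => hk (Finset.mem_biUnion.2 ⟨j, hj, h⟩), mul_zero]
  · rw [hs j hj, zero_mul]

theorem ColFinite.mul {A B : Mat} (hA : ColFinite A) (hB : ColFinite B) : ColFinite (mul A B) := by
  rw [← rowFinite_transpose, transpose_mul']
  exact RowFinite.mul (rowFinite_transpose.2 hB) (rowFinite_transpose.2 hA)

theorem mul_add_of_summable {A B C : Mat} (hB : MulSummable A B) (hC : MulSummable A C) :
    mul A (B + C) = mul A B + mul A C := by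
  ext i k
  simp only [mul_apply_eq, Matrix.add_apply, mul_add]
  exact (hB i k).tsum_add (hC i k)

theorem add_mul_of_summable {A B C : Mat} (hA : MulSummable A C) (hB : MulSummable B C) :
    mul (A + B) C = mul A C + mul B C := by
  ext i k
  simp only [mul_apply_eq, Matrix.add_apply, add_mul]
  exact (hA i k).tsum_add (hB i k)

theorem mul_neg' (A B : Mat) : mul A (-B) = -mul A B := by
  ext i k
  simp only [mul_apply_eq, Matrix.neg_apply, mul_neg, tsum_neg]

theorem neg_mul' (A B : Mat) : mul (-A) B = -mul A B := by
  ext i k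
  simp only [mul_apply_eq, Matrix.neg_apply, neg_mul, tsum_neg]

theorem MulSummable.neg_right {A B : Mat} (h : MulSummable A B) : MulSummable A (-B) :=
  fun i k => by simpa only [Matrix.neg_apply, mul_neg] using (h i k).neg

theorem zero_mul' (A : Mat) : mul 0 A = 0 := by
  ext i k; simp [mul_apply_eq]

theorem mul_zero' (A : Mat) : mul A 0 = 0 := by
  ext i k; simp [mul_apply_eq]

theorem one_mul' (A : Mat) : mul 1 A = A := by
  ext i k
  rw [mul_apply_eq, tsum_eq_single i fun j hj => by rw [Matrix.one_apply_ne hj.symm, zero_mul]]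
  simp

theorem mul_one' (A : Mat) : mul A 1 = A := by
  ext i k
  rw [mul_apply_eq, tsum_eq_single k fun j hj => by rw [Matrix.one_apply_ne hj, mul_zero]]
  simp

theorem RowFinite.neg {A : Mat} (hA : RowFinite A) : RowFinite (-A) := fun i => by
  simpa using hA i

theorem RowFinite.add {A B : Mat} (hA : RowFinite A) (hB : RowFinite B) : RowFinite (A + B) :=
  fun i => ((hA i).union (hB i)).subset fun k hk => by
    by_contra h
    simp only [Set.mem_union, Set.mem_ofPred_eq, not_or, not_not] at h
    exact hk (by rw [Matrix.add_apply, h.1, h.2, add_zero])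

theorem ColFinite.neg {A : Mat} (hA : ColFinite A) : ColFinite (-A) := fun i => by
  simpa using hA i

theorem ColFinite.add {A B : Mat} (hA : ColFinite A) (hB : ColFinite B) : ColFinite (A + B) :=
  rowFinite_transpose.1 (RowFinite.add (rowFinite_transpose.2 hA) (rowFinite_transpose.2 hB))

theorem rowFinite_one : RowFinite (1 : Mat) :=
  rowFinite_of_forall fun i => ⟨{i}, fun j hj => Matrix.one_apply_ne (by simpa [eq_comm] using hj)⟩

theorem RowFinite.mpow {A : Mat} (hA : RowFinite A) : ∀ n, RowFinite (mpow A n)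
  | 0 => rowFinite_one
  | n + 1 => (RowFinite.mpow hA n).mul hA

theorem colFinite_one : ColFinite (1 : Mat) := by
  rw [← rowFinite_transpose, Matrix.transpose_one]; exact rowFinite_one

theorem ColFinite.mpow {A : Mat} (hA : ColFinite A) : ∀ n, ColFinite (mpow A n)
  | 0 => colFinite_one
  | n + 1 => (ColFinite.mpow hA n).mul hA

theorem conjTranspose_mul' (A B : Mat) : (mul A B)ᴴ = mul Bᴴ Aᴴ := by
  ext i k
  simp only [mul_apply_eq, conjTranspose_apply]
  rw [tsum_star]
  exact tsum_congr fun j => star_mul _ _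

/-! ### Triangular matrices -/

/-- Lower triangular semi-infinite matrices. -/
def LowerTri (A : Mat) : Prop := ∀ i k, i < k → A i k = 0

/-- Strictly lower triangular semi-infinite matrices. -/
def StrictLowerTri (A : Mat) : Prop := ∀ i k, i ≤ k → A i k = 0

/-- Upper triangular semi-infinite matrices. -/
def UpperTri (A : Mat) : Prop := ∀ i k, k < i → A i k = 0

theorem lt_of_notMem_range_succ {j l : ℕ} (hj : j ∉ Finset.range (l + 1)) : l < j := by
  rw [Finset.mem_range] at hj
  omega

theorem LowerTri.mul_apply {A : Mat} (hA : LowerTri A) (B : Mat) (l k : ℕ) :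
    mul A B l k = ∑ i ∈ Finset.range (l + 1), A l i * B i k :=
  tsum_eq_sum fun j hj => by
    rw [hA l j (lt_of_notMem_range_succ hj), zero_mul]

theorem UpperTri.mul_apply {B : Mat} (hB : UpperTri B) (A : Mat) (k l : ℕ) :
    mul A B k l = ∑ i ∈ Finset.range (l + 1), A k i * B i l :=
  tsum_eq_sum fun j hj => by
    rw [hB j l (lt_of_notMem_range_succ hj), mul_zero]

theorem LowerTri.rowFinite {A : Mat} (hA : LowerTri A) : RowFinite A :=
  rowFinite_of_forall fun i => ⟨Finset.range (i + 1), fun j hj =>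
    hA i j (lt_of_notMem_range_succ hj)⟩

theorem UpperTri.colFinite {A : Mat} (hA : UpperTri A) : ColFinite A :=
  LowerTri.rowFinite (A := Aᵀ) fun i k h => hA k i h

theorem LowerTri.mul {A B : Mat} (hA : LowerTri A) (hB : LowerTri B) : LowerTri (mul A B) := by
  intro i k h
  refine (tsum_congr fun j => ?_).trans tsum_zero
  rcases lt_or_ge i j with hj | hj
  · rw [hA i j hj, zero_mul]
  · rw [hB j k (hj.trans_lt h), mul_zero]

theorem UpperTri.mul {A B : Mat} (hA : UpperTri A) (hB : UpperTri B) : UpperTri (mul A B) := by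
  intro i k h
  refine (tsum_congr fun j => ?_).trans tsum_zero
  rcases lt_or_ge j i with hj | hj
  · rw [hA i j hj, zero_mul]
  · rw [hB j k (h.trans_le hj), mul_zero]

theorem StrictLowerTri.lowerTri {A : Mat} (hA : StrictLowerTri A) : LowerTri A :=
  fun i k h => hA i k h.le

theorem StrictLowerTri.mul {A B : Mat} (hA : StrictLowerTri A) (hB : LowerTri B) :
    StrictLowerTri (mul A B) := by
  intro i k h
  refine (tsum_congr fun j => ?_).trans tsum_zero
  rcases le_or_gt i j with hj | hj
  · rw [hA i j hj, zero_mul]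
  · rw [hB j k (hj.trans_le h), mul_zero]

theorem LowerTri.mul_strict {A B : Mat} (hA : LowerTri A) (hB : StrictLowerTri B) :
    StrictLowerTri (CMVToda.mul A B) := by
  intro i k h
  refine (tsum_congr fun j => ?_).trans tsum_zero
  rcases lt_or_ge i j with hj | hj
  · rw [hA i j hj, zero_mul]
  · rw [hB j k (hj.trans h), mul_zero]

theorem LowerTri.mul_diag {A B : Mat} (hA : LowerTri A) (hB : LowerTri B) (i : ℕ) :
    CMVToda.mul A B i i = A i i * B i i :=
  tsum_eq_single i fun j hj => by
    rcases lt_or_gt_of_ne hj with h | h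
    · rw [hB j i h, mul_zero]
    · rw [hA i j h, zero_mul]

/-- The first `l` rows of a lower triangular matrix end before column `l`, so the right factor may
be arbitrary. -/
theorem LowerTri.trunc_mul {A : Mat} (hA : LowerTri A) (B : Mat) (l : ℕ) :
    trunc (CMVToda.mul A B) l = trunc A l * trunc B l := by
  ext i k
  change CMVToda.mul A B i k = _
  rw [Matrix.mul_apply, CMVToda.mul_apply_eq, tsum_eq_sum (s := Finset.range l),
    ← Fin.sum_univ_eq_sum_range (fun j => A i j * B j k)]
  · rfl
  · intro j hj
    rw [hA i j (i.2.trans_le (by simpa using hj)), zero_mul]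

theorem ext_of_trunc {A B : Mat} (h : ∀ l, trunc A l = trunc B l) : A = B := by
  ext i k
  have := congrFun (congrFun (h (max i k + 1)) ⟨i, by omega⟩) ⟨k, by omega⟩
  exact this

theorem trunc_one (l : ℕ) : trunc 1 l = 1 := by
  ext i k
  simp [trunc, Matrix.one_apply, Fin.ext_iff]

/-- Truncation is multiplicative here, and for finite blocks a one-sided inverse is two-sided. -/
theorem LowerTri.mul_eq_one_comm {A B : Mat} (hA : LowerTri A) (hB : LowerTri B)
    (h : CMVToda.mul A B = 1) : CMVToda.mul B A = 1 :=
  ext_of_trunc fun l => by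
    rw [hB.trunc_mul, trunc_one]
    apply _root_.mul_eq_one_comm.1
    rw [← hA.trunc_mul, h, trunc_one]

theorem UpperTri.mul_eq_one_comm {A B : Mat} (hA : UpperTri A) (hB : UpperTri B)
    (h : CMVToda.mul A B = 1) : CMVToda.mul B A = 1 := by
  apply Matrix.transpose_injective
  rw [transpose_mul', Matrix.transpose_one]
  refine LowerTri.mul_eq_one_comm (fun i k h => hB k i h) (fun i k h => hA k i h) ?_
  rw [← transpose_mul', h, Matrix.transpose_one]

/-- A lower triangular matrix with unit diagonal which is also upper triangular is the identity. -/
theorem eq_one_of_lowerTri_of_upperTri {A : Mat} (hl : LowerTri A) (hu : UpperTri A)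
    (hd : ∀ i, A i i = 1) : A = 1 := by
  ext i k
  rcases lt_trichotomy i k with h | rfl | h
  · rw [hl i k h, Matrix.one_apply_ne h.ne]
  · rw [hd, Matrix.one_apply_eq]
  · rw [hu i k h, Matrix.one_apply_ne h.ne']

theorem upperTri_upper (A : Mat) : UpperTri (upper A) := fun i k h => by
  simp [upper, h]

theorem strictLowerTri_strictLower (A : Mat) : StrictLowerTri (strictLower A) := fun i k h => by
  simp [strictLower, h]

theorem upper_add_strictLower (A : Mat) : upper A + strictLower A = A := by
  ext i k
  by_cases h : i ≤ k
  · simp [upper, strictLower, h]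
  · simp [upper, strictLower, h, not_le.1 h]

theorem upper_add (A B : Mat) : upper (A + B) = upper A + upper B := by
  ext i k; simp only [upper, Matrix.of_apply, Matrix.add_apply]; split_ifs <;> simp

theorem strictLower_add (A B : Mat) : strictLower (A + B) = strictLower A + strictLower B := by
  ext i k; simp only [strictLower, Matrix.of_apply, Matrix.add_apply]; split_ifs <;> simp

theorem upper_neg (A : Mat) : upper (-A) = -upper A := by
  ext i k; simp only [upper, Matrix.of_apply, Matrix.neg_apply]; split_ifs <;> simp

theorem strictLower_neg (A : Mat) : strictLower (-A) = -strictLower A := by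
  ext i k; simp only [strictLower, Matrix.of_apply, Matrix.neg_apply]; split_ifs <;> simp

theorem UpperTri.upper_eq {A : Mat} (hA : UpperTri A) : upper A = A := by
  ext i k
  by_cases h : i ≤ k
  · simp [upper, h]
  · simp [upper, h, hA i k (not_le.1 h)]

theorem UpperTri.strictLower_eq {A : Mat} (hA : UpperTri A) : strictLower A = 0 := by
  ext i k
  by_cases h : k < i
  · simp [strictLower, h, hA i k h]
  · simp [strictLower, h]

theorem StrictLowerTri.strictLower_eq {A : Mat} (hA : StrictLowerTri A) : strictLower A = A := by
  ext i k
  by_cases h : k < i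
  · simp [strictLower, h]
  · simp [strictLower, h, hA i k (not_lt.1 h)]

theorem StrictLowerTri.upper_eq {A : Mat} (hA : StrictLowerTri A) : upper A = 0 := by
  ext i k
  by_cases h : i ≤ k
  · simp [upper, h, hA i k h]
  · simp [upper, h]

theorem RowFinite.upper {A : Mat} (hA : RowFinite A) : RowFinite (upper A) := fun i =>
  (hA i).subset fun k hk h => hk (by simp [CMVToda.upper, h])

theorem ColFinite.strictLower {A : Mat} (hA : ColFinite A) : ColFinite (strictLower A) := fun i =>
  (hA i).subset fun k hk h => hk (by simp [CMVToda.strictLower, h])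

/-! ### The Gauss--Borel factorization -/

theorem lowerTri_gaussS₁ (g : Mat) : LowerTri (gaussS₁ g) := fun l k h => by
  simp [gaussS₁, h.not_gt, h.ne']

theorem gaussS₁_diag (g : Mat) (l : ℕ) : gaussS₁ g l l = 1 := by
  simp [gaussS₁]

theorem gaussS₁_of_lt (g : Mat) {l k : ℕ} (h : k < l) :
    gaussS₁ g l k = - ∑ j : Fin l, g l j * (trunc g l)⁻¹ j ⟨k, h⟩ := by
  simp [gaussS₁, h]

theorem upperTri_gaussS₂ (g : Mat) : UpperTri (gaussS₂ g) := fun l k h => by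
  simp [gaussS₂, h]

theorem upperTri_gaussS₂Inv (g : Mat) : UpperTri (gaussS₂Inv g) := fun l k h => by
  simp [gaussS₂Inv, h]

theorem lowerTri_gaussS₁Inv (g : Mat) : LowerTri (gaussS₁Inv g) := fun l k h => by
  simp [gaussS₁Inv, h]

/-- The part of row `l` of `gaussS₁ g` left of the diagonal, times the leading block, cancels row
`l` of `g`. Only the minor of order `l` enters, so the identity is available at nearby times where
the other minors are not controlled. -/
theorem gaussS₁_mul_of_lt {g : Mat} {l : ℕ} (hl : (trunc g l).det ≠ 0) {k : ℕ} (hk : k < l) :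
    mul (gaussS₁ g) g l k = 0 := by
  rw [(lowerTri_gaussS₁ g).mul_apply, Finset.sum_range_succ, gaussS₁_diag, one_mul,
    ← Fin.sum_univ_eq_sum_range (fun i => gaussS₁ g l i * g i k)]
  have h1 : ∀ i : Fin l, gaussS₁ g l i = -(Matrix.vecMul (fun j : Fin l => g l j) (trunc g l)⁻¹) i :=
    fun i => gaussS₁_of_lt g i.2
  have h2 : ∑ i : Fin l, gaussS₁ g l i * g i k =
      -(Matrix.vecMul (Matrix.vecMul (fun j : Fin l => g l j) (trunc g l)⁻¹) (trunc g l)) ⟨k, hk⟩ := by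
    simp only [h1, neg_mul, Finset.sum_neg_distrib]
    rfl
  rw [h2, Matrix.vecMul_vecMul, Matrix.nonsing_inv_mul _ (isUnit_iff_ne_zero.2 hl),
    Matrix.vecMul_one]
  simp

theorem gaussS₂_apply {g : Mat} {l : ℕ} (hl : (trunc g l).det ≠ 0) (k : ℕ) :
    gaussS₂ g l k = mul (gaussS₁ g) g l k := by
  rcases lt_or_ge k l with h | h
  · rw [gaussS₁_mul_of_lt hl h, upperTri_gaussS₂ g l k h]
  · rw [(lowerTri_gaussS₁ g).mul_apply]
    simp [gaussS₂, h]

/-- Column `l` is the last column of the inverse of the block of size `l + 1`; multiplying by that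
block gives a unit vector. -/
theorem mul_gaussS₂Inv_of_le {g : Mat} {l : ℕ} (hl : (trunc g (l + 1)).det ≠ 0) {i : ℕ}
    (hi : i ≤ l) : mul g (gaussS₂Inv g) i l = (1 : Mat) i l := by
  rw [(upperTri_gaussS₂Inv g).mul_apply,
    ← Fin.sum_univ_eq_sum_range (fun j => g i j * gaussS₂Inv g j l)]
  have h1 : ∀ j : Fin (l + 1), gaussS₂Inv g j l = (trunc g (l + 1))⁻¹ j (Fin.last l) := fun j => by
    simp [gaussS₂Inv, Nat.lt_succ_iff.1 j.2]
  simp only [h1]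
  have h2 := congrFun (congrFun (Matrix.mul_nonsing_inv _ (isUnit_iff_ne_zero.2 hl))
    ⟨i, Nat.lt_succ_of_le hi⟩) (Fin.last l)
  rw [Matrix.mul_apply] at h2
  refine h2.trans ?_
  simp [Matrix.one_apply, Fin.ext_iff]

theorem gaussS₁Inv_apply {g : Mat} {l : ℕ} (hl : (trunc g (l + 1)).det ≠ 0) (k : ℕ) :
    gaussS₁Inv g k l = mul g (gaussS₂Inv g) k l := by
  rcases lt_or_ge k l with h | h
  · rw [mul_gaussS₂Inv_of_le hl h.le, lowerTri_gaussS₁Inv g k l h, Matrix.one_apply_ne h.ne]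
  · rw [(upperTri_gaussS₂Inv g).mul_apply]
    simp [gaussS₁Inv, h]

theorem gaussS₁_mul {g : Mat} (hg : NonzeroMinors g) : mul (gaussS₁ g) g = gaussS₂ g := by
  ext l k
  exact (gaussS₂_apply (hg l) k).symm

theorem mul_gaussS₂Inv {g : Mat} (hg : NonzeroMinors g) :
    mul g (gaussS₂Inv g) = gaussS₁Inv g := by
  ext k l
  exact (gaussS₁Inv_apply (hg (l + 1)) k).symm

/-- Bracketing $S_1gS_2^{-1}$ in two ways gives $S_1S_1^{-1}=S_2S_2^{-1}$ for the explicit matrices.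
This product is both lower and upper triangular with unit diagonal, hence the identity. -/
theorem isGaussBorel_gauss {g : Mat} (hg : NonzeroMinors g) :
    IsGaussBorel g (gaussS₁ g) (gaussS₁Inv g) (gaussS₂ g) (gaussS₂Inv g) := by
  have hS := lowerTri_gaussS₁ g
  have hS' := lowerTri_gaussS₁Inv g
  have hT := upperTri_gaussS₂ g
  have hT' := upperTri_gaussS₂Inv g
  have h1 : mul (gaussS₁ g) (gaussS₁Inv g) = mul (gaussS₂ g) (gaussS₂Inv g) := by
    rw [← mul_gaussS₂Inv hg, ← gaussS₁_mul hg,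
      mul_assoc_of_rowFinite hS.rowFinite (.of_colFinite _ hT'.colFinite)]
  have h2 : mul (gaussS₁ g) (gaussS₁Inv g) = 1 := by
    refine eq_one_of_lowerTri_of_upperTri (hS.mul hS') (h1 ▸ hT.mul hT') fun i => ?_
    rw [hS.mul_diag hS', gaussS₁_diag, one_mul, gaussS₁Inv_apply (hg (i + 1)),
      mul_gaussS₂Inv_of_le (hg (i + 1)) le_rfl, Matrix.one_apply_eq]
  have h3 := hS.mul_eq_one_comm hS' h2
  exact
    { lower := hS
      unit_diag := gaussS₁_diag g
      lower_inv := hS'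
      upper := hT
      upper_inv := hT'
      mul_inv_one := h2
      inv_mul_one := h3
      mul_inv_two := h1 ▸ h2
      inv_mul_two := hT.mul_eq_one_comm hT' (h1 ▸ h2)
      factor := by
        rw [← gaussS₁_mul hg, ← mul_assoc_of_rowFinite hS'.rowFinite (.of_rowFinite hS.rowFinite _),
          h3, one_mul'] }

/-- The quotients satisfy $S'S^{-1}=T'T^{-1}$; one side is lower triangular with unit diagonal and
the other upper triangular. -/
theorem IsGaussBorel.unique {g S Si T Ti S' Si' T' Ti' : Mat} (h : IsGaussBorel g S Si T Ti)
    (h' : IsGaussBorel g S' Si' T' Ti') : S' = S ∧ Si' = Si ∧ T' = T ∧ Ti' = Ti := by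
  have hS : LowerTri S := h.lower
  have hSi : LowerTri Si := h.lower_inv
  have hT : UpperTri T := h.upper
  have hTi : UpperTri Ti := h.upper_inv
  have hS' : LowerTri S' := h'.lower
  have hSi' : LowerTri Si' := h'.lower_inv
  have hT' : UpperTri T' := h'.upper
  have hTi' : UpperTri Ti' := h'.upper_inv
  have e1 : mul S' g = T' := by
    rw [h'.factor, ← mul_assoc_of_rowFinite hS'.rowFinite (.of_rowFinite hSi'.rowFinite _),
      h'.mul_inv_one, one_mul']
  have e2 : mul (mul S' Si) T = T' := by
    rw [mul_assoc_of_rowFinite hS'.rowFinite (.of_rowFinite hSi.rowFinite _), ← h.factor, e1]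
  have e3 : mul S' Si = mul T' Ti := by
    rw [← e2, mul_assoc_of_colFinite hTi.colFinite (.of_colFinite _ hT.colFinite), h.mul_inv_two,
      mul_one']
  have hd : ∀ i, Si i i = 1 := fun i => by
    have := hS.mul_diag hSi i
    rwa [h.mul_inv_one, h.unit_diag, one_mul, Matrix.one_apply_eq, eq_comm] at this
  have e4 : mul S' Si = 1 := by
    refine eq_one_of_lowerTri_of_upperTri (hS'.mul hSi) (e3 ▸ hT'.mul hTi) fun i => ?_
    rw [hS'.mul_diag hSi, hd, h'.unit_diag, one_mul]
  have e5 : S' = S := by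
    rw [← one_mul' S, ← e4, mul_assoc_of_rowFinite hS'.rowFinite (.of_rowFinite hSi.rowFinite _),
      h.inv_mul_one, mul_one']
  have e6 : T' = T := by rw [← e2, e4, one_mul']
  subst e5 e6
  refine ⟨rfl, ?_, rfl, ?_⟩
  · rw [← mul_one' Si', ← h.mul_inv_one,
      ← mul_assoc_of_rowFinite hSi'.rowFinite (.of_rowFinite hS.rowFinite _), h'.inv_mul_one,
      one_mul']
  · rw [← one_mul' Ti', ← h.inv_mul_two,
      mul_assoc_of_colFinite hTi'.colFinite (.of_colFinite _ hT.colFinite), h'.mul_inv_two,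
      mul_one']

/-! ### Differentiability of the factors -/

theorem differentiableAt_det {n : Type*} [Fintype n] [DecidableEq n] {M : ℂ → Matrix n n ℂ} {s : ℂ}
    (hM : ∀ i j, DifferentiableAt ℂ (fun x => M x i j) s) :
    DifferentiableAt ℂ (fun x => (M x).det) s := by
  simp only [Matrix.det_apply]
  refine DifferentiableAt.fun_sum fun σ _ => ?_
  refine DifferentiableAt.const_smul ?_ (Equiv.Perm.sign σ : ℤˣ)
  exact DifferentiableAt.fun_finsetProd fun i _ => hM _ _

theorem differentiableAt_inv {n : Type*} [Fintype n] [DecidableEq n] {M : ℂ → Matrix n n ℂ} {s : ℂ}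
    (hM : ∀ i j, DifferentiableAt ℂ (fun x => M x i j) s) (h0 : (M s).det ≠ 0) (i j : n) :
    DifferentiableAt ℂ (fun x => (M x)⁻¹ i j) s := by
  simp only [Matrix.inv_def, Matrix.smul_apply, Ring.inverse_eq_inv', smul_eq_mul,
    Matrix.adjugate_apply]
  refine ((differentiableAt_det hM).inv h0).mul (differentiableAt_det fun a b => ?_)
  by_cases h : a = j
  · simp [h]
  · simpa [Matrix.updateRow_ne h] using hM a b

theorem differentiableAt_gaussS₁ {g : ℂ → Mat} {s : ℂ}
    (hg : ∀ i j, DifferentiableAt ℂ (fun x => g x i j) s) {l : ℕ} (h0 : (trunc (g s) l).det ≠ 0)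
    (k : ℕ) : DifferentiableAt ℂ (fun x => gaussS₁ (g x) l k) s := by
  rcases lt_trichotomy k l with h | rfl | h
  · simp only [gaussS₁_of_lt _ h]
    refine (DifferentiableAt.fun_sum fun j _ => ?_).neg
    exact (hg _ _).mul (differentiableAt_inv (M := fun x => trunc (g x) l) (fun a b => hg a b) h0 _ _)
  · simp [gaussS₁_diag]
  · simp [lowerTri_gaussS₁ _ _ _ h]

theorem differentiableAt_gaussS₂Inv {g : ℂ → Mat} {s : ℂ}
    (hg : ∀ i j, DifferentiableAt ℂ (fun x => g x i j) s) {l : ℕ}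
    (h0 : (trunc (g s) (l + 1)).det ≠ 0) (k : ℕ) :
    DifferentiableAt ℂ (fun x => gaussS₂Inv (g x) k l) s := by
  rcases le_or_gt k l with h | h
  · simp only [gaussS₂Inv, Matrix.of_apply, h, dif_pos]
    exact differentiableAt_inv (M := fun x => trunc (g x) (l + 1)) (fun a b => hg a b) h0 _ _
  · simp [upperTri_gaussS₂Inv _ _ _ h]

theorem eventually_det_trunc_ne_zero {g : ℂ → Mat} {s : ℂ}
    (hg : ∀ i j, DifferentiableAt ℂ (fun x => g x i j) s) {l : ℕ}
    (h0 : (trunc (g s) l).det ≠ 0) : ∀ᶠ x in 𝓝 s, (trunc (g x) l).det ≠ 0 :=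
  (differentiableAt_det (M := fun x => trunc (g x) l)
    fun a b => hg a b).continuousAt.eventually_ne h0

namespace Data

variable (d : Data)

/-! ### The CMV ordering and the shift matrix -/

theorem expo_pos₁ (k : ℕ) : d.expo (d.pos₁ k) = k := by
  have hp := d.np_pos
  have hk : k % d.np < d.np := Nat.mod_lt _ hp
  have h1 : d.pos₁ k % (d.np + d.nm) = k % d.np := by
    rw [pos₁, Nat.mul_add_mod', Nat.mod_eq_of_lt (by omega)]
  have h2 : d.pos₁ k / (d.np + d.nm) = k / d.np := by
    rw [pos₁, mul_comm, Nat.mul_add_div (by omega),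
      Nat.div_eq_of_lt (show k % d.np < d.np + d.nm by omega), add_zero]
  rw [expo, h1, h2, if_pos hk, Nat.div_add_mod']

theorem expo_pos₂ (k : ℕ) : d.expo (d.pos₂ k) = -(k + 1 : ℕ) := by
  have hp := d.nm_pos
  have hk : k % d.nm < d.nm := Nat.mod_lt _ hp
  have h1 : d.pos₂ k % (d.np + d.nm) = d.np + k % d.nm := by
    rw [pos₂, add_assoc, Nat.mul_add_mod', Nat.mod_eq_of_lt (by omega)]
  have h2 : d.pos₂ k / (d.np + d.nm) = k / d.nm := by
    rw [pos₂, add_assoc, mul_comm, Nat.mul_add_div (by omega),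
      Nat.div_eq_of_lt (show d.np + k % d.nm < d.np + d.nm by omega), add_zero]
  rw [expo, h1, h2, if_neg (by omega), Nat.add_sub_cancel_left, Nat.div_add_mod']

/-- The place of the monomial `z ^ n` in the CMV ordering. -/
def pos (n : ℤ) : ℕ := if 0 ≤ n then d.pos₁ n.toNat else d.pos₂ (-n - 1).toNat

theorem expo_pos (n : ℤ) : d.expo (d.pos n) = n := by
  unfold pos
  split_ifs with h
  · rw [expo_pos₁]; omega
  · rw [expo_pos₂]; omega

theorem pos_natCast (k : ℕ) : d.pos k = d.pos₁ k := by
  simp [pos]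

theorem pos_neg (k : ℕ) : d.pos (-(k + 1 : ℕ)) = d.pos₂ k := by
  have h : ¬ (0 : ℤ) ≤ -(k + 1 : ℕ) := by omega
  rw [pos, if_neg h]
  congr 1
  omega

theorem pos_expo (l : ℕ) : d.pos (d.expo l) = l := by
  have hp := d.np_pos
  have hm := d.nm_pos
  have hl : l % (d.np + d.nm) < d.np + d.nm := Nat.mod_lt _ (by omega)
  have hdm := Nat.div_add_mod' l (d.np + d.nm)
  rw [expo]
  split_ifs with h
  · rw [pos_natCast, pos₁, mul_comm (l / _) d.np, Nat.mul_add_div hp, Nat.div_eq_of_lt h,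
      Nat.mul_add_mod, Nat.mod_eq_of_lt h, add_zero, hdm]
  · have h' : l % (d.np + d.nm) - d.np < d.nm := by omega
    rw [pos_neg, pos₂, mul_comm (l / _) d.nm, Nat.mul_add_div hm, Nat.div_eq_of_lt h',
      Nat.mul_add_mod, Nat.mod_eq_of_lt h', add_zero]
    omega

theorem pos_eq_iff {n : ℤ} {l : ℕ} : l = d.pos n ↔ d.expo l = n :=
  ⟨fun h => by rw [h, expo_pos], fun h => by rw [← h, pos_expo]⟩

/-- The bijection between places and exponents. -/
def expoEquiv : ℕ ≃ ℤ := ⟨d.expo, d.pos, d.pos_expo, d.expo_pos⟩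

/-- The place of `z ^ n` times the `i`-th monomial. -/
def shift (n i : ℕ) : ℕ := d.pos (d.expo i + n)

theorem expo_shift (n i : ℕ) : d.expo (d.shift n i) = d.expo i + n := d.expo_pos _

theorem shift_zero (i : ℕ) : d.shift 0 i = i := by
  rw [shift, Nat.cast_zero, add_zero, pos_expo]

theorem shift_shift (m n i : ℕ) : d.shift m (d.shift n i) = d.shift (n + m) i := by
  rw [shift, expo_shift, shift, Nat.cast_add, add_assoc]

/-- The three summands of `Ups` raise the exponent by one on disjoint ranges: $\Lambda_1$ for
exponents $\ge0$, $\Lambda_2^\top$ for exponents $<-1$, and the matrix unit for $-1$. -/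
theorem Ups_apply (i m : ℕ) : d.Ups i m = if m = d.shift 1 i then 1 else 0 := by
  have h1 : (∃ k, i = d.pos₁ k ∧ m = d.pos₁ (k + 1)) ↔ 0 ≤ d.expo i ∧ d.expo m = d.expo i + 1 := by
    constructor
    · rintro ⟨k, rfl, rfl⟩
      rw [expo_pos₁, expo_pos₁]
      omega
    · rintro ⟨h0, h⟩
      refine ⟨(d.expo i).toNat, ?_, ?_⟩
      · rw [← pos_natCast, pos_eq_iff]; omega
      · rw [← pos_natCast, pos_eq_iff]; omega
  have h2 : (∃ k, m = d.pos₂ k ∧ i = d.pos₂ (k + 1)) ↔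
      d.expo i < -1 ∧ d.expo m = d.expo i + 1 := by
    constructor
    · rintro ⟨k, rfl, rfl⟩
      rw [expo_pos₂, expo_pos₂]
      omega
    · rintro ⟨h0, h⟩
      refine ⟨(-d.expo m - 1).toNat, ?_, ?_⟩
      · rw [← pos_neg, pos_eq_iff]; omega
      · rw [← pos_neg, pos_eq_iff]; omega
  have h3 : (d.np = i ∧ 0 = m) ↔ d.expo i = -1 ∧ d.expo m = d.expo i + 1 := by
    have e1 : d.pos 0 = 0 := by
      have := d.pos_natCast 0
      simpa [pos₁] using this
    have e2 : d.pos (-1) = d.np := by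
      have := d.pos_neg 0
      simpa [pos₂] using this
    rw [← e1, ← e2, eq_comm, d.pos_eq_iff, eq_comm (b := m), d.pos_eq_iff]
    omega
  have h4 : m = d.shift 1 i ↔ d.expo m = d.expo i + 1 := by
    rw [shift, pos_eq_iff]; simp
  simp only [Ups, Lam₁, Lam₂, Matrix.add_apply, Matrix.of_apply, Matrix.transpose_apply,
    Matrix.single_apply, h1, h2, h3, h4]
  by_cases h : d.expo m = d.expo i + 1
  · simp only [h, and_true, if_true]
    rcases lt_trichotomy (d.expo i) (-1) with h' | h' | h'
    · rw [if_neg (by omega), if_pos h', if_neg (by omega)]; simp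
    · rw [if_neg (by omega), if_neg (by omega), if_pos h']; simp
    · rw [if_pos (by omega), if_neg (by omega), if_neg (by omega)]; simp
  · simp [h]

theorem mpow_Ups_apply (n i m : ℕ) :
    mpow d.Ups n i m = if m = d.shift n i then 1 else 0 := by
  induction n generalizing m with
  | zero => simp [mpow, shift_zero, Matrix.one_apply, eq_comm]
  | succ n ih =>
    rw [mpow, mul_apply_eq, tsum_eq_single (d.shift n i)]
    · rw [ih, if_pos rfl, one_mul, Ups_apply, shift_shift]
    · intro j hj
      rw [ih, if_neg hj, zero_mul]

theorem mpow_Ups_mul (n : ℕ) (X : Mat) (i k : ℕ) :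
    mul (mpow d.Ups n) X i k = X (d.shift n i) k := by
  rw [mul_apply_eq, tsum_eq_single (d.shift n i)]
  · rw [mpow_Ups_apply, if_pos rfl, one_mul]
  · intro j hj
    rw [mpow_Ups_apply, if_neg hj, zero_mul]

theorem mpow_transpose_Ups (n : ℕ) : mpow d.Upsᵀ n = (mpow d.Ups n)ᵀ := by
  induction n with
  | zero => simp [mpow]
  | succ n ih =>
    rw [mpow, ih, ← transpose_mul']
    congr 1
    ext i k
    have h1 := d.mpow_Ups_mul 1 (mpow d.Ups n) i k
    rw [show mpow d.Ups 1 = d.Ups from one_mul' _] at h1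
    rw [h1, mpow_Ups_apply, mpow_Ups_apply, shift_shift, add_comm]

theorem mul_mpow_transpose_Ups (n : ℕ) (X : Mat) (i k : ℕ) :
    mul X (mpow d.Upsᵀ n) i k = X i (d.shift n k) := by
  have := d.mpow_Ups_mul n Xᵀ k i
  rwa [← transpose_transpose (mpow d.Ups n), ← mpow_transpose_Ups, ← transpose_mul'] at this

theorem rowFinite_mpow_Ups (n : ℕ) : RowFinite (mpow d.Ups n) :=
  rowFinite_of_forall fun i => ⟨{d.shift n i}, fun j hj => by
    rw [mpow_Ups_apply, if_neg (by simpa using hj)]⟩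

theorem mpow_one' (A : Mat) : mpow A 1 = A := one_mul' A

theorem rowFinite_Ups : RowFinite d.Ups := by
  have := d.rowFinite_mpow_Ups 1
  rwa [mpow_one'] at this

theorem colFinite_mpow_transpose_Ups (n : ℕ) : ColFinite (mpow d.Upsᵀ n) := by
  rw [mpow_transpose_Ups]
  exact d.rowFinite_mpow_Ups n

end Data

/-! ### Bounded operators on `ℓ¹` and their matrices -/

/-- The Banach space `ℓ¹(ℕ)`. -/
noncomputable abbrev EllOne := lp (fun _ : ℕ => ℂ) 1

theorem EllOne.summable_norm (x : EllOne) : Summable fun n => ‖x n‖ := by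
  simpa using (lp.memℓp x).summable (by simp)

theorem EllOne.norm_eq (x : EllOne) : ‖x‖ = ∑' n, ‖x n‖ := by
  simpa using lp.norm_eq_tsum_rpow (p := 1) (by simp) x

/-- The canonical basis vectors of `ℓ¹(ℕ)`. -/
noncomputable def basisVec (k : ℕ) : EllOne := lp.single 1 k (1 : ℂ)

theorem basisVec_apply (k i : ℕ) : basisVec k i = (1 : Mat) i k := by
  rw [basisVec, lp.single_apply, Matrix.one_apply, Pi.single_apply]

theorem EllOne.hasSum_basisVec (x : EllOne) : HasSum (fun j => x j • basisVec j) x := by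
  refine (lp.hasSum_single (by simp) x).congr_fun fun j => ?_
  rw [basisVec, ← lp.single_smul, smul_eq_mul, mul_one]

/-- The matrix of a bounded operator on `ℓ¹(ℕ)`. -/
noncomputable def opMatrix (P : EllOne →L[ℂ] EllOne) : Mat := Matrix.of fun i k => P (basisVec k) i

/-- The entries of the matrix of an operator, as continuous linear functionals. -/
noncomputable def opEntry (i k : ℕ) : (EllOne →L[ℂ] EllOne) →L[ℂ] ℂ :=
  (lp.evalCLM ℂ (fun _ : ℕ => ℂ) 1 i).comp (ContinuousLinearMap.apply ℂ EllOne (basisVec k))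

theorem opEntry_apply (i k : ℕ) (P : EllOne →L[ℂ] EllOne) : opEntry i k P = opMatrix P i k := rfl

theorem hasSum_opMatrix (P : EllOne →L[ℂ] EllOne) (x : EllOne) (i : ℕ) :
    HasSum (fun j => opMatrix P i j * x j) (P x i) := by
  have h := (EllOne.hasSum_basisVec x).mapL ((lp.evalCLM ℂ (fun _ : ℕ => ℂ) 1 i).comp P)
  refine h.congr_fun fun j => ?_
  rw [map_smul, smul_eq_mul, mul_comm]
  rfl

theorem mulSummable_opMatrix (P Q : EllOne →L[ℂ] EllOne) :
    MulSummable (opMatrix P) (opMatrix Q) := fun i k => (hasSum_opMatrix P (Q (basisVec k)) i).summable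

theorem opMatrix_mul (P Q : EllOne →L[ℂ] EllOne) :
    opMatrix (P * Q) = mul (opMatrix P) (opMatrix Q) := by
  ext i k
  exact (hasSum_opMatrix P (Q (basisVec k)) i).tsum_eq.symm

theorem opMatrix_one : opMatrix 1 = 1 := by
  ext i k
  exact basisVec_apply k i

theorem opMatrix_neg (P : EllOne →L[ℂ] EllOne) : opMatrix (-P) = -opMatrix P := by
  ext i k
  exact (opEntry i k).map_neg P

theorem opMatrix_pow (P : EllOne →L[ℂ] EllOne) (n : ℕ) :
    opMatrix (P ^ n) = mpow (opMatrix P) n := by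
  induction n with
  | zero => rw [pow_zero, opMatrix_one, mpow]
  | succ n ih => rw [pow_succ, opMatrix_mul, ih, mpow]

theorem hasSum_opMatrix_exp (P : EllOne →L[ℂ] EllOne) (i k : ℕ) :
    HasSum (fun n : ℕ => ((n.factorial : ℂ)⁻¹) * mpow (opMatrix P) n i k)
      (opMatrix (NormedSpace.exp P) i k) := by
  have h := (NormedSpace.exp_series_hasSum_exp' (𝕂 := ℂ) P).mapL (opEntry i k)
  refine h.congr_fun fun n => ?_
  rw [map_smul, smul_eq_mul, opEntry_apply, opMatrix_pow]

theorem mexp_opMatrix (P : EllOne →L[ℂ] EllOne) :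
    mexp (opMatrix P) = opMatrix (NormedSpace.exp P) := by
  ext i k
  exact (hasSum_opMatrix_exp P i k).tsum_eq

theorem expSummable_opMatrix (P : EllOne →L[ℂ] EllOne) : ExpSummable (opMatrix P) := by
  refine ⟨fun n => ?_, fun i k => (hasSum_opMatrix_exp P i k).summable⟩
  rw [← opMatrix_pow]
  exact mulSummable_opMatrix _ _

theorem mpow_transpose_opMatrix (P : EllOne →L[ℂ] EllOne) (n : ℕ) :
    mpow (opMatrix P)ᵀ n = (mpow (opMatrix P) n)ᵀ := by
  induction n with
  | zero => simp [mpow]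
  | succ n ih => rw [mpow, ih, ← transpose_mul', ← opMatrix_pow, ← opMatrix_pow, ← opMatrix_mul,
      pow_succ']

theorem mexp_transpose_opMatrix (P : EllOne →L[ℂ] EllOne) :
    mexp (opMatrix P)ᵀ = (mexp (opMatrix P))ᵀ := by
  ext i k
  simp only [mexp, mpow_transpose_opMatrix]
  rfl

theorem expSummable_transpose_opMatrix (P : EllOne →L[ℂ] EllOne) :
    ExpSummable (opMatrix P)ᵀ := by
  refine ⟨fun n => ?_, fun i k => ?_⟩
  · rw [mpow_transpose_opMatrix, ← opMatrix_pow]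
    exact (mulSummable_opMatrix _ _).transpose
  · simp only [mpow_transpose_opMatrix]
    exact (expSummable_opMatrix P).2 k i

theorem mul_opMatrix_exp_neg (P : EllOne →L[ℂ] EllOne) :
    mul (opMatrix (NormedSpace.exp P)) (opMatrix (NormedSpace.exp (-P))) = 1 := by
  let := NormedAlgebra.restrictScalars ℚ ℂ (EllOne →L[ℂ] EllOne)
  rw [← opMatrix_mul, ← NormedSpace.exp_add_of_commute (Commute.refl P).neg_right, add_neg_cancel,
    NormedSpace.exp_zero, opMatrix_one]

/-- Conjugation by an invertible diagonal matrix passes through powers and the exponential. No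
convergence is assumed, since a scalar comes out of a `tsum` over a field in all cases. -/
theorem mexp_conj_apply {A B : Mat} {w : ℕ → ℂ} (hw : ∀ i, w i ≠ 0)
    (h : ∀ i k, w k * A i k = w i * B i k) (i k : ℕ) : w k * mexp A i k = w i * mexp B i k := by
  have hp : ∀ n i k, w k * mpow A n i k = w i * mpow B n i k := by
    intro n
    induction n with
    | zero =>
      intro i k
      by_cases hik : i = k
      · simp [mpow, hik]
      · simp [mpow, Matrix.one_apply_ne hik]
    | succ n ih =>
      intro i k
      simp only [mpow, mul_apply_eq, ← tsum_mul_left]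
      refine tsum_congr fun j => mul_left_cancel₀ (hw j) ?_
      linear_combination (w k * A j k) * ih i j + (w i * mpow B n i j) * h j k
  simp only [mexp, Matrix.of_apply, ← tsum_mul_left]
  refine tsum_congr fun n => ?_
  linear_combination ((n.factorial : ℂ)⁻¹) * hp n i k

/-- The pairing of summable sequences with a bounded sequence. -/
theorem exists_pairing {b : ℕ → ℂ} {C : ℝ} (hb : ∀ n, ‖b n‖ ≤ C) :
    ∃ φ : EllOne →L[ℂ] ℂ, ∀ x : EllOne, HasSum (fun n => x n * b n) (φ x) := by
  have hs : ∀ x : EllOne, Summable fun n => ‖x n * b n‖ := fun x =>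
    ((EllOne.summable_norm x).mul_right C).of_nonneg_of_le (fun _ => norm_nonneg _) fun n => by
      rw [norm_mul]
      exact mul_le_mul_of_nonneg_left (hb n) (norm_nonneg _)
  refine ⟨LinearMap.mkContinuous
    { toFun := fun x => ∑' n, x n * b n
      map_add' := fun x y => by
        rw [← (hs x).of_norm.tsum_add (hs y).of_norm]
        exact tsum_congr fun n => by rw [lp.coeFn_add, Pi.add_apply, add_mul]
      map_smul' := fun c x => by
        rw [RingHom.id_apply, smul_eq_mul, ← tsum_mul_left]
        exact tsum_congr fun n => by rw [lp.coeFn_smul, Pi.smul_apply, smul_eq_mul, mul_assoc] }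
    C fun x => ?_, fun x => (hs x).of_norm.hasSum⟩
  refine (norm_tsum_le_tsum_norm (hs x)).trans ?_
  rw [mul_comm, EllOne.norm_eq, ← tsum_mul_right]
  refine (hs x).tsum_le_tsum (fun n => ?_) ((EllOne.summable_norm x).mul_right C)
  rw [norm_mul]
  exact mul_le_mul_of_nonneg_left (hb n) (norm_nonneg _)

/-- The operator permuting the basis vectors of `ℓ¹(ℕ)`. -/
noncomputable def permOp (σ : ℕ ≃ ℕ) : EllOne →L[ℂ] EllOne :=
  LinearMap.mkContinuous
    { toFun := fun x => ⟨fun m => x (σ.symm m), memℓp_gen (by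
        simpa [Function.comp_def] using (EllOne.summable_norm x).comp_injective σ.symm.injective)⟩
      map_add' := fun x y => rfl
      map_smul' := fun c x => rfl } 1 fun x => by
    rw [one_mul, EllOne.norm_eq, EllOne.norm_eq]
    exact (σ.symm.tsum_eq fun n => ‖x n‖).le

theorem permOp_basisVec (σ : ℕ ≃ ℕ) (k : ℕ) : permOp σ (basisVec k) = basisVec (σ k) := by
  ext m
  change basisVec k (σ.symm m) = _
  rw [basisVec_apply, basisVec_apply, Matrix.one_apply, Matrix.one_apply]
  simp only [Equiv.symm_apply_eq]

theorem norm_permOp_le (σ : ℕ ≃ ℕ) : ‖permOp σ‖ ≤ 1 :=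
  LinearMap.mkContinuous_norm_le _ zero_le_one _

/-! ### The shift operator on $\ell^1$ and its exponentials -/

namespace Data

variable (d : Data)

/-- The operator of multiplication by `z`, on the coefficients of Laurent series. -/
noncomputable def shiftOp : EllOne →L[ℂ] EllOne :=
  permOp ((d.expoEquiv.trans (Equiv.addRight 1)).trans d.expoEquiv.symm)

theorem shiftOp_pow_basisVec (n k : ℕ) : (d.shiftOp ^ n) (basisVec k) = basisVec (d.shift n k) := by
  induction n generalizing k with
  | zero => rw [pow_zero, shift_zero]; rfl
  | succ n ih =>
    rw [pow_succ, mul_apply_eq_comp, shiftOp, permOp_basisVec, ← shiftOp]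
    have : ((d.expoEquiv.trans (Equiv.addRight 1)).trans d.expoEquiv.symm) k = d.shift 1 k := rfl
    rw [this, ih, shift_shift, add_comm]

theorem norm_shiftOp_pow_le (n : ℕ) : ‖d.shiftOp ^ n‖ ≤ 1 := by
  induction n with
  | zero => rw [pow_zero]; exact ContinuousLinearMap.norm_id_le
  | succ n ih =>
    rw [pow_succ]
    exact (norm_mul_le _ _).trans (mul_le_one₀ ih (norm_nonneg _) (norm_permOp_le _))

theorem opMatrix_shiftOp_pow (n : ℕ) : opMatrix (d.shiftOp ^ n) = mpow d.Upsᵀ n := by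
  ext i k
  rw [mpow_transpose_Ups, Matrix.transpose_apply, mpow_Ups_apply]
  change (d.shiftOp ^ n) (basisVec k) i = _
  rw [shiftOp_pow_basisVec, basisVec_apply, Matrix.one_apply]

/-- The generator `∑_j τ_j y^j U^j` of the deformation, `U` the shift operator. -/
noncomputable def gen (y : ℂ) (τ : ℕ+ → ℂ) : EllOne →L[ℂ] EllOne :=
  ∑' j : ℕ+, (τ j * y ^ (j : ℕ)) • d.shiftOp ^ (j : ℕ)

variable {d}

theorem summable_gen {y : ℂ} {τ : ℕ+ → ℂ} (h : Summable fun j : ℕ+ => ‖τ j‖ * ‖y‖ ^ (j : ℕ)) :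
    Summable fun j : ℕ+ => (τ j * y ^ (j : ℕ)) • d.shiftOp ^ (j : ℕ) := by
  refine Summable.of_norm_bounded h fun j => ?_
  rw [norm_smul, norm_mul, norm_pow]
  exact mul_le_of_le_one_right (by positivity) (d.norm_shiftOp_pow_le j)

theorem hasSum_opMatrix_gen {y : ℂ} {τ : ℕ+ → ℂ}
    (h : Summable fun j : ℕ+ => ‖τ j‖ * ‖y‖ ^ (j : ℕ)) (i k : ℕ) :
    HasSum (fun j : ℕ+ => τ j * y ^ (j : ℕ) * mpow d.Upsᵀ j i k) (opMatrix (d.gen y τ) i k) := by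
  refine ((summable_gen (d := d) h).hasSum.mapL (opEntry i k)).congr_fun fun j => ?_
  rw [map_smul, smul_eq_mul, opEntry_apply, opMatrix_shiftOp_pow]

theorem gen_update {y : ℂ} {τ : ℕ+ → ℂ} (h : Summable fun j : ℕ+ => ‖τ j‖ * ‖y‖ ^ (j : ℕ))
    (j : ℕ+) (s : ℂ) :
    d.gen y (Function.update τ j s) =
      d.gen y τ + (s - τ j) • (y ^ (j : ℕ) • d.shiftOp ^ (j : ℕ)) := by
  have h1 : HasSum (fun i : ℕ+ => if i = j then (s - τ j) • (y ^ (j : ℕ) • d.shiftOp ^ (j : ℕ))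
      else 0) ((s - τ j) • (y ^ (j : ℕ) • d.shiftOp ^ (j : ℕ))) := hasSum_ite_eq j _
  refine (((summable_gen (d := d) h).hasSum.add h1).congr_fun fun i => ?_).tsum_eq
  by_cases hi : i = j
  · subst hi
    rw [Function.update_self, if_pos rfl, smul_smul, ← add_smul]
    congr 1
    ring
  · rw [Function.update_of_ne hi, if_neg hi, add_zero]

theorem commute_gen (y : ℂ) (τ : ℕ+ → ℂ) (n : ℕ) : Commute (d.gen y τ) (d.shiftOp ^ n) :=
  Commute.tsum_left _ fun j => (Commute.pow_pow_self d.shiftOp j n).smul_left _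

theorem hasDerivAt_exp_gen {y : ℂ} {τ : ℕ+ → ℂ}
    (h : Summable fun j : ℕ+ => ‖τ j‖ * ‖y‖ ^ (j : ℕ)) (ε : ℂ) (j : ℕ+) :
    HasDerivAt (fun s => NormedSpace.exp (ε • d.gen y (Function.update τ j s)))
      (NormedSpace.exp (ε • d.gen y τ) * ((ε * y ^ (j : ℕ)) • d.shiftOp ^ (j : ℕ))) (τ j) := by
  set V : EllOne →L[ℂ] EllOne := (ε * y ^ (j : ℕ)) • d.shiftOp ^ (j : ℕ) with hV
  -- All generators are series in the same operator and commute, so changing one time multiplies the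
  -- exponential by a one-parameter group.
  have h1 : ∀ s, NormedSpace.exp (ε • d.gen y (Function.update τ j s)) =
      NormedSpace.exp (ε • d.gen y τ) * NormedSpace.exp ((s - τ j) • V) := by
    intro s
    let := NormedAlgebra.restrictScalars ℚ ℂ (EllOne →L[ℂ] EllOne)
    rw [← NormedSpace.exp_add_of_commute]
    · rw [gen_update h, smul_add, hV, smul_smul, smul_smul, smul_smul]
      congr 3
      ring
    · exact ((((commute_gen y τ j).smul_left ε).smul_right _)).smul_right _
  simp only [h1]
  have h2 : HasDerivAt (fun s => NormedSpace.exp ((s - τ j) • V)) V (τ j) := by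
    have h3 := hasDerivAt_exp_smul_const V (τ j - τ j)
    have h4 := HasDerivAt.scomp (𝕜 := ℂ) (h := fun s => s - τ j) (τ j) h3
      ((hasDerivAt_id (τ j)).sub_const (τ j))
    simpa [Function.comp_def] using h4
  exact h2.const_mul _

variable (d)

/-- The columns of `exp (ε ∑_j t_{aj} U^j)`, weighted by the powers of `y`. -/
noncomputable def expCol (a : Fin 2) (ε y : ℂ) (t : Times) (k : ℕ) : EllOne :=
  y ^ d.expo k • NormedSpace.exp (ε • d.gen y fun j => t (a, j)) (basisVec k)

variable {d}

/-- The factor $U^j$ moves the basis vector from place `k` to place `d.shift j k`, and $y^j$ adjusts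
the weight $y^{\mathrm{expo}\,k}$ to the new place. Hence the derivative is, up to $\varepsilon$,
another column of the same family. -/
theorem hasDerivAt_expCol {a : Fin 2} {ε y : ℂ} (hy : y ≠ 0) {t : Times}
    (h : Summable fun j : ℕ+ => ‖t (a, j)‖ * ‖y‖ ^ (j : ℕ)) (p : Fin 2 × ℕ+) (k : ℕ) :
    HasDerivAt (fun s => d.expCol a ε y (Function.update t p s) k)
      (if p.1 = a then ε • d.expCol a ε y t (d.shift p.2 k) else 0) (t p) := by
  obtain ⟨b, j⟩ := p
  by_cases hb : b = a
  · subst hb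
    have h1 : ∀ s, (fun i => Function.update t (b, j) s (b, i)) =
        Function.update (fun i => t (b, i)) j s := fun s => by
      ext i
      by_cases hi : i = j
      · subst hi; simp
      · rw [Function.update_of_ne (by simpa using hi), Function.update_of_ne hi]
    simp only [expCol, h1, if_true]
    have h2 := (hasDerivAt_exp_gen (d := d) h ε j).clm_apply
      (hasDerivAt_const (t (b, j)) (basisVec k))
    have h3 := h2.const_smul (y ^ d.expo k)
    refine h3.congr_deriv ?_
    rw [map_zero, add_zero, mul_apply_eq_comp, _root_.smul_apply,
      shiftOp_pow_basisVec, expo_shift, map_smul, smul_smul, smul_smul, zpow_add₀ hy, zpow_natCast]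
    congr 1
    ring
  · have h1 : ∀ s, (fun i => Function.update t (b, j) s (a, i)) = fun i => t (a, i) := fun s => by
      ext i
      rw [Function.update_of_ne]
      exact fun h' => hb (congrArg Prod.fst h').symm
    simp only [expCol, h1, hb, if_false]
    exact hasDerivAt_const _ _

theorem expCol_one (a : Fin 2) (ε : ℂ) (t : Times) (i k : ℕ) :
    d.expCol a ε 1 t k i = opMatrix (NormedSpace.exp (ε • d.gen 1 fun j => t (a, j))) i k := by
  rw [expCol, _root_.one_zpow, one_smul]
  rfl

/-- The generator at `y` is conjugate to the one at `1` by the diagonal matrix of the powers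
$y^{\mathrm{expo}\,i}$. As the left side is a vector of $\ell^1$, the unweighted column remains
summable after multiplication by the monomials. -/
theorem expCol_apply {a : Fin 2} {ε y : ℂ} (hy : y ≠ 0) {t : Times}
    (h : Summable fun j : ℕ+ => ‖t (a, j)‖ * ‖y‖ ^ (j : ℕ))
    (h' : Summable fun j : ℕ+ => ‖t (a, j)‖) (i k : ℕ) :
    d.expCol a ε y t k i = d.expCol a ε 1 t k i * y ^ d.expo i := by
  have h1 : Summable fun j : ℕ+ => ‖t (a, j)‖ * ‖(1 : ℂ)‖ ^ (j : ℕ) := by simpa using h'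
  have key := mexp_conj_apply (A := opMatrix (ε • d.gen y fun j => t (a, j)))
    (B := opMatrix (ε • d.gen 1 fun j => t (a, j))) (w := fun i => y ^ d.expo i)
    (fun i => zpow_ne_zero _ hy) (fun i k => by
      have e1 := (opEntry i k).map_smul ε (d.gen y fun j => t (a, j))
      have e2 := (opEntry i k).map_smul ε (d.gen 1 fun j => t (a, j))
      simp only [opEntry_apply, smul_eq_mul] at e1 e2
      rw [e1, e2, ← (hasSum_opMatrix_gen (d := d) h i k).tsum_eq,
        ← (hasSum_opMatrix_gen (d := d) h1 i k).tsum_eq]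
      simp only [← tsum_mul_left]
      refine tsum_congr fun j => ?_
      rw [mpow_transpose_Ups, Matrix.transpose_apply, mpow_Ups_apply]
      split_ifs with hi
      · rw [hi, expo_shift, zpow_add₀ hy, zpow_natCast, one_pow]
        ring
      · simp) i k
  rw [mexp_opMatrix, mexp_opMatrix] at key
  rw [expCol_one, mul_comm _ (y ^ _), ← key]
  rfl

end Data

/-! ### Interchange of summations -/

/-- Schur's bound: rows of `K` with uniformly bounded $\ell^1$ norm, weighted by a summable
sequence, give an absolutely summable double family. -/
theorem schur_tsum_comm (x : EllOne) {K : ℕ → ℕ → ℂ} {H : ℝ} (hs : ∀ m, Summable fun k => ‖K m k‖)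
    (hH : ∀ m, ∑' k, ‖K m k‖ ≤ H) :
    (Summable fun k => ∑' m, x m * K m k) ∧
      ∑' k, ∑' m, x m * K m k = ∑' m, x m * ∑' k, K m k := by
  have h1 : Summable fun q : ℕ × ℕ => ‖x q.1 * K q.1 q.2‖ := by
    refine (summable_prod_of_nonneg fun q => norm_nonneg _).2 ⟨fun m => ?_, ?_⟩
    · simpa only [norm_mul] using (hs m).mul_left ‖x m‖
    · refine ((EllOne.summable_norm x).mul_right H).of_nonneg_of_le
        (fun m => tsum_nonneg fun _ => norm_nonneg _) fun m => ?_
      simp only [norm_mul, tsum_mul_left]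
      exact mul_le_mul_of_nonneg_left (hH m) (norm_nonneg _)
  have h2 := h1.of_norm
  exact ⟨h2.prod_symm.prod, (Summable.tsum_comm (f := fun m k => x m * K m k) h2).trans
    (tsum_congr fun m => tsum_mul_left)⟩

/-- This is $(bQ)x=b(Qx)$ for a bounded row `b`: pairing with `b` after `Q` is continuous on
$\ell^1$, so it may be applied term by term to the expansion of `x` in the basis. -/
theorem hasSum_pairing_opMatrix {b : ℕ → ℂ} {C : ℝ} (hb : ∀ n, ‖b n‖ ≤ C)
    (Q : EllOne →L[ℂ] EllOne) (x : EllOne) :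
    HasSum (fun k => (∑' l, b l * opMatrix Q l k) * x k) (∑' l, b l * Q x l) := by
  obtain ⟨φ, hφ⟩ := exists_pairing hb
  have h1 : ∀ y : EllOne, φ y = ∑' l, b l * y l := fun y => by
    rw [← (hφ y).tsum_eq]
    exact tsum_congr fun _ => mul_comm _ _
  rw [← h1]
  refine ((EllOne.hasSum_basisVec x).mapL (φ.comp Q)).congr_fun fun k => ?_
  rw [map_smul, ContinuousLinearMap.comp_apply, h1, smul_eq_mul, mul_comm]
  rfl

/-- The matrix whose columns are all equal to `v`. -/
def constCol (v : ℕ → ℂ) : Mat := Matrix.of fun k _ => v k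

/-- The matrix whose rows are all equal to `v`. -/
def constRow (v : ℕ → ℂ) : Mat := Matrix.of fun _ k => v k

/-! ### Partial derivatives -/

theorem hasPartial_functional {F : Times → EllOne} {p : Fin 2 × ℕ+} {D : EllOne} {t : Times}
    (h : HasDerivAt (fun s => F (Function.update t p s)) D (t p)) (φ : EllOne →L[ℂ] ℂ) :
    HasPartial (fun t' => φ (F t')) p (φ D) t := φ.hasFDerivAt.comp_hasDerivAt (t p) h

theorem hasPartial_congr {F G : Times → ℂ} {p : Fin 2 × ℕ+} {D : ℂ} {t : Times}
    (h : HasPartial F p D t)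
    (he : ∀ᶠ s in 𝓝 (t p), G (Function.update t p s) = F (Function.update t p s)) :
    HasPartial G p D t := HasDerivAt.congr_of_eventuallyEq h he

theorem summable_update {t : Times} (ht : Summable fun p => ‖t p‖) (p : Fin 2 × ℕ+) (s : ℂ) :
    Summable fun q => ‖Function.update t p s q‖ := by
  refine (ht.update p ‖s‖).congr fun q => ?_
  by_cases h : q = p
  · subst h; simp
  · simp [Function.update_of_ne h]

theorem summable_weight_update {t : Times} {a : Fin 2} {r : ℝ}
    (ht : Summable fun j : ℕ+ => ‖t (a, j)‖ * r ^ (j : ℕ)) (p : Fin 2 × ℕ+) (s : ℂ) :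
    Summable fun j : ℕ+ => ‖Function.update t p s (a, j)‖ * r ^ (j : ℕ) := by
  refine (ht.update p.2 (‖Function.update t p s (a, p.2)‖ * r ^ (p.2 : ℕ))).congr fun j => ?_
  by_cases h : j = p.2
  · subst h; simp
  · rw [Function.update_of_ne h, Function.update_of_ne]
    rintro rfl
    exact h rfl

theorem summable_times {t : Times} (ht : Summable fun p => ‖t p‖) (a : Fin 2) :
    Summable fun j : ℕ+ => ‖t (a, j)‖ :=
  ht.comp_injective (i := fun j : ℕ+ => (a, j)) fun _ _ h => congrArg Prod.snd h

theorem summable_times_one {t : Times} (ht : Summable fun p => ‖t p‖) (a : Fin 2) :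
    Summable fun j : ℕ+ => ‖t (a, j)‖ * ‖(1 : ℂ)‖ ^ (j : ℕ) := by
  simpa using summable_times ht a

namespace Data

variable {d : Data}

/-! ### The moment matrix -/

/-- On the circle conjugation is inversion, so `g` is a Toeplitz matrix in the exponents. Row and
column sums weighted by relative exponents then do not depend on the row or column. -/
theorem g_apply (i k : ℕ) : d.g i k = 2 * Real.pi * d.fourierCoeff (d.expo k - d.expo i) := by
  have hpi : (2 * (Real.pi : ℂ)) ≠ 0 := by
    simp [Real.pi_ne_zero]
  rw [fourierCoeff, mul_inv_cancel_left₀ hpi]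
  change d.μ.integral _ _ = _
  congr 1
  ext z
  have hz : (z : ℂ) ≠ 0 := z.coe_ne_zero
  have hc : (starRingEnd ℂ) (z : ℂ) = (z : ℂ)⁻¹ := by
    rw [← Circle.coe_inv_eq_conj, Circle.coe_inv]
  rw [chi, chi, map_zpow₀, hc, _root_.inv_zpow', ← zpow_add₀ hz]
  congr 1
  ring

variable (d) in
theorem exists_norm_g_le : ∃ C : ℝ, ∀ i k, ‖d.g i k‖ ≤ C := by
  refine ⟨‖ContinuousLinearMap.mul ℝ ℂ‖ *
    ENNReal.toReal (∫⁻ _, ENNReal.ofReal 1 ∂d.μ.variation), fun i k => ?_⟩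
  refine MeasureTheory.VectorMeasure.norm_integral_le_lintegral_norm.trans (le_of_eq ?_)
  congr 3
  ext z
  rw [norm_mul, RCLike.norm_conj, chi, chi, norm_zpow, norm_zpow, Circle.norm_coe, _root_.one_zpow,
    _root_.one_zpow, mul_one]

/-! ### The deformation matrices -/

/-- Differentiating a weighted row of $W_{1,0}$ shifts its index, exactly as left multiplication by
$\Upsilon^j$ does, and a bounded functional commutes with differentiation. The summand `0` brings
the result to the form required by `hasPartialM_S₁_mul`. -/
theorem hasPartialM_of_row {t : Times} {R : Times → Mat} {y : ℂ} (hy : y ≠ 0)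
    (hyt : Summable fun j : ℕ+ => ‖t (0, j)‖ * ‖y‖ ^ (j : ℕ)) (p : Fin 2 × ℕ+)
    (hR : ∀ k, ∃ φ : EllOne →L[ℂ] ℂ, ∀ s i, R (Function.update t p s) i k =
      φ (d.expCol 0 1 y (Function.update t p s) i)) :
    HasPartialM R p ((if p.1 = 0 then mul (mpow d.Ups p.2) (R t) else 0) + 0) t := by
  intro i k
  obtain ⟨φ, hφ⟩ := hR k
  have hφt : ∀ i, R t i k = φ (d.expCol 0 1 y t i) := fun i => by
    have := hφ (t p) i
    rwa [Function.update_eq_self] at this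
  have h := hasPartial_functional (F := fun t' => d.expCol 0 1 y t' i)
    (hasDerivAt_expCol (ε := 1) hy hyt p i) φ
  have h' : HasPartial (fun t' => R t' i k) p _ t :=
    hasPartial_congr h (Eventually.of_forall fun s => hφ s i)
  convert h' using 1
  rw [add_zero]
  split_ifs with hp
  · rw [mpow_Ups_mul, one_smul, hφt]
  · simp

/-- The dual statement, for columns of $W_{2,0}^{-1}$; the minus sign is the value $\varepsilon=-1$
of the inverse exponential. -/
theorem hasPartialM_of_col {t : Times} {R : Times → Mat} {y : ℂ} (hy : y ≠ 0)
    (hyt : Summable fun j : ℕ+ => ‖t (1, j)‖ * ‖y‖ ^ (j : ℕ)) (p : Fin 2 × ℕ+)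
    (hR : ∀ i, ∃ φ : EllOne →L[ℂ] ℂ, ∀ s k, R (Function.update t p s) i k =
      φ (d.expCol 1 (-1) y (Function.update t p s) k)) :
    HasPartialM R p ((if p.1 = 0 then 0 else -mul (R t) (mpow d.Upsᵀ p.2)) + 0) t := by
  intro i k
  obtain ⟨φ, hφ⟩ := hR i
  have hφt : ∀ k, R t i k = φ (d.expCol 1 (-1) y t k) := fun k => by
    have := hφ (t p) k
    rwa [Function.update_eq_self] at this
  have h := hasPartial_functional (F := fun t' => d.expCol 1 (-1) y t' k)
    (hasDerivAt_expCol (ε := -1) hy hyt p k) φ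
  have h' : HasPartial (fun t' => R t' i k) p _ t :=
    hasPartial_congr h (Eventually.of_forall fun s => hφ s k)
  convert h' using 1
  rw [add_zero]
  by_cases hp : p.1 = 0
  · simp [hp]
  · have hp1 : p.1 = 1 := by omega
    rw [if_neg hp, if_pos hp1, Matrix.neg_apply, mul_mpow_transpose_Ups, neg_one_smul, map_neg, hφt]

section

variable {t : Times} (ht : Summable fun p => ‖t p‖)
include ht

theorem A₂_eq : d.A₂ t = opMatrix (d.gen 1 fun j => t (1, j)) := by
  ext i k
  rw [← (hasSum_opMatrix_gen (d := d) (summable_times_one ht 1) i k).tsum_eq]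
  simp [A₂]

theorem A₁_eq : d.A₁ t = (opMatrix (d.gen 1 fun j => t (0, j)))ᵀ := by
  ext i k
  rw [Matrix.transpose_apply,
    ← (hasSum_opMatrix_gen (d := d) (summable_times_one ht 0) k i).tsum_eq]
  simp [A₁, mpow_transpose_Ups]

/-- `Ups` is the transpose of the matrix of $U$, so the rows of $W_{1,0}$ are the columns of an
exponential on $\ell^1$. This explains the opposite index order for $W_{2,0}$. -/
theorem W₁₀_apply (i k : ℕ) : d.W₁₀ t i k = d.expCol 0 1 1 t i k := by
  rw [W₁₀, A₁_eq ht, mexp_transpose_opMatrix, mexp_opMatrix, expCol_one, one_smul]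
  rfl

theorem W₁₀Inv_apply (i k : ℕ) : d.W₁₀Inv t i k = d.expCol 0 (-1) 1 t i k := by
  rw [W₁₀Inv, A₁_eq ht, ← Matrix.transpose_neg, ← opMatrix_neg, mexp_transpose_opMatrix,
    mexp_opMatrix, expCol_one, neg_one_smul]
  rfl

theorem W₂₀_apply (i k : ℕ) : d.W₂₀ t i k = d.expCol 1 1 1 t k i := by
  rw [W₂₀, A₂_eq ht, mexp_opMatrix, expCol_one, one_smul]

theorem W₂₀Inv_apply (i k : ℕ) : d.W₂₀Inv t i k = d.expCol 1 (-1) 1 t k i := by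
  rw [W₂₀Inv, A₂_eq ht, ← opMatrix_neg, mexp_opMatrix, expCol_one, neg_one_smul]

theorem W₁₀_mul_inv : mul (d.W₁₀ t) (d.W₁₀Inv t) = 1 := by
  rw [W₁₀, W₁₀Inv, A₁_eq ht, ← Matrix.transpose_neg, ← opMatrix_neg, mexp_transpose_opMatrix,
    mexp_transpose_opMatrix, mexp_opMatrix, mexp_opMatrix, ← transpose_mul']
  nth_rw 2 [← neg_neg (d.gen 1 fun j => t (0, j))]
  rw [mul_opMatrix_exp_neg, Matrix.transpose_one]

theorem W₁₀_inv_mul : mul (d.W₁₀Inv t) (d.W₁₀ t) = 1 := by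
  rw [W₁₀, W₁₀Inv, A₁_eq ht, ← Matrix.transpose_neg, ← opMatrix_neg, mexp_transpose_opMatrix,
    mexp_transpose_opMatrix, mexp_opMatrix, mexp_opMatrix, ← transpose_mul', mul_opMatrix_exp_neg,
    Matrix.transpose_one]

theorem W₂₀_mul_inv : mul (d.W₂₀ t) (d.W₂₀Inv t) = 1 := by
  rw [W₂₀, W₂₀Inv, A₂_eq ht, ← opMatrix_neg, mexp_opMatrix, mexp_opMatrix, mul_opMatrix_exp_neg]

theorem W₂₀_inv_mul : mul (d.W₂₀Inv t) (d.W₂₀ t) = 1 := by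
  rw [W₂₀, W₂₀Inv, A₂_eq ht, ← opMatrix_neg, mexp_opMatrix, mexp_opMatrix]
  nth_rw 2 [← neg_neg (d.gen 1 fun j => t (1, j))]
  rw [mul_opMatrix_exp_neg]

/-! ### The deformed moment matrix -/

theorem mulSummable_W₁₀_g : MulSummable (d.W₁₀ t) d.g := fun i k => by
  obtain ⟨C, hC⟩ := d.exists_norm_g_le
  obtain ⟨φ, hφ⟩ := exists_pairing (b := fun m => d.g m k) fun m => hC m k
  simpa only [W₁₀_apply ht] using (hφ (d.expCol 0 1 1 t i)).summable

theorem exists_norm_W₁₀_mul_g_le (i : ℕ) : ∃ C : ℝ, ∀ k, ‖mul (d.W₁₀ t) d.g i k‖ ≤ C := by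
  obtain ⟨C, hC⟩ := d.exists_norm_g_le
  refine ⟨‖d.expCol 0 1 1 t i‖ * C, fun k => ?_⟩
  simp only [mul_apply_eq, W₁₀_apply ht]
  have h := (EllOne.summable_norm (d.expCol 0 1 1 t i)).mul_right C
  rw [EllOne.norm_eq, ← tsum_mul_right]
  exact tsum_of_norm_bounded h.hasSum fun m => by
    rw [norm_mul]
    exact mul_le_mul_of_nonneg_left (hC m k) (norm_nonneg _)

theorem exists_norm_g_mul_W₂₀Inv_le (k : ℕ) : ∃ C : ℝ, ∀ i, ‖mul d.g (d.W₂₀Inv t) i k‖ ≤ C := by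
  obtain ⟨C, hC⟩ := d.exists_norm_g_le
  refine ⟨‖d.expCol 1 (-1) 1 t k‖ * C, fun i => ?_⟩
  simp only [mul_apply_eq, W₂₀Inv_apply ht]
  have h := (EllOne.summable_norm (d.expCol 1 (-1) 1 t k)).mul_right C
  rw [EllOne.norm_eq, ← tsum_mul_right]
  exact tsum_of_norm_bounded h.hasSum fun m => by
    rw [norm_mul, mul_comm]
    exact mul_le_mul_of_nonneg_left (hC i m) (norm_nonneg _)

/-- A row of $W_{1,0}$ and a column of $W_{2,0}^{-1}$ are summable and `g` is bounded, so the triple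
product may be bracketed either way. -/
theorem schur_gt (i k : ℕ) :
    (Summable fun l => mul (d.W₁₀ t) d.g i l * d.W₂₀Inv t l k) ∧
      ∑' l, mul (d.W₁₀ t) d.g i l * d.W₂₀Inv t l k =
        ∑' m, d.W₁₀ t i m * mul d.g (d.W₂₀Inv t) m k := by
  obtain ⟨C, hC⟩ := d.exists_norm_g_le
  set c := d.expCol 1 (-1) 1 t k with hc
  have hle : ∀ m l, ‖d.g m l * c l‖ ≤ C * ‖c l‖ := fun m l => by
    rw [norm_mul]
    exact mul_le_mul_of_nonneg_right (hC m l) (norm_nonneg _)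
  have hsum := (EllOne.summable_norm c).mul_left C
  have hs : ∀ m, Summable fun l => ‖d.g m l * c l‖ := fun m =>
    hsum.of_nonneg_of_le (fun _ => norm_nonneg _) (hle m)
  have key := schur_tsum_comm (d.expCol 0 1 1 t i) (K := fun m l => d.g m l * c l) hs
    fun m => (hs m).tsum_le_tsum (hle m) hsum
  simpa only [mul_apply_eq, W₁₀_apply ht, W₂₀Inv_apply ht, ← hc, ← tsum_mul_right, mul_assoc]
    using key

theorem mulSummable_W₁₀_g_W₂₀Inv : MulSummable (mul (d.W₁₀ t) d.g) (d.W₂₀Inv t) :=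
  fun i k => (schur_gt ht i k).1

theorem gt_eq : d.gt t = mul (d.W₁₀ t) (mul d.g (d.W₂₀Inv t)) := by
  ext i k
  exact (schur_gt ht i k).2

theorem mulSummable_W₁₀_g_mul : MulSummable (d.W₁₀ t) (mul d.g (d.W₂₀Inv t)) := fun i k => by
  obtain ⟨C, hC⟩ := exists_norm_g_mul_W₂₀Inv_le (d := d) ht k
  obtain ⟨φ, hφ⟩ := exists_pairing hC
  simpa only [W₁₀_apply ht] using (hφ (d.expCol 0 1 1 t i)).summable

/-- The row of $W_{1,0}g$ is bounded and the column of $W_{2,0}$ lies in $\ell^1$, so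
`hasSum_pairing_opMatrix` with the operator of $W_{2,0}^{-1}$ justifies cancelling the two
exponentials. -/
theorem hasSum_gt_mul_W₂₀ (i k : ℕ) :
    HasSum (fun l => d.gt t i l * d.W₂₀ t l k) (mul (d.W₁₀ t) d.g i k) := by
  obtain ⟨C, hC⟩ := exists_norm_W₁₀_mul_g_le (d := d) ht i
  set Q := NormedSpace.exp ((-1 : ℂ) • d.gen 1 fun j => t (1, j)) with hQ
  have hQ1 : opMatrix Q = d.W₂₀Inv t := by
    ext l m
    rw [W₂₀Inv_apply ht, expCol_one]
  have h := hasSum_pairing_opMatrix hC Q (d.expCol 1 1 1 t k)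
  have h2 : ∀ l, Q (d.expCol 1 1 1 t k) l = (1 : Mat) l k := fun l => by
    rw [← W₂₀_inv_mul (d := d) ht, ← (hasSum_opMatrix Q _ l).tsum_eq, hQ1]
    simp only [mul_apply_eq, W₂₀_apply ht]
  simp only [h2, hQ1, ← W₂₀_apply ht] at h
  have h3 := mul_one' (mul (d.W₁₀ t) d.g)
  rw [← h3]
  exact h

theorem mulSummable_gt_W₂₀ : MulSummable (d.gt t) (d.W₂₀ t) :=
  fun i k => (hasSum_gt_mul_W₂₀ ht i k).summable

theorem gt_mul_W₂₀ : mul (d.gt t) (d.W₂₀ t) = mul (d.W₁₀ t) d.g := by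
  ext i k
  exact (hasSum_gt_mul_W₂₀ ht i k).tsum_eq

theorem hasSum_W₁₀Inv_mul_gt (i k : ℕ) :
    HasSum (fun l => d.W₁₀Inv t i l * d.gt t l k) (mul d.g (d.W₂₀Inv t) i k) := by
  obtain ⟨C, hC⟩ := exists_norm_g_mul_W₂₀Inv_le (d := d) ht k
  set Q := NormedSpace.exp ((1 : ℂ) • d.gen 1 fun j => t (0, j)) with hQ
  have hQ1 : opMatrix Q = (d.W₁₀ t)ᵀ := by
    ext l m
    rw [Matrix.transpose_apply, W₁₀_apply ht, expCol_one]
  have h := hasSum_pairing_opMatrix hC Q (d.expCol 0 (-1) 1 t i)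
  have h2 : ∀ l, Q (d.expCol 0 (-1) 1 t i) l = (1 : Mat) i l := fun l => by
    rw [← W₁₀_inv_mul (d := d) ht, ← (hasSum_opMatrix Q _ l).tsum_eq, hQ1]
    simp only [mul_apply_eq, W₁₀Inv_apply ht, Matrix.transpose_apply, mul_comm]
  simp only [h2, hQ1, ← W₁₀Inv_apply ht] at h
  have h3 := one_mul' (mul d.g (d.W₂₀Inv t))
  rw [← h3, gt_eq ht]
  simp only [mul_apply_eq (1 : Mat), mul_apply_eq (d.W₁₀ t)]
  simpa only [Matrix.transpose_apply, mul_comm] using h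

theorem mulSummable_W₁₀Inv_gt : MulSummable (d.W₁₀Inv t) (d.gt t) :=
  fun i k => (hasSum_W₁₀Inv_mul_gt ht i k).summable

theorem W₁₀Inv_mul_gt : mul (d.W₁₀Inv t) (d.gt t) = mul d.g (d.W₂₀Inv t) := by
  ext i k
  exact (hasSum_W₁₀Inv_mul_gt ht i k).tsum_eq

/-! ### Derivatives of the deformed matrices -/

theorem hasPartialM_W₁₀ (p : Fin 2 × ℕ+) :
    HasPartialM d.W₁₀ p ((if p.1 = 0 then mul (mpow d.Ups p.2) (d.W₁₀ t) else 0) + 0) t :=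
  hasPartialM_of_row one_ne_zero (summable_times_one ht 0) p fun k =>
    ⟨lp.evalCLM ℂ (fun _ : ℕ => ℂ) 1 k, fun s i => W₁₀_apply (summable_update ht p s) i k⟩

theorem hasPartialM_W₂₀Inv (p : Fin 2 × ℕ+) :
    HasPartialM d.W₂₀Inv p
      ((if p.1 = 0 then 0 else -mul (d.W₂₀Inv t) (mpow d.Upsᵀ p.2)) + 0) t :=
  hasPartialM_of_col one_ne_zero (summable_times_one ht 1) p fun i =>
    ⟨lp.evalCLM ℂ (fun _ : ℕ => ℂ) 1 i, fun s k => W₂₀Inv_apply (summable_update ht p s) i k⟩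

theorem hasPartialM_W₁₀_mul_g (p : Fin 2 × ℕ+) :
    HasPartialM (fun t' => mul (d.W₁₀ t') d.g) p
      ((if p.1 = 0 then mul (mpow d.Ups p.2) (mul (d.W₁₀ t) d.g) else 0) + 0) t :=
  hasPartialM_of_row one_ne_zero (summable_times_one ht 0) p fun k => by
    obtain ⟨C, hC⟩ := d.exists_norm_g_le
    obtain ⟨φ, hφ⟩ := exists_pairing (b := fun m => d.g m k) fun m => hC m k
    refine ⟨φ, fun s i => ?_⟩
    rw [← (hφ _).tsum_eq]
    simp only [mul_apply_eq, W₁₀_apply (summable_update ht p s)]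

theorem hasPartialM_g_mul_W₂₀Inv (p : Fin 2 × ℕ+) :
    HasPartialM (fun t' => mul d.g (d.W₂₀Inv t')) p
      ((if p.1 = 0 then 0 else -mul (mul d.g (d.W₂₀Inv t)) (mpow d.Upsᵀ p.2)) + 0) t :=
  hasPartialM_of_col one_ne_zero (summable_times_one ht 1) p fun i => by
    obtain ⟨C, hC⟩ := d.exists_norm_g_le
    obtain ⟨φ, hφ⟩ := exists_pairing (b := fun m => d.g i m) fun m => hC i m
    refine ⟨φ, fun s k => ?_⟩
    rw [← (hφ _).tsum_eq]
    simp only [mul_apply_eq, W₂₀Inv_apply (summable_update ht p s), mul_comm]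

/-- A time $t_{1j}$ enters only $W_{1,0}$ and a time $t_{2j}$ only $W_{2,0}^{-1}$. In each case the
triple product is bracketed so that the moving factor is paired with a fixed bounded vector. -/
theorem hasPartialM_gt (p : Fin 2 × ℕ+) :
    HasPartialM d.gt p ((if p.1 = 0 then mul (mpow d.Ups p.2) (d.gt t) else 0) +
      (if p.1 = 0 then 0 else -mul (d.gt t) (mpow d.Upsᵀ p.2))) t := by
  by_cases hp : p.1 = 0
  · have h := hasPartialM_of_row (d := d) (R := d.gt) one_ne_zero (summable_times_one ht 0) p
      fun k => by
        obtain ⟨C, hC⟩ := exists_norm_g_mul_W₂₀Inv_le (d := d) ht k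
        obtain ⟨φ, hφ⟩ := exists_pairing hC
        refine ⟨φ, fun s i => ?_⟩
        have h2 : d.W₂₀Inv (Function.update t p s) = d.W₂₀Inv t := by
          have : d.A₂ (Function.update t p s) = d.A₂ t := by
            ext i k
            refine tsum_congr fun j => ?_
            rw [Function.update_of_ne]
            rintro rfl
            exact absurd hp (by simp)
          rw [W₂₀Inv, W₂₀Inv, this]
        rw [gt_eq (summable_update ht p s), h2, ← (hφ _).tsum_eq]
        simp only [mul_apply_eq (d.W₁₀ _), W₁₀_apply (summable_update ht p s)]
    simpa only [hp, if_true] using h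
  · have h := hasPartialM_of_col (d := d) (R := d.gt) one_ne_zero (summable_times_one ht 1) p
      fun i => by
        obtain ⟨C, hC⟩ := exists_norm_W₁₀_mul_g_le (d := d) ht i
        obtain ⟨φ, hφ⟩ := exists_pairing hC
        refine ⟨φ, fun s k => ?_⟩
        have h2 : d.W₁₀ (Function.update t p s) = d.W₁₀ t := by
          have : d.A₁ (Function.update t p s) = d.A₁ t := by
            ext i k
            refine tsum_congr fun j => ?_
            rw [Function.update_of_ne]
            rintro rfl
            exact hp rfl
          rw [W₁₀, W₁₀, this]
        rw [gt, h2, ← (hφ _).tsum_eq]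
        simp only [mul_apply_eq (mul _ _), W₂₀Inv_apply (summable_update ht p s), mul_comm]
    simpa only [hp, if_false, add_zero, zero_add] using h

end

end Data

/-! ### Uniqueness in triangular systems; powers of conjugated matrices -/

/-- Row `l` has `l` free entries, and its first `l` equations form a square system with the leading
block as matrix. -/
theorem eq_zero_of_strictLowerTri_mul {X g : Mat} (hX : StrictLowerTri X) {l : ℕ}
    (hl : (trunc g l).det ≠ 0) (h : ∀ k < l, mul X g l k = 0) (k : ℕ) : X l k = 0 := by
  rcases le_or_gt l k with hk | hk
  · exact hX l k hk
  have h1 : Matrix.vecMul (fun j : Fin l => X l j) (trunc g l) = 0 := by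
    ext m
    have h2 := h m m.2
    rw [hX.lowerTri.mul_apply, Finset.sum_range_succ, hX l l le_rfl, zero_mul, add_zero,
      ← Fin.sum_univ_eq_sum_range (fun i => X l i * g i m)] at h2
    exact h2
  exact congrFun (Matrix.eq_zero_of_vecMul_eq_zero hl h1) ⟨k, hk⟩

/-- The diagonal entry is free here, so column `l` has `l + 1` unknowns and the block has size `l +
1`. -/
theorem eq_zero_of_mul_upperTri {X g : Mat} (hX : UpperTri X) {l : ℕ}
    (hl : (trunc g (l + 1)).det ≠ 0) (h : ∀ i ≤ l, mul g X i l = 0) (k : ℕ) : X k l = 0 := by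
  rcases lt_or_ge l k with hk | hk
  · exact hX k l hk
  have h1 : (trunc g (l + 1)).mulVec (fun j : Fin (l + 1) => X j l) = 0 := by
    ext m
    have h2 := h m (Nat.lt_succ_iff.1 m.2)
    rw [hX.mul_apply, ← Fin.sum_univ_eq_sum_range (fun i => g m i * X i l)] at h2
    exact h2
  exact congrFun (Matrix.eq_zero_of_mulVec_eq_zero hl h1) ⟨k, Nat.lt_succ_of_le hk⟩

theorem mpow_conj_of_rowFinite {S U S' : Mat} (hS : RowFinite S) (hU : RowFinite U)
    (hS' : RowFinite S') (h : mul S S' = 1) (h' : mul S' S = 1) (n : ℕ) :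
    mpow (mul (mul S U) S') n = mul (mul S (mpow U n)) S' := by
  induction n with
  | zero => rw [mpow, mpow, mul_one', h]
  | succ n ih =>
    have e1 : mul S' (mul (mul S U) S') = mul U S' := by
      rw [mul_assoc_of_rowFinite hS (.of_rowFinite hU _),
        ← mul_assoc_of_rowFinite hS' (.of_rowFinite hS _), h', one_mul']
    rw [mpow, ih, mul_assoc_of_rowFinite (hS.mul (hU.mpow n)) (.of_rowFinite hS' _), e1, mpow,
      ← mul_assoc_of_rowFinite (hS.mul (hU.mpow n)) (.of_rowFinite hU _),
      mul_assoc_of_rowFinite hS (.of_rowFinite (hU.mpow n) _)]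

theorem mpow_conj_of_colFinite {S U S' : Mat} (hS : ColFinite S) (hU : ColFinite U)
    (hS' : ColFinite S') (h : mul S S' = 1) (h' : mul S' S = 1) (n : ℕ) :
    mpow (mul (mul S U) S') n = mul (mul S (mpow U n)) S' := by
  induction n with
  | zero => rw [mpow, mpow, mul_one', h]
  | succ n ih =>
    have e1 : mul S' (mul (mul S U) S') = mul U S' := by
      rw [← mul_assoc_of_colFinite hS' (.of_colFinite _ (hS.mul hU)),
        ← mul_assoc_of_colFinite hU (.of_colFinite _ hS), h', one_mul']
    rw [mpow, ih, mul_assoc_of_colFinite ((hS.mul hU).mul hS') (.of_colFinite _ hS'), e1, mpow,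
      ← mul_assoc_of_colFinite hS' (.of_colFinite _ hU),
      mul_assoc_of_colFinite hU (.of_colFinite _ (hU.mpow n))]

namespace Data

variable {d : Data} {t : Times}

theorem B_of_eq {p : Fin 2 × ℕ+} (hp : p.1 = 0) (t : Times) :
    d.B p t = upper (mpow (d.L₁ t) p.2) := if_pos hp

theorem B_of_ne {p : Fin 2 × ℕ+} (hp : p.1 ≠ 0) (t : Times) :
    d.B p t = strictLower (mpow (d.L₂ t) p.2) := if_neg hp

theorem lowerTri_S₁ (t : Times) : LowerTri (d.S₁ t) := lowerTri_gaussS₁ _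

theorem lowerTri_S₁Inv (t : Times) : LowerTri (d.S₁Inv t) := lowerTri_gaussS₁Inv _

theorem upperTri_S₂ (t : Times) : UpperTri (d.S₂ t) := upperTri_gaussS₂ _

theorem upperTri_S₂Inv (t : Times) : UpperTri (d.S₂Inv t) := upperTri_gaussS₂Inv _

theorem rowFinite_S₁ (t : Times) : RowFinite (d.S₁ t) := (lowerTri_S₁ t).rowFinite

theorem rowFinite_S₁Inv (t : Times) : RowFinite (d.S₁Inv t) := (lowerTri_S₁Inv t).rowFinite

theorem colFinite_S₂ (t : Times) : ColFinite (d.S₂ t) := (upperTri_S₂ t).colFinite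

theorem colFinite_S₂Inv (t : Times) : ColFinite (d.S₂Inv t) := (upperTri_S₂Inv t).colFinite

theorem rowFinite_L₁ (t : Times) : RowFinite (d.L₁ t) :=
  ((rowFinite_S₁ t).mul d.rowFinite_Ups).mul (rowFinite_S₁Inv t)

theorem colFinite_L₂ (t : Times) : ColFinite (d.L₂ t) :=
  ((colFinite_S₂ t).mul (colFinite_transpose.2 d.rowFinite_Ups)).mul (colFinite_S₂Inv t)

theorem rowFinite_B (p : Fin 2 × ℕ+) (t : Times) : RowFinite (d.B p t) := by
  by_cases hp : p.1 = 0
  · rw [B_of_eq hp]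
    exact ((rowFinite_L₁ t).mpow _).upper
  · rw [B_of_ne hp]
    exact (strictLowerTri_strictLower _).lowerTri.rowFinite

theorem colFinite_B (p : Fin 2 × ℕ+) (t : Times) : ColFinite (d.B p t) := by
  by_cases hp : p.1 = 0
  · rw [B_of_eq hp]
    exact (upperTri_upper _).colFinite
  · rw [B_of_ne hp]
    exact ((colFinite_L₂ t).mpow _).strictLower

section

variable (hg : NonzeroMinors (d.gt t))
include hg

theorem isGaussBorel : IsGaussBorel (d.gt t) (d.S₁ t) (d.S₁Inv t) (d.S₂ t) (d.S₂Inv t) :=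
  isGaussBorel_gauss hg

theorem mpow_L₁ (n : ℕ) : mpow (d.L₁ t) n = mul (mul (d.S₁ t) (mpow d.Ups n)) (d.S₁Inv t) :=
  mpow_conj_of_rowFinite (rowFinite_S₁ t) d.rowFinite_Ups (rowFinite_S₁Inv t)
    (isGaussBorel hg).mul_inv_one (isGaussBorel hg).inv_mul_one n

theorem mpow_L₂ (n : ℕ) : mpow (d.L₂ t) n = mul (mul (d.S₂ t) (mpow d.Upsᵀ n)) (d.S₂Inv t) :=
  mpow_conj_of_colFinite (colFinite_S₂ t) (colFinite_transpose.2 d.rowFinite_Ups)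
    (colFinite_S₂Inv t) (isGaussBorel hg).mul_inv_two (isGaussBorel hg).inv_mul_two n

theorem mpow_L₁_mul_S₁ (n : ℕ) : mul (mpow (d.L₁ t) n) (d.S₁ t) = mul (d.S₁ t) (mpow d.Ups n) := by
  rw [mpow_L₁ hg, mul_assoc_of_rowFinite ((rowFinite_S₁ t).mul (d.rowFinite_mpow_Ups n))
    (.of_rowFinite (rowFinite_S₁Inv t) _), (isGaussBorel hg).inv_mul_one, mul_one']

theorem S₁Inv_mul_mpow_L₁ (n : ℕ) :
    mul (d.S₁Inv t) (mpow (d.L₁ t) n) = mul (mpow d.Ups n) (d.S₁Inv t) := by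
  rw [mpow_L₁ hg, mul_assoc_of_rowFinite (rowFinite_S₁ t) (.of_rowFinite (d.rowFinite_mpow_Ups n) _),
    ← mul_assoc_of_rowFinite (rowFinite_S₁Inv t) (.of_rowFinite (rowFinite_S₁ t) _),
    (isGaussBorel hg).inv_mul_one, one_mul']

theorem mpow_L₂_mul_S₂ (n : ℕ) :
    mul (mpow (d.L₂ t) n) (d.S₂ t) = mul (d.S₂ t) (mpow d.Upsᵀ n) := by
  rw [mpow_L₂ hg, mul_assoc_of_colFinite (colFinite_S₂ t) (.of_colFinite _ (colFinite_S₂Inv t)),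
    (isGaussBorel hg).inv_mul_two, mul_one']

theorem S₂Inv_mul_mpow_L₂ (n : ℕ) :
    mul (d.S₂Inv t) (mpow (d.L₂ t) n) = mul (mpow d.Upsᵀ n) (d.S₂Inv t) := by
  rw [mpow_L₂ hg, ← mul_assoc_of_colFinite (colFinite_S₂Inv t)
      (.of_colFinite _ ((colFinite_S₂ t).mul (d.colFinite_mpow_transpose_Ups n))),
    ← mul_assoc_of_colFinite (d.colFinite_mpow_transpose_Ups n) (.of_colFinite _ (colFinite_S₂ t)),
    (isGaussBorel hg).inv_mul_two, one_mul']

theorem S₁_mul_gt : mul (d.S₁ t) (d.gt t) = d.S₂ t := gaussS₁_mul hg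

theorem gt_mul_S₂Inv : mul (d.gt t) (d.S₂Inv t) = d.S₁Inv t := mul_gaussS₂Inv hg

end

/-! ### Derivatives of the Gauss--Borel factors -/

/-- The derivative of `S₁` with respect to the time `p`. -/
noncomputable def dS₁ (d : Data) (p : Fin 2 × ℕ+) (t : Times) : Mat :=
  mul (d.B p t) (d.S₁ t) + if p.1 = 0 then -mul (d.S₁ t) (mpow d.Ups p.2) else 0

/-- The derivative of `S₂⁻¹` with respect to the time `p`. -/
noncomputable def dS₂Inv (d : Data) (p : Fin 2 × ℕ+) (t : Times) : Mat :=
  -mul (d.S₂Inv t) (d.B p t) + if p.1 = 0 then 0 else mul (mpow d.Upsᵀ p.2) (d.S₂Inv t)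

/-- The derivative of `g(t)` with respect to the time `p`. -/
noncomputable def dgt (d : Data) (p : Fin 2 × ℕ+) (t : Times) : Mat :=
  (if p.1 = 0 then mul (mpow d.Ups p.2) (d.gt t) else 0) +
    if p.1 = 0 then 0 else -mul (d.gt t) (mpow d.Upsᵀ p.2)

/-- For $t_{1j}$ the relation $S_1\Upsilon^j=L_1^jS_1$ turns the expression into $-(L_1^j)_-S_1$;
for $t_{2j}$ it is $(L_2^j)_-S_1$. -/
theorem strictLowerTri_dS₁ (hg : NonzeroMinors (d.gt t)) (p : Fin 2 × ℕ+) :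
    StrictLowerTri (d.dS₁ p t) := by
  have hS : LowerTri (d.S₁ t) := lowerTri_S₁ t
  by_cases hp : p.1 = 0
  · have h : d.dS₁ p t = -mul (strictLower (mpow (d.L₁ t) p.2)) (d.S₁ t) := by
      rw [dS₁, if_pos hp, ← mpow_L₁_mul_S₁ hg, B_of_eq hp]
      nth_rw 2 [← upper_add_strictLower (mpow (d.L₁ t) p.2)]
      rw [add_mul_of_summable (.of_rowFinite ((rowFinite_L₁ t).mpow _).upper _)
        (.of_rowFinite (strictLowerTri_strictLower _).lowerTri.rowFinite _)]
      abel
    intro i k hik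
    rw [h, Matrix.neg_apply, (strictLowerTri_strictLower _).mul hS i k hik, neg_zero]
  · rw [dS₁, if_neg hp, add_zero, B_of_ne hp]
    exact (strictLowerTri_strictLower _).mul hS

/-- For $t_{1j}$ the expression is $-S_2^{-1}(L_1^j)_+$; for $t_{2j}$ the relation
$(\Upsilon^\top)^jS_2^{-1}=S_2^{-1}L_2^j$ gives $S_2^{-1}(L_2^j)_+$. -/
theorem upperTri_dS₂Inv (hg : NonzeroMinors (d.gt t)) (p : Fin 2 × ℕ+) :
    UpperTri (d.dS₂Inv p t) := by
  have hS : UpperTri (d.S₂Inv t) := upperTri_gaussS₂Inv _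
  by_cases hp : p.1 = 0
  · rw [dS₂Inv, if_pos hp, add_zero, B_of_eq hp]
    intro i k hik
    rw [Matrix.neg_apply, hS.mul (upperTri_upper _) i k hik, neg_zero]
  · have h : d.dS₂Inv p t = mul (d.S₂Inv t) (upper (mpow (d.L₂ t) p.2)) := by
      rw [dS₂Inv, if_neg hp, ← S₂Inv_mul_mpow_L₂ hg, B_of_ne hp]
      nth_rw 2 [← upper_add_strictLower (mpow (d.L₂ t) p.2)]
      rw [mul_add_of_summable (.of_colFinite _ (upperTri_upper _).colFinite)
        (.of_colFinite _ ((colFinite_L₂ t).mpow _).strictLower)]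
      abel
    rw [h]
    exact hS.mul (upperTri_upper _)

/-- The candidate satisfies the differentiated form of "$S_1g(t)$ vanishes below the diagonal". The
total is $(L_1^j)_+S_2$ for $t_{1j}$ and $-(L_2^j)_+S_2$ for $t_{2j}$, both upper triangular. -/
theorem dS₁_mul_gt (hg : NonzeroMinors (d.gt t)) (p : Fin 2 × ℕ+) {l k : ℕ} (hk : k < l) :
    mul (d.dS₁ p t) (d.gt t) l k + mul (d.S₁ t) (d.dgt p t) l k = 0 := by
  have hT : UpperTri (d.S₂ t) := upperTri_gaussS₂ _
  have e1 : mul (mul (d.B p t) (d.S₁ t)) (d.gt t) = mul (d.B p t) (d.S₂ t) := by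
    rw [mul_assoc_of_rowFinite (rowFinite_B p t) (.of_rowFinite (rowFinite_S₁ t) _), S₁_mul_gt hg]
  by_cases hp : p.1 = 0
  · have h : mul (d.dS₁ p t) (d.gt t) + mul (d.S₁ t) (d.dgt p t) = mul (d.B p t) (d.S₂ t) := by
      rw [dS₁, dgt, if_pos hp, if_pos hp, if_pos hp, add_zero, add_mul_of_summable
        (.of_rowFinite ((rowFinite_B p t).mul (rowFinite_S₁ t)) _)
        (.of_rowFinite ((rowFinite_S₁ t).mul (d.rowFinite_mpow_Ups _)).neg _), e1, neg_mul',
        mul_assoc_of_rowFinite (rowFinite_S₁ t) (.of_rowFinite (d.rowFinite_mpow_Ups _) _)]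
      abel
    rw [← Matrix.add_apply, h, B_of_eq hp]
    exact (upperTri_upper _).mul hT l k hk
  · have h : mul (d.dS₁ p t) (d.gt t) + mul (d.S₁ t) (d.dgt p t) =
        -mul (upper (mpow (d.L₂ t) p.2)) (d.S₂ t) := by
      rw [dS₁, dgt, if_neg hp, if_neg hp, if_neg hp, add_zero, zero_add, e1, mul_neg',
        ← mul_assoc_of_colFinite (d.colFinite_mpow_transpose_Ups _)
          (.of_rowFinite (rowFinite_S₁ t) _), S₁_mul_gt hg, ← mpow_L₂_mul_S₂ hg, B_of_ne hp]
      nth_rw 2 [← upper_add_strictLower (mpow (d.L₂ t) p.2)]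
      rw [add_mul_of_summable (.of_colFinite _ hT.colFinite) (.of_colFinite _ hT.colFinite)]
      abel
    rw [← Matrix.add_apply, h, Matrix.neg_apply, (upperTri_upper _).mul hT l k hk, neg_zero]

/-- The total is $S_1^{-1}(L_1^j)_-$ for $t_{1j}$ and $-S_1^{-1}(L_2^j)_-$ for $t_{2j}$, both
strictly lower triangular. -/
theorem gt_mul_dS₂Inv (hg : NonzeroMinors (d.gt t)) (p : Fin 2 × ℕ+) {i l : ℕ} (hi : i ≤ l) :
    mul (d.gt t) (d.dS₂Inv p t) i l + mul (d.dgt p t) (d.S₂Inv t) i l = 0 := by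
  have hS : LowerTri (d.S₁Inv t) := lowerTri_gaussS₁Inv _
  have e1 : mul (d.gt t) (mul (d.S₂Inv t) (d.B p t)) = mul (d.S₁Inv t) (d.B p t) := by
    rw [← mul_assoc_of_colFinite (colFinite_B p t) (.of_colFinite _ (colFinite_S₂Inv t)),
      gt_mul_S₂Inv hg]
  by_cases hp : p.1 = 0
  · have h : mul (d.gt t) (d.dS₂Inv p t) + mul (d.dgt p t) (d.S₂Inv t) =
        mul (d.S₁Inv t) (strictLower (mpow (d.L₁ t) p.2)) := by
      rw [dS₂Inv, dgt, if_pos hp, if_pos hp, if_pos hp, add_zero, add_zero, mul_neg', e1,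
        mul_assoc_of_rowFinite (d.rowFinite_mpow_Ups _) (.of_colFinite _ (colFinite_S₂Inv t)),
        gt_mul_S₂Inv hg, ← S₁Inv_mul_mpow_L₁ hg, B_of_eq hp]
      nth_rw 2 [← upper_add_strictLower (mpow (d.L₁ t) p.2)]
      rw [mul_add_of_summable (.of_rowFinite hS.rowFinite _) (.of_rowFinite hS.rowFinite _)]
      abel
    rw [← Matrix.add_apply, h]
    exact hS.mul_strict (strictLowerTri_strictLower _) i l hi
  · have h : mul (d.gt t) (d.dS₂Inv p t) + mul (d.dgt p t) (d.S₂Inv t) =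
        -mul (d.S₁Inv t) (d.B p t) := by
      have hU := d.colFinite_mpow_transpose_Ups p.2
      rw [dS₂Inv, dgt, if_neg hp, if_neg hp, if_neg hp, zero_add, neg_mul', mul_add_of_summable
        (.of_colFinite _ ((colFinite_S₂Inv t).mul (colFinite_B p t)).neg)
        (.of_colFinite _ (hU.mul (colFinite_S₂Inv t))), mul_neg', e1,
        mul_assoc_of_colFinite (colFinite_S₂Inv t) (.of_colFinite _ hU)]
      abel
    rw [← Matrix.add_apply, h, B_of_ne hp, Matrix.neg_apply,
      hS.mul_strict (strictLowerTri_strictLower _) i l hi, neg_zero]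

theorem hasDerivAt_gt (ht : Summable fun p => ‖t p‖) (p : Fin 2 × ℕ+) (i k : ℕ) :
    HasDerivAt (fun s => d.gt (Function.update t p s) i k) (d.dgt p t i k) (t p) :=
  hasPartialM_gt ht p i k

section

variable (ht : Summable fun p => ‖t p‖) (hg : NonzeroMinors (d.gt t))
include ht hg

theorem eventually_det_ne_zero (p : Fin 2 × ℕ+) (l : ℕ) :
    ∀ᶠ s in 𝓝 (t p), (trunc (d.gt (Function.update t p s)) l).det ≠ 0 :=
  eventually_det_trunc_ne_zero (g := fun s => d.gt (Function.update t p s))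
    (fun i j => (hasDerivAt_gt ht p i j).differentiableAt)
    (by rw [Function.update_eq_self]; exact hg l)

/-- Rationality gives existence of the derivative; its value is found by showing that it and `dS₁`
solve the same uniquely solvable triangular system. -/
theorem hasPartialM_S₁ (p : Fin 2 × ℕ+) : HasPartialM d.S₁ p (d.dS₁ p t) t := by
  have hdiff : ∀ l k, DifferentiableAt ℂ (fun s => d.S₁ (Function.update t p s) l k) (t p) :=
    fun l k => differentiableAt_gaussS₁ (g := fun s => d.gt (Function.update t p s))
      (fun i j => (hasDerivAt_gt ht p i j).differentiableAt)
      (by rw [Function.update_eq_self]; exact hg l) k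
  set D : Mat := Matrix.of fun l k => deriv (fun s => d.S₁ (Function.update t p s) l k) (t p) with hD
  have hDs : StrictLowerTri D := fun l k hlk => by
    have : (fun s => d.S₁ (Function.update t p s) l k) = fun _ => (1 : Mat) l k := by
      ext s
      rcases hlk.lt_or_eq with h | rfl
      · rw [Matrix.one_apply_ne h.ne]
        exact lowerTri_gaussS₁ _ l k h
      · rw [Matrix.one_apply_eq]
        exact gaussS₁_diag _ l
    rw [hD, Matrix.of_apply, this, deriv_const]
  have hD0 : ∀ l k, k < l → mul D (d.gt t) l k + mul (d.S₁ t) (d.dgt p t) l k = 0 := by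
    intro l k hk
    have h1 : HasDerivAt (fun s => ∑ i ∈ Finset.range (l + 1), d.S₁ (Function.update t p s) l i *
        d.gt (Function.update t p s) i k) (∑ i ∈ Finset.range (l + 1),
        (D l i * d.gt t i k + d.S₁ t l i * d.dgt p t i k)) (t p) := by
      refine HasDerivAt.fun_sum fun i _ => ?_
      have := (hdiff l i).hasDerivAt.mul (hasDerivAt_gt (d := d) ht p i k)
      rwa [Function.update_eq_self] at this
    -- Near `t` the entry vanishes as soon as the single minor of order `l` stays nonzero.
    have h2 : (fun s => ∑ i ∈ Finset.range (l + 1), d.S₁ (Function.update t p s) l i *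
        d.gt (Function.update t p s) i k) =ᶠ[𝓝 (t p)] fun _ => 0 := by
      filter_upwards [eventually_det_ne_zero ht hg p l] with s hs
      rw [← LowerTri.mul_apply (lowerTri_S₁ _)]
      exact gaussS₁_mul_of_lt hs hk
    rw [hDs.lowerTri.mul_apply, LowerTri.mul_apply (lowerTri_S₁ _), ← Finset.sum_add_distrib]
    exact h1.unique ((hasDerivAt_const (t p) (0 : ℂ)).congr_of_eventuallyEq h2)
  have hR := strictLowerTri_dS₁ hg p
  have hX : StrictLowerTri (D + -d.dS₁ p t) := fun i k hik => by
    rw [Matrix.add_apply, Matrix.neg_apply, hDs i k hik, hR i k hik, neg_zero, add_zero]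
  intro l k
  have h := eq_zero_of_strictLowerTri_mul hX (hg l) (fun k hk => by
    rw [add_mul_of_summable (.of_rowFinite hDs.lowerTri.rowFinite _)
      (.of_rowFinite hR.lowerTri.rowFinite.neg _), neg_mul', Matrix.add_apply, Matrix.neg_apply]
    linear_combination hD0 l k hk - dS₁_mul_gt hg p hk) k
  rw [Matrix.add_apply, Matrix.neg_apply, add_neg_eq_zero] at h
  rw [← h]
  exact (hdiff l k).hasDerivAt

theorem hasPartialM_S₂Inv (p : Fin 2 × ℕ+) : HasPartialM d.S₂Inv p (d.dS₂Inv p t) t := by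
  have hdiff : ∀ k l, DifferentiableAt ℂ (fun s => d.S₂Inv (Function.update t p s) k l) (t p) :=
    fun k l => differentiableAt_gaussS₂Inv (g := fun s => d.gt (Function.update t p s))
      (fun i j => (hasDerivAt_gt ht p i j).differentiableAt)
      (by rw [Function.update_eq_self]; exact hg (l + 1)) k
  set D : Mat := Matrix.of fun k l => deriv (fun s => d.S₂Inv (Function.update t p s) k l) (t p)
    with hD
  have hDs : UpperTri D := fun k l hkl => by
    have : (fun s => d.S₂Inv (Function.update t p s) k l) = fun _ => (0 : ℂ) := by
      ext s
      exact upperTri_gaussS₂Inv _ k l hkl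
    rw [hD, Matrix.of_apply, this, deriv_const]
  have hD0 : ∀ i l, i ≤ l → mul (d.gt t) D i l + mul (d.dgt p t) (d.S₂Inv t) i l = 0 := by
    intro i l hi
    have h1 : HasDerivAt (fun s => ∑ k ∈ Finset.range (l + 1), d.gt (Function.update t p s) i k *
        d.S₂Inv (Function.update t p s) k l) (∑ k ∈ Finset.range (l + 1),
        (d.dgt p t i k * d.S₂Inv t k l + d.gt t i k * D k l)) (t p) := by
      refine HasDerivAt.fun_sum fun k _ => ?_
      have := (hasDerivAt_gt (d := d) ht p i k).mul (hdiff k l).hasDerivAt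
      rwa [Function.update_eq_self] at this
    have h2 : (fun s => ∑ k ∈ Finset.range (l + 1), d.gt (Function.update t p s) i k *
        d.S₂Inv (Function.update t p s) k l) =ᶠ[𝓝 (t p)] fun _ => (1 : Mat) i l := by
      filter_upwards [eventually_det_ne_zero ht hg p (l + 1)] with s hs
      rw [← UpperTri.mul_apply (upperTri_S₂Inv _)]
      exact mul_gaussS₂Inv_of_le hs hi
    rw [hDs.mul_apply, UpperTri.mul_apply (upperTri_S₂Inv _), ← Finset.sum_add_distrib]
    simp only [add_comm (d.gt t i _ * _)]
    exact h1.unique ((hasDerivAt_const (t p) ((1 : Mat) i l)).congr_of_eventuallyEq h2)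
  have hR := upperTri_dS₂Inv hg p
  have hX : UpperTri (D + -d.dS₂Inv p t) := fun i k hik => by
    rw [Matrix.add_apply, Matrix.neg_apply, hDs i k hik, hR i k hik, neg_zero, add_zero]
  intro k l
  have h := eq_zero_of_mul_upperTri hX (hg (l + 1)) (fun i hi => by
    rw [mul_add_of_summable (.of_colFinite _ hDs.colFinite)
      (.of_colFinite _ hR.colFinite.neg), mul_neg', Matrix.add_apply, Matrix.neg_apply]
    linear_combination hD0 i l hi - gt_mul_dS₂Inv hg p hi) k
  rw [Matrix.add_apply, Matrix.neg_apply, add_neg_eq_zero] at h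
  rw [← h]
  exact (hdiff k l).hasDerivAt

/-- If `∂R = Υ^j R + D` for the times `t_{1j}` and `∂R = D` for the times `t_{2j}`, then
`∂(S₁ R) = B (S₁ R) + S₁ D`. -/
theorem hasPartialM_S₁_mul {R : Times → Mat} {D : Mat} {p : Fin 2 × ℕ+}
    (hR : HasPartialM R p ((if p.1 = 0 then mul (mpow d.Ups p.2) (R t) else 0) + D) t) :
    HasPartialM (fun t' => mul (d.S₁ t') (R t')) p
      (mul (d.B p t) (mul (d.S₁ t) (R t)) + mul (d.S₁ t) D) t := by
  intro l k
  have h1 : HasDerivAt (fun s => ∑ i ∈ Finset.range (l + 1), d.S₁ (Function.update t p s) l i *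
      R (Function.update t p s) i k) (∑ i ∈ Finset.range (l + 1), (d.dS₁ p t l i * R t i k +
      d.S₁ t l i * ((if p.1 = 0 then mul (mpow d.Ups p.2) (R t) else 0) + D) i k)) (t p) := by
    refine HasDerivAt.fun_sum fun i _ => ?_
    have := (hasPartialM_S₁ ht hg p l i).mul (hR i k)
    rwa [Function.update_eq_self] at this
  rw [Finset.sum_add_distrib, ← LowerTri.mul_apply (strictLowerTri_dS₁ hg p).lowerTri,
    ← LowerTri.mul_apply (lowerTri_S₁ _)] at h1
  -- For the times $t_{1j}$, the term $-S_1\Upsilon^jR$ coming from `dS₁` cancels $S_1\Upsilon^jR$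
  -- coming from the derivative of `R`.
  have h2 : mul (d.dS₁ p t) (R t) + mul (d.S₁ t)
      ((if p.1 = 0 then mul (mpow d.Ups p.2) (R t) else 0) + D) =
      mul (d.B p t) (mul (d.S₁ t) (R t)) + mul (d.S₁ t) D := by
    have hS := rowFinite_S₁ (d := d) t
    have hB := rowFinite_B (d := d) p t
    have hU := d.rowFinite_mpow_Ups p.2
    rw [dS₁, mul_add_of_summable (.of_rowFinite hS _) (.of_rowFinite hS _)]
    split_ifs with hp
    · rw [add_mul_of_summable (.of_rowFinite (hB.mul hS) _) (.of_rowFinite (hS.mul hU).neg _),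
        neg_mul', mul_assoc_of_rowFinite hS (.of_rowFinite hU _),
        mul_assoc_of_rowFinite hB (.of_rowFinite hS _)]
      abel
    · rw [add_zero, mul_zero', zero_add, mul_assoc_of_rowFinite hB (.of_rowFinite hS _)]
  rw [← h2]
  refine h1.congr_of_eventuallyEq (Eventually.of_forall fun s => ?_)
  exact LowerTri.mul_apply (lowerTri_S₁ _) _ _ _

/-- If `∂C = D` for the times `t_{1j}` and `∂C = -C (Υ^⊤)^j + D` for the times `t_{2j}`, then
`∂(C S₂⁻¹) = -(C S₂⁻¹) B + D S₂⁻¹`. -/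
theorem hasPartialM_mul_S₂Inv {C : Times → Mat} {D : Mat} {p : Fin 2 × ℕ+}
    (hC : HasPartialM C p ((if p.1 = 0 then 0 else -mul (C t) (mpow d.Upsᵀ p.2)) + D) t) :
    HasPartialM (fun t' => mul (C t') (d.S₂Inv t')) p
      (-mul (mul (C t) (d.S₂Inv t)) (d.B p t) + mul D (d.S₂Inv t)) t := by
  intro k l
  have h1 : HasDerivAt (fun s => ∑ i ∈ Finset.range (l + 1), C (Function.update t p s) k i *
      d.S₂Inv (Function.update t p s) i l) (∑ i ∈ Finset.range (l + 1),
      (((if p.1 = 0 then 0 else -mul (C t) (mpow d.Upsᵀ p.2)) + D) k i * d.S₂Inv t i l +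
      C t k i * d.dS₂Inv p t i l)) (t p) := by
    refine HasDerivAt.fun_sum fun i _ => ?_
    have := (hC k i).mul (hasPartialM_S₂Inv ht hg p i l)
    rwa [Function.update_eq_self] at this
  rw [Finset.sum_add_distrib, ← UpperTri.mul_apply (upperTri_dS₂Inv hg p),
    ← UpperTri.mul_apply (upperTri_S₂Inv _)] at h1
  have h2 : mul ((if p.1 = 0 then 0 else -mul (C t) (mpow d.Upsᵀ p.2)) + D) (d.S₂Inv t) +
      mul (C t) (d.dS₂Inv p t) =
      -mul (mul (C t) (d.S₂Inv t)) (d.B p t) + mul D (d.S₂Inv t) := by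
    have hS := colFinite_S₂Inv (d := d) t
    have hB := colFinite_B (d := d) p t
    have hU := d.colFinite_mpow_transpose_Ups p.2
    rw [dS₂Inv, add_mul_of_summable (.of_colFinite _ hS) (.of_colFinite _ hS)]
    split_ifs with hp
    · rw [add_zero, zero_mul', zero_add, mul_neg', ← mul_assoc_of_colFinite hB (.of_colFinite _ hS)]
      abel
    · rw [mul_add_of_summable (.of_colFinite _ (hS.mul hB).neg) (.of_colFinite _ (hU.mul hS)),
        neg_mul', mul_neg', ← mul_assoc_of_colFinite hS (.of_colFinite _ hU),
        ← mul_assoc_of_colFinite hB (.of_colFinite _ hS)]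
      abel
  rw [← h2]
  refine h1.congr_of_eventuallyEq (Eventually.of_forall fun s => ?_)
  exact UpperTri.mul_apply (upperTri_S₂Inv _) _ _ _

end

end Data

namespace Data

variable {d : Data}

/-! ### The deformed matrices applied to the monomials -/

theorem chi_ne_zero_mul {y : ℂ} (hy : y ≠ 0) (m k : ℕ) :
    y ^ d.expo m * y ^ (d.expo k - d.expo m) = d.chi y k := by
  rw [← zpow_add₀ hy, chi]
  congr 1
  ring

theorem conj_chi (z : ℂ) (k : ℕ) : (starRingEnd ℂ) (d.chi z k) = d.chi ((starRingEnd ℂ) z) k :=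
  map_zpow₀ _ _ _

theorem conj_chiStar (z : ℂ) (k : ℕ) :
    (starRingEnd ℂ) (d.chiStar z k) = d.chiStar ((starRingEnd ℂ) z) k := by
  rw [chiStar, chiStar, map_mul, conj_chi, map_inv₀]

variable (d) in
-- Summing against the monomials means summing the coordinates of the weighted vector `expCol`, so
-- pairing with the constant sequence `1` works for all `z` and `t`.
theorem exists_functional_chi : ∃ φ : EllOne →L[ℂ] ℂ,
    (∀ z : ℂ, z ≠ 0 → ∀ t : Times, (Summable fun p => ‖t p‖) →
      (Summable fun j : ℕ+ => ‖t (0, j)‖ * ‖z‖ ^ (j : ℕ)) → ∀ i,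
        HasSum (fun k => d.W₁₀ t i k * d.chi z k) (φ (d.expCol 0 1 z t i))) ∧
    (∀ z : ℂ, z ≠ 0 → ∀ t : Times, (Summable fun p => ‖t p‖) →
      (Summable fun j : ℕ+ => ‖t (1, j)‖ * ‖z‖ ^ (j : ℕ)) → ∀ i,
        HasSum (fun k => d.chi z k * d.W₂₀Inv t k i) (φ (d.expCol 1 (-1) z t i))) := by
  obtain ⟨φ, hφ⟩ := exists_pairing (b := fun _ => 1) (C := 1) (fun _ => by simp)
  refine ⟨φ, fun z hz t ht h i => ?_, fun z hz t ht h i => ?_⟩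
  · refine (hφ (d.expCol 0 1 z t i)).congr_fun fun k => ?_
    rw [mul_one, W₁₀_apply ht, expCol_apply hz h (summable_times ht 0)]
    rfl
  · refine (hφ (d.expCol 1 (-1) z t i)).congr_fun fun k => ?_
    rw [mul_one, W₂₀Inv_apply ht, expCol_apply hz h (summable_times ht 1), mul_comm]
    rfl

/-- Write $y^{\mathrm{expo}\,k}=y^{\mathrm{expo}\,m}\,y^{\mathrm{expo}\,k-\mathrm{expo}\,m}$. The
first factor weights the row of $W_{1,0}$; the second joins `g`, whose weighted absolute row sums
all equal the same series in the Fourier coefficients. -/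
theorem exists_functional_row {y : ℂ} (hy : y ≠ 0) (c : ℂ)
    (hc : Summable fun n : ℤ => ‖d.fourierCoeff n‖ * ‖y‖ ^ n) : ∃ φ : EllOne →L[ℂ] ℂ,
    ∀ t : Times, (Summable fun p => ‖t p‖) →
      (Summable fun j : ℕ+ => ‖t (0, j)‖ * ‖y‖ ^ (j : ℕ)) → ∀ i,
        HasSum (fun k => mul (d.W₁₀ t) d.g i k * (c * d.chi y k)) (φ (d.expCol 0 1 y t i)) := by
  set K : ℕ → ℕ → ℂ := fun m k => d.g m k * (c * y ^ (d.expo k - d.expo m)) with hK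
  set w : ℤ → ℝ := fun n => ‖2 * (Real.pi : ℂ)‖ * ‖c‖ * (‖d.fourierCoeff n‖ * ‖y‖ ^ n) with hw
  have hws : Summable w := hc.mul_left _
  have hn : ∀ m, (fun k => ‖K m k‖) = w ∘ (d.expoEquiv.trans (Equiv.subRight (d.expo m))) := by
    intro m
    ext k
    have e : (d.expoEquiv.trans (Equiv.subRight (d.expo m))) k = d.expo k - d.expo m := rfl
    simp only [hK, hw, Function.comp_apply, e, g_apply, norm_mul, norm_zpow]
    ring
  have hs : ∀ m, Summable fun k => ‖K m k‖ := fun m => by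
    rw [hn]
    exact (Equiv.summable_iff _).2 hws
  have ht : ∀ m, ∑' k, ‖K m k‖ = ∑' n, w n := fun m => by
    rw [hn]
    exact Equiv.tsum_eq _ w
  obtain ⟨φ, hφ⟩ := exists_pairing (b := fun m => ∑' k, K m k) (C := ∑' n, w n) fun m =>
    (norm_tsum_le_tsum_norm (hs m)).trans (ht m).le
  refine ⟨φ, fun t hts hty i => ?_⟩
  obtain ⟨h1, h2⟩ := schur_tsum_comm (d.expCol 0 1 y t i) hs fun m => (ht m).le
  have h3 := h1.hasSum
  rw [h2, (hφ _).tsum_eq] at h3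
  refine h3.congr_fun fun k => ?_
  rw [mul_apply_eq, ← tsum_mul_right]
  refine tsum_congr fun m => ?_
  rw [expCol_apply hy hty (summable_times hts 0), ← W₁₀_apply hts, ← chi_ne_zero_mul hy m k]
  simp only [hK]
  ring

theorem exists_functional_col {y : ℂ} (hy : y ≠ 0) (c : ℂ)
    (hc : Summable fun n : ℤ => ‖d.fourierCoeff n‖ * ‖y⁻¹‖ ^ n) : ∃ φ : EllOne →L[ℂ] ℂ,
    ∀ t : Times, (Summable fun p => ‖t p‖) →
      (Summable fun j : ℕ+ => ‖t (1, j)‖ * ‖y‖ ^ (j : ℕ)) → ∀ i,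
        HasSum (fun k => (c * d.chi y k) * mul d.g (d.W₂₀Inv t) k i)
          (φ (d.expCol 1 (-1) y t i)) := by
  set K : ℕ → ℕ → ℂ := fun m k => d.g k m * (c * y ^ (d.expo k - d.expo m)) with hK
  set w : ℤ → ℝ := fun n => ‖2 * (Real.pi : ℂ)‖ * ‖c‖ * (‖d.fourierCoeff n‖ * ‖y⁻¹‖ ^ n) with hw
  have hws : Summable w := hc.mul_left _
  have hn : ∀ m, (fun k => ‖K m k‖) = w ∘ (d.expoEquiv.trans (Equiv.subLeft (d.expo m))) := by
    intro m
    ext k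
    have e : (d.expoEquiv.trans (Equiv.subLeft (d.expo m))) k = d.expo m - d.expo k := rfl
    -- The moving vector is now a column index of `g`, so the Fourier index is the opposite
    -- difference and the weight becomes $|y|^{-n}$.
    have e' : ‖y‖ ^ (d.expo k - d.expo m) = ‖y⁻¹‖ ^ (d.expo m - d.expo k) := by
      rw [norm_inv, _root_.inv_zpow', neg_sub]
    simp only [hK, hw, Function.comp_apply, e, g_apply, norm_mul, norm_zpow, e']
    ring
  have hs : ∀ m, Summable fun k => ‖K m k‖ := fun m => by
    rw [hn]
    exact (Equiv.summable_iff _).2 hws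
  have ht : ∀ m, ∑' k, ‖K m k‖ = ∑' n, w n := fun m => by
    rw [hn]
    exact Equiv.tsum_eq _ w
  obtain ⟨φ, hφ⟩ := exists_pairing (b := fun m => ∑' k, K m k) (C := ∑' n, w n) fun m =>
    (norm_tsum_le_tsum_norm (hs m)).trans (ht m).le
  refine ⟨φ, fun t hts hty i => ?_⟩
  obtain ⟨h1, h2⟩ := schur_tsum_comm (d.expCol 1 (-1) y t i) hs fun m => (ht m).le
  have h3 := h1.hasSum
  rw [h2, (hφ _).tsum_eq] at h3
  refine h3.congr_fun fun k => ?_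
  rw [mul_apply_eq, ← tsum_mul_left]
  refine tsum_congr fun m => ?_
  rw [expCol_apply hy hty (summable_times hts 1), ← W₂₀Inv_apply hts, ← chi_ne_zero_mul hy m k]
  simp only [hK]
  ring

/-! ### The wave matrices -/

/-- By $S_2=S_1g(t)$ and $g(t)W_{2,0}=W_{1,0}g$, the matrix $W_2$ is also a product with left factor
$S_1$. It is stated for one row with one minor so that it applies at times near the given one. -/
theorem W₂_apply {t : Times} (ht : Summable fun p => ‖t p‖) {l : ℕ}
    (hl : (trunc (d.gt t) l).det ≠ 0) (k : ℕ) :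
    d.W₂ t l k = mul (d.S₁ t) (mul (d.W₁₀ t) d.g) l k := by
  rw [← gt_mul_W₂₀ ht, ← mul_assoc_of_rowFinite (rowFinite_S₁ t) (mulSummable_gt_W₂₀ ht), W₂,
    mul_apply_eq, mul_apply_eq]
  exact tsum_congr fun j => congrArg (· * _) (gaussS₂_apply hl j)

theorem W₁Inv_apply {t : Times} (ht : Summable fun p => ‖t p‖) {l : ℕ}
    (hl : (trunc (d.gt t) (l + 1)).det ≠ 0) (k : ℕ) :
    d.W₁Inv t k l = mul (mul d.g (d.W₂₀Inv t)) (d.S₂Inv t) k l := by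
  rw [← W₁₀Inv_mul_gt ht, mul_assoc_of_colFinite (colFinite_S₂Inv t) (mulSummable_W₁₀Inv_gt ht),
    W₁Inv, mul_apply_eq, mul_apply_eq]
  exact tsum_congr fun j => congrArg (_ * ·) (gaussS₁Inv_apply hl j)

section

variable {t : Times} (ht : Summable fun p => ‖t p‖) (hg : NonzeroMinors (d.gt t))
include ht hg

theorem W₂_eq : d.W₂ t = mul (d.S₁ t) (mul (d.W₁₀ t) d.g) := by
  ext l k
  exact W₂_apply ht (hg l) k

theorem W₁Inv_eq : d.W₁Inv t = mul (mul d.g (d.W₂₀Inv t)) (d.S₂Inv t) := by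
  ext k l
  exact W₁Inv_apply ht (hg (l + 1)) k

theorem mulSummable_S₂_W₂₀ : MulSummable (d.S₂ t) (d.W₂₀ t) := by
  rw [← S₁_mul_gt hg]
  exact .mul_left_of_rowFinite (rowFinite_S₁ t) (mulSummable_gt_W₂₀ ht)

theorem mulSummable_W₁₀Inv_S₁Inv : MulSummable (d.W₁₀Inv t) (d.S₁Inv t) := by
  rw [← gt_mul_S₂Inv hg]
  exact .mul_right_of_colFinite (colFinite_S₂Inv t) (mulSummable_W₁₀Inv_gt ht)

theorem mulSummable_W₁₀_W₁Inv : MulSummable (d.W₁₀ t) (d.W₁Inv t) := by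
  rw [W₁Inv_eq ht hg]
  exact .mul_right_of_colFinite (colFinite_S₂Inv t) (mulSummable_W₁₀_g_mul ht)

theorem mulSummable_W₁_W₁Inv : MulSummable (d.W₁ t) (d.W₁Inv t) :=
  .mul_left_of_rowFinite (rowFinite_S₁ t) (mulSummable_W₁₀_W₁Inv ht hg)

theorem W₁_mul_W₁Inv : mul (d.W₁ t) (d.W₁Inv t) = 1 := by
  rw [W₁, mul_assoc_of_rowFinite (rowFinite_S₁ t) (mulSummable_W₁₀_W₁Inv ht hg), W₁Inv_eq ht hg,
    ← mul_assoc_of_colFinite (colFinite_S₂Inv t) (mulSummable_W₁₀_g_mul ht), ← gt_eq ht,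
    gt_mul_S₂Inv hg, (isGaussBorel hg).mul_inv_one]

theorem mulSummable_W₂_W₂₀Inv : MulSummable (d.W₂ t) (d.W₂₀Inv t) := by
  rw [W₂_eq ht hg]
  exact .mul_left_of_rowFinite (rowFinite_S₁ t) (mulSummable_W₁₀_g_W₂₀Inv ht)

theorem mulSummable_W₂_W₂Inv : MulSummable (d.W₂ t) (d.W₂Inv t) :=
  .mul_right_of_colFinite (colFinite_S₂Inv t) (mulSummable_W₂_W₂₀Inv ht hg)

theorem W₂_mul_W₂Inv : mul (d.W₂ t) (d.W₂Inv t) = 1 := by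
  rw [W₂Inv, ← mul_assoc_of_colFinite (colFinite_S₂Inv t) (mulSummable_W₂_W₂₀Inv ht hg),
    W₂_eq ht hg, mul_assoc_of_rowFinite (rowFinite_S₁ t) (mulSummable_W₁₀_g_W₂₀Inv ht)]
  change mul (mul (d.S₁ t) (d.gt t)) _ = 1
  rw [S₁_mul_gt hg, (isGaussBorel hg).mul_inv_two]

/-! ### Linear systems -/

theorem hasPartialM_W₁ (p : Fin 2 × ℕ+) : HasPartialM d.W₁ p (mul (d.B p t) (d.W₁ t)) t := by
  have h := hasPartialM_S₁_mul ht hg (hasPartialM_W₁₀ ht p)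
  rwa [mul_zero', add_zero] at h

theorem hasPartialM_W₂ (p : Fin 2 × ℕ+) : HasPartialM d.W₂ p (mul (d.B p t) (d.W₂ t)) t := by
  have h := hasPartialM_S₁_mul ht hg (hasPartialM_W₁₀_mul_g ht p)
  rw [mul_zero', add_zero, ← W₂_eq ht hg] at h
  exact fun l k => hasPartial_congr (h l k)
    ((eventually_det_ne_zero ht hg p l).mono fun s hs => W₂_apply (summable_update ht p s) hs k)

theorem hasPartialM_W₂Inv (p : Fin 2 × ℕ+) :
    HasPartialM d.W₂Inv p (-mul (d.W₂Inv t) (d.B p t)) t := by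
  have h := hasPartialM_mul_S₂Inv ht hg (hasPartialM_W₂₀Inv ht p)
  rwa [zero_mul', add_zero] at h

theorem hasPartialM_W₁Inv (p : Fin 2 × ℕ+) :
    HasPartialM d.W₁Inv p (-mul (d.W₁Inv t) (d.B p t)) t := by
  have h := hasPartialM_mul_S₂Inv ht hg (hasPartialM_g_mul_W₂₀Inv ht p)
  rw [zero_mul', add_zero, ← W₁Inv_eq ht hg] at h
  exact fun k l => hasPartial_congr (h k l)
    ((eventually_det_ne_zero ht hg p (l + 1)).mono fun s hs =>
      W₁Inv_apply (summable_update ht p s) hs k)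

omit ht hg in
theorem hasConjPartialM_of_hasPartialM {F : Times → Mat} {B : Mat} {p : Fin 2 × ℕ+}
    (h : HasPartialM F p (-mul (F t) B) t) :
    HasConjPartialM (fun t' => (F t')ᴴ) p (-mul Bᴴ (F t)ᴴ) t := by
  intro i k
  have h1 := HasDerivAt.conj_conj (h k i)
  rw [← conjTranspose_mul']
  refine h1.congr_deriv ?_
  rw [Matrix.neg_apply, map_neg, Matrix.neg_apply]
  rfl

/-- Linear systems for the functions `W v`, where `W = S₁ R`. -/
theorem hasPartialV_mulVec {R W : Times → Mat} {v : ℕ → ℂ} {p : Fin 2 × ℕ+}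
    (hR : HasPartialM (fun t' => mul (R t') (constCol v)) p
      ((if p.1 = 0 then mul (mpow d.Ups p.2) (mul (R t) (constCol v)) else 0) + 0) t)
    (hs : ∀ s, MulSummable (R (Function.update t p s)) (constCol v))
    (hW : ∀ l, ∀ᶠ s in 𝓝 (t p), ∀ k, W (Function.update t p s) l k =
      mul (d.S₁ (Function.update t p s)) (R (Function.update t p s)) l k)
    (hWt : W t = mul (d.S₁ t) (R t)) :
    HasPartialV (fun t' => mulVec (W t') v) p (mulVec (d.B p t) (mulVec (W t) v)) t := by
  intro l
  have hst : MulSummable (R t) (constCol v) := by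
    have := hs (t p)
    rwa [Function.update_eq_self] at this
  have h := hasPartialM_S₁_mul ht hg hR
  rw [mul_zero', add_zero, ← mul_assoc_of_rowFinite (rowFinite_S₁ t) hst, ← hWt] at h
  -- The vector is carried by a matrix with equal columns; column `0` recovers it.
  refine hasPartial_congr (h l 0) ((hW l).mono fun s hWs => ?_)
  have ha := congrFun (congrFun (mul_assoc_of_rowFinite (rowFinite_S₁ (d := d) (Function.update t p s)) (hs s)) l) 0
  exact (tsum_congr fun k => congrArg (· * _) (hWs k)).trans ha

/-- Linear systems for the functions `W† v`, where `W = C S₂⁻¹`. -/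
theorem hasConjPartialV_mulVec {C W : Times → Mat} {v : ℕ → ℂ} {p : Fin 2 × ℕ+}
    (hC : HasPartialM (fun t' => mul (constRow (star v)) (C t')) p
      ((if p.1 = 0 then 0 else -mul (mul (constRow (star v)) (C t)) (mpow d.Upsᵀ p.2)) + 0) t)
    (hs : ∀ s, MulSummable (constRow (star v)) (C (Function.update t p s)))
    (hW : ∀ l, ∀ᶠ s in 𝓝 (t p), ∀ k, W (Function.update t p s) k l =
      mul (C (Function.update t p s)) (d.S₂Inv (Function.update t p s)) k l)
    (hWt : W t = mul (C t) (d.S₂Inv t)) :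
    HasConjPartialV (fun t' => mulVec (W t')ᴴ v) p
      (-mulVec (d.B p t)ᴴ (mulVec (W t)ᴴ v)) t := by
  intro l
  have hst : MulSummable (constRow (star v)) (C t) := by
    have := hs (t p)
    rwa [Function.update_eq_self] at this
  -- The function $W^\dagger v$ is the conjugate of the row $v^\dagger W$, which depends
  -- holomorphically on the time.
  have hconj : ∀ A : Mat, ∀ u : ℕ → ℂ, ∀ m,
      mulVec Aᴴ u m = (starRingEnd ℂ) (mul (constRow (star u)) A 0 m) := fun A u m => by
    rw [starRingEnd_apply, mul_apply_eq, tsum_star]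
    exact tsum_congr fun j => by simp [constRow, mul_comm]
  have h := hasPartialM_mul_S₂Inv ht hg hC
  rw [zero_mul', add_zero, mul_assoc_of_colFinite (colFinite_S₂Inv t) hst, ← hWt] at h
  have h1 : HasPartial (fun t' => mul (constRow (star v)) (W t') 0 l) p _ t :=
    hasPartial_congr (h 0 l) ((hW l).mono fun s hWs => by
      have ha := congrFun (congrFun (mul_assoc_of_colFinite (colFinite_S₂Inv (d := d) (Function.update t p s)) (hs s)) 0) l
      exact (tsum_congr fun k => congrArg (_ * ·) (hWs k)).trans ha.symm)
  have h2 := HasDerivAt.conj_conj h1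
  have h3 : (fun s => mulVec (W (Function.update t p ((starRingEnd ℂ) s)))ᴴ v l) =
      (starRingEnd ℂ) ∘ (fun s => mul (constRow (star v)) (W (Function.update t p s)) 0 l) ∘
        (starRingEnd ℂ) := by
    ext s
    exact hconj _ _ _
  change HasDerivAt (fun s => mulVec (W (Function.update t p ((starRingEnd ℂ) s)))ᴴ v l) _ _
  rw [h3]
  refine h2.congr_deriv ?_
  rw [Pi.neg_apply, hconj, Matrix.neg_apply, map_neg]
  congr 2
  refine tsum_congr fun m => congrArg (· * _) ?_
  have := hconj (W t) v m
  simp only [constRow, Matrix.of_apply, Pi.star_apply]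
  rw [this, starRingEnd_apply, star_star]
  rfl

end

end Data

/-! ### Products of matrix functions of the times -/

theorem HasPartialM.transpose {F : Times → Mat} {D : Mat} {p : Fin 2 × ℕ+} {t : Times}
    (h : HasPartialM F p D t) : HasPartialM (fun t' => (F t')ᵀ) p Dᵀ t := fun i k => h k i

/-- The finite support of a row of `P` is required to be the same at all times, so that the product
is a fixed finite sum and can be differentiated term by term. -/
theorem HasPartialM.mul_of_rowFinite {P Q : Times → Mat} {D E : Mat} {p : Fin 2 × ℕ+} {t : Times}
    (hP : HasPartialM P p D t) (hQ : HasPartialM Q p E t)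
    (hf : ∀ i, ∃ s : Finset ℕ, ∀ t', ∀ j ∉ s, P t' i j = 0) :
    HasPartialM (fun t' => mul (P t') (Q t')) p (mul D (Q t) + mul (P t) E) t := by
  intro i k
  obtain ⟨s, hs⟩ := hf i
  have hD : ∀ j ∉ s, D i j = 0 := fun j hj => by
    refine HasDerivAt.unique (hP i j) ?_
    simp only [hs _ j hj]
    exact hasDerivAt_const _ _
  have h1 : ∀ t' : Times, ∀ X : Mat, mul (P t') X i k = ∑ j ∈ s, P t' i j * X j k := fun t' X =>
    tsum_eq_sum fun j hj => by rw [hs t' j hj, zero_mul]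
  have h2 : mul D (Q t) i k = ∑ j ∈ s, D i j * Q t j k :=
    tsum_eq_sum fun j hj => by rw [hD j hj, zero_mul]
  rw [Matrix.add_apply, h1, h2, ← Finset.sum_add_distrib]
  change HasDerivAt (fun z => mul (P (Function.update t p z)) (Q (Function.update t p z)) i k) _ _
  simp only [h1]
  refine HasDerivAt.fun_sum fun j _ => ?_
  have := (hP i j).mul (hQ j k)
  rwa [Function.update_eq_self] at this

theorem HasPartialM.mul_of_colFinite {P Q : Times → Mat} {D E : Mat} {p : Fin 2 × ℕ+} {t : Times}
    (hP : HasPartialM P p D t) (hQ : HasPartialM Q p E t)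
    (hf : ∀ k, ∃ s : Finset ℕ, ∀ t', ∀ j ∉ s, Q t' j k = 0) :
    HasPartialM (fun t' => mul (P t') (Q t')) p (mul D (Q t) + mul (P t) E) t := by
  have h := (hQ.transpose.mul_of_rowFinite hP.transpose hf).transpose
  simpa only [transpose_mul', Matrix.transpose_add, Matrix.transpose_transpose, add_comm] using h

theorem exists_finset_mul {P Q : Times → Mat}
    (hP : ∀ i, ∃ s : Finset ℕ, ∀ t', ∀ j ∉ s, P t' i j = 0)
    (hQ : ∀ i, ∃ s : Finset ℕ, ∀ t', ∀ j ∉ s, Q t' i j = 0) (i : ℕ) :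
    ∃ s : Finset ℕ, ∀ t', ∀ j ∉ s, mul (P t') (Q t') i j = 0 := by
  obtain ⟨s, hs⟩ := hP i
  choose f hf using hQ
  refine ⟨s.biUnion f, fun t' k hk => (tsum_congr fun j => ?_).trans tsum_zero⟩
  by_cases hj : j ∈ s
  · rw [hf j t' k fun h => hk (Finset.mem_biUnion.2 ⟨j, hj, h⟩), mul_zero]
  · rw [hs t' j hj, zero_mul]

theorem exists_finset_mul_col {P Q : Times → Mat}
    (hP : ∀ k, ∃ s : Finset ℕ, ∀ t', ∀ j ∉ s, P t' j k = 0)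
    (hQ : ∀ k, ∃ s : Finset ℕ, ∀ t', ∀ j ∉ s, Q t' j k = 0) (k : ℕ) :
    ∃ s : Finset ℕ, ∀ t', ∀ j ∉ s, mul (P t') (Q t') j k = 0 := by
  obtain ⟨s, hs⟩ := exists_finset_mul (P := fun t => (Q t)ᵀ) (Q := fun t => (P t)ᵀ) hQ hP k
  refine ⟨s, fun t' j hj => ?_⟩
  have := hs t' j hj
  rwa [← transpose_mul'] at this

/-! ### Commutators -/

theorem comm_eq (A B : Mat) : comm A B = mul A B + -mul B A := sub_eq_add_neg _ _

theorem comm_one (A : Mat) : comm A 1 = 0 := by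
  rw [comm, mul_one', one_mul', sub_self]

theorem comm_mul_of_rowFinite {B P L : Mat} (hB : RowFinite B) (hP : RowFinite P)
    (hL : RowFinite L) : mul (comm B P) L + mul P (comm B L) = comm B (mul P L) := by
  rw [comm_eq, comm_eq, comm_eq,
    add_mul_of_summable (.of_rowFinite (hB.mul hP) _) (.of_rowFinite (hP.mul hB).neg _),
    mul_add_of_summable (.of_rowFinite hP _) (.of_rowFinite hP _), neg_mul', mul_neg',
    mul_assoc_of_rowFinite hB (.of_rowFinite hP _), mul_assoc_of_rowFinite hP (.of_rowFinite hB _),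
    mul_assoc_of_rowFinite hP (.of_rowFinite hL _)]
  abel

theorem comm_mul_of_colFinite {B P L : Mat} (hB : ColFinite B) (hP : ColFinite P)
    (hL : ColFinite L) : mul (comm B P) L + mul P (comm B L) = comm B (mul P L) := by
  rw [comm_eq, comm_eq, comm_eq,
    add_mul_of_summable (.of_colFinite _ hL) (.of_colFinite _ hL),
    mul_add_of_summable (.of_colFinite _ (hB.mul hL)) (MulSummable.of_colFinite _ (hL.mul hB)).neg_right,
    neg_mul', mul_neg', mul_assoc_of_colFinite hL (.of_colFinite _ hP),
    mul_assoc_of_colFinite hL (.of_colFinite _ hB), mul_assoc_of_colFinite hB (.of_colFinite _ hL)]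
  abel

theorem comm_add_right_of_rowFinite {A B C : Mat} (hA : RowFinite A) (hB : RowFinite B)
    (hC : RowFinite C) : comm A (B + C) = comm A B + comm A C := by
  rw [comm, comm, comm, mul_add_of_summable (.of_rowFinite hA _) (.of_rowFinite hA _),
    add_mul_of_summable (.of_rowFinite hB _) (.of_rowFinite hC _)]
  abel

theorem comm_add_right_of_colFinite {A B C : Mat} (hA : ColFinite A) (hB : ColFinite B)
    (hC : ColFinite C) : comm A (B + C) = comm A B + comm A C := by
  rw [comm, comm, comm, mul_add_of_summable (.of_colFinite _ hB) (.of_colFinite _ hC),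
    add_mul_of_summable (.of_colFinite _ hA) (.of_colFinite _ hA)]
  abel

theorem comm_swap (A B : Mat) : comm A B = -comm B A := by
  rw [comm, comm, neg_sub]

theorem upperTri_comm {A B : Mat} (hA : UpperTri A) (hB : UpperTri B) : UpperTri (comm A B) :=
  fun i k h => by rw [comm, Matrix.sub_apply, hA.mul hB i k h, hB.mul hA i k h, sub_zero]

theorem strictLowerTri_comm {A B : Mat} (hA : StrictLowerTri A) (hB : StrictLowerTri B) :
    StrictLowerTri (comm A B) := fun i k h => by
  rw [comm, Matrix.sub_apply, hA.mul hB.lowerTri i k h, hB.mul hA.lowerTri i k h, sub_zero]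

/-- Expanding $[Q,P]=0$ gives $[Q_+,P]=[P_+,Q]-[P_+,Q_+]+[P_-,Q_-]$. The upper projection kills the
last commutator and fixes $[P_+,Q_+]$. Row finiteness makes these commutators bilinear. -/
theorem zakharovShabat_upper {P Q : Mat} (hP : RowFinite P) (hQ : RowFinite Q)
    (h : mul P Q = mul Q P) :
    upper (comm (upper Q) P) - upper (comm (upper P) Q) + comm (upper P) (upper Q) = 0 := by
  have hPu := hP.upper
  have hQu := hQ.upper
  have hPl := (strictLowerTri_strictLower P).lowerTri.rowFinite
  have hQl := (strictLowerTri_strictLower Q).lowerTri.rowFinite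
  have e1 := comm_add_right_of_rowFinite hQu hPu hPl
  have e2 := comm_add_right_of_rowFinite hPu hQu hQl
  have e3 := comm_add_right_of_rowFinite hPl hQu hQl
  have e4 := comm_add_right_of_rowFinite hQ hPu hPl
  rw [upper_add_strictLower] at e1 e2 e3 e4
  have h0 : comm Q P = 0 := by rw [comm, h, sub_self]
  rw [h0, comm_swap Q, comm_swap Q, e2, e3] at e4
  have key : comm (upper Q) P = comm (upper P) Q + -comm (upper P) (upper Q) +
      comm (strictLower P) (strictLower Q) := by
    rw [e1, e2, comm_swap (upper Q), comm_swap (upper Q)]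
    rw [← sub_eq_zero]
    refine Eq.trans ?_ e4.symm
    abel
  rw [key, upper_add, upper_add, upper_neg,
    (upperTri_comm (upperTri_upper P) (upperTri_upper Q)).upper_eq,
    (strictLowerTri_comm (strictLowerTri_strictLower P) (strictLowerTri_strictLower Q)).upper_eq]
  abel

theorem zakharovShabat_strictLower {P Q : Mat} (hP : ColFinite P) (hQ : ColFinite Q)
    (h : mul P Q = mul Q P) :
    strictLower (comm (strictLower Q) P) - strictLower (comm (strictLower P) Q) +
      comm (strictLower P) (strictLower Q) = 0 := by
  have hPu := (upperTri_upper P).colFinite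
  have hQu := (upperTri_upper Q).colFinite
  have hPl := hP.strictLower
  have hQl := hQ.strictLower
  have e1 := comm_add_right_of_colFinite hQl hPu hPl
  have e2 := comm_add_right_of_colFinite hPl hQu hQl
  have e3 := comm_add_right_of_colFinite hPu hQu hQl
  have e4 := comm_add_right_of_colFinite hQ hPu hPl
  rw [upper_add_strictLower] at e1 e2 e3 e4
  have h0 : comm Q P = 0 := by rw [comm, h, sub_self]
  rw [h0, comm_swap Q, comm_swap Q, e2, e3] at e4
  have key : comm (strictLower Q) P = comm (strictLower P) Q +
      -comm (strictLower P) (strictLower Q) + comm (upper P) (upper Q) := by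
    rw [e1, e2, comm_swap (strictLower Q), comm_swap (strictLower Q)]
    rw [← sub_eq_zero]
    refine Eq.trans ?_ e4.symm
    abel
  rw [key, strictLower_add, strictLower_add, strictLower_neg,
    (strictLowerTri_comm (strictLowerTri_strictLower P)
      (strictLowerTri_strictLower Q)).strictLower_eq,
    (upperTri_comm (upperTri_upper P) (upperTri_upper Q)).strictLower_eq]
  abel

/-- Since $[Q_-,P_-]$ is strictly lower and $[P_+,Q_+]$ upper triangular, both derivative terms
reduce to the two projections of $-[P_+,Q_-]$. Commutation of `P` and `Q` plays no role; their
product need not even converge. -/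
theorem zakharovShabat_mixed {P Q : Mat} (hP : RowFinite P) (hQ : ColFinite Q) :
    upper (comm (strictLower Q) P) - strictLower (comm (upper P) Q) +
      comm (upper P) (strictLower Q) = 0 := by
  have hPl := strictLowerTri_strictLower P
  have hQl := strictLowerTri_strictLower Q
  have e1 := comm_add_right_of_rowFinite hQl.lowerTri.rowFinite hP.upper hPl.lowerTri.rowFinite
  have e2 := comm_add_right_of_colFinite (upperTri_upper P).colFinite (upperTri_upper Q).colFinite
    hQ.strictLower
  rw [upper_add_strictLower] at e1 e2
  rw [e1, e2, upper_add, strictLower_add, (strictLowerTri_comm hQl hPl).upper_eq,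
    (upperTri_comm (upperTri_upper P) (upperTri_upper Q)).strictLower_eq, comm_swap (strictLower Q),
    upper_neg, add_zero, zero_add]
  nth_rw 3 [← upper_add_strictLower (comm (upper P) (strictLower Q))]
  abel

theorem mpow_mul_comm_of_rowFinite {L : Mat} (hL : RowFinite L) (m n : ℕ) :
    mul (mpow L m) (mpow L n) = mul (mpow L n) (mpow L m) := by
  have h : ∀ m n, mul (mpow L m) (mpow L n) = mpow L (m + n) := by
    intro m n
    induction n with
    | zero => exact mul_one' _
    | succ n ih =>
      rw [mpow, ← mul_assoc_of_rowFinite (hL.mpow m) (.of_rowFinite (hL.mpow n) _), ih]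
      rfl
  rw [h, h, add_comm]

theorem mpow_mul_comm_of_colFinite {L : Mat} (hL : ColFinite L) (m n : ℕ) :
    mul (mpow L m) (mpow L n) = mul (mpow L n) (mpow L m) := by
  have h : ∀ m n, mul (mpow L m) (mpow L n) = mpow L (m + n) := by
    intro m n
    induction n with
    | zero => exact mul_one' _
    | succ n ih =>
      rw [mpow, ← mul_assoc_of_colFinite hL (.of_colFinite _ (hL.mpow n)), ih]
      rfl
  rw [h, h, add_comm]

namespace Data

variable {d : Data}

/-- The supports are uniform in the times because `gaussS₁` and `gaussS₁Inv` are triangular by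
definition, even where minors vanish. -/
theorem exists_finset_L₁ (n : ℕ) (i : ℕ) :
    ∃ s : Finset ℕ, ∀ t, ∀ j ∉ s, mpow (d.L₁ t) n i j = 0 := by
  have hS : ∀ i, ∃ s : Finset ℕ, ∀ t, ∀ j ∉ s, d.S₁ t i j = 0 := fun i =>
    ⟨Finset.range (i + 1), fun t j hj => lowerTri_S₁ t i j (lt_of_notMem_range_succ hj)⟩
  have hS' : ∀ i, ∃ s : Finset ℕ, ∀ t, ∀ j ∉ s, d.S₁Inv t i j = 0 := fun i =>
    ⟨Finset.range (i + 1), fun t j hj => lowerTri_S₁Inv t i j (lt_of_notMem_range_succ hj)⟩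
  have hU : ∀ i, ∃ s : Finset ℕ, ∀ _ : Times, ∀ j ∉ s, d.Ups i j = 0 := fun i => by
    obtain ⟨s, hs⟩ := d.rowFinite_Ups.exists_finset i
    exact ⟨s, fun _ => hs⟩
  have hL := exists_finset_mul (exists_finset_mul hS hU) hS'
  induction n generalizing i with
  | zero => exact ⟨{i}, fun t j hj => Matrix.one_apply_ne (by simpa [eq_comm] using hj)⟩
  | succ n ih => exact exists_finset_mul ih hL i

theorem exists_finset_L₂ (n : ℕ) (k : ℕ) :
    ∃ s : Finset ℕ, ∀ t, ∀ j ∉ s, mpow (d.L₂ t) n j k = 0 := by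
  have hS : ∀ i, ∃ s : Finset ℕ, ∀ t, ∀ j ∉ s, d.S₂ t j i = 0 := fun i =>
    ⟨Finset.range (i + 1), fun t j hj => upperTri_S₂ t j i (lt_of_notMem_range_succ hj)⟩
  have hS' : ∀ i, ∃ s : Finset ℕ, ∀ t, ∀ j ∉ s, d.S₂Inv t j i = 0 := fun i =>
    ⟨Finset.range (i + 1), fun t j hj => upperTri_S₂Inv t j i (lt_of_notMem_range_succ hj)⟩
  have hU : ∀ i, ∃ s : Finset ℕ, ∀ _ : Times, ∀ j ∉ s, d.Upsᵀ j i = 0 := fun i => by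
    obtain ⟨s, hs⟩ := d.rowFinite_Ups.exists_finset i
    exact ⟨s, fun _ => hs⟩
  have hL := exists_finset_mul_col (exists_finset_mul_col hS hU) hS'
  induction n generalizing k with
  | zero => exact ⟨{k}, fun t j hj => Matrix.one_apply_ne (by simpa using hj)⟩
  | succ n ih => exact exists_finset_mul_col (fun k => ih k) hL k

theorem Ups_mul (X : Mat) (i k : ℕ) : mul d.Ups X i k = X (d.shift 1 i) k := by
  have := d.mpow_Ups_mul 1 X i k
  rwa [mpow_one'] at this

theorem mul_transpose_Ups (X : Mat) (i k : ℕ) : mul X d.Upsᵀ i k = X i (d.shift 1 k) := by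
  have := d.mul_mpow_transpose_Ups 1 X i k
  rwa [mpow_one'] at this

theorem zakharovShabat (p q : Fin 2 × ℕ+) (t : Times) :
    (if p.1 = 0 then upper (comm (d.B q t) (mpow (d.L₁ t) p.2))
      else strictLower (comm (d.B q t) (mpow (d.L₂ t) p.2))) -
    (if q.1 = 0 then upper (comm (d.B p t) (mpow (d.L₁ t) q.2))
      else strictLower (comm (d.B p t) (mpow (d.L₂ t) q.2))) + comm (d.B p t) (d.B q t) = 0 := by
  have hP := (rowFinite_L₁ (d := d) t).mpow
  have hQ := (colFinite_L₂ (d := d) t).mpow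
  by_cases hp : p.1 = 0 <;> by_cases hq : q.1 = 0
  · rw [if_pos hp, if_pos hq, B_of_eq hp, B_of_eq hq]
    exact zakharovShabat_upper (hP _) (hP _) (mpow_mul_comm_of_rowFinite (rowFinite_L₁ t) _ _)
  · rw [if_pos hp, if_neg hq, B_of_eq hp, B_of_ne hq]
    exact zakharovShabat_mixed (hP _) (hQ _)
  · rw [if_neg hp, if_pos hq, B_of_ne hp, B_of_eq hq, comm_swap (strictLower _) (upper _),
      ← neg_eq_zero, ← zakharovShabat_mixed (hP q.2) (hQ p.2)]
    abel
  · rw [if_neg hp, if_neg hq, B_of_ne hp, B_of_ne hq]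
    exact zakharovShabat_strictLower (hQ _) (hQ _) (mpow_mul_comm_of_colFinite (colFinite_L₂ t) _ _)

section

variable {t : Times} (ht : Summable fun p => ‖t p‖) (hg : NonzeroMinors (d.gt t))
include ht hg

theorem hasPartialM_S₁Inv (p : Fin 2 × ℕ+) :
    HasPartialM d.S₁Inv p (-mul (d.S₁Inv t) (d.B p t) +
      if p.1 = 0 then mul (mpow d.Ups p.2) (d.S₁Inv t) else 0) t := by
  have h0 := hasPartialM_gt (d := d) ht p
  rw [add_comm] at h0
  -- Here $S_1^{-1}=g(t)S_2^{-1}$, with $\Upsilon^jg(t)$, present for the times $t_{1j}$, in the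
  -- role of the additional term `D`.
  have h := hasPartialM_mul_S₂Inv ht hg h0
  have e : mul (if p.1 = 0 then mul (mpow d.Ups p.2) (d.gt t) else 0) (d.S₂Inv t) =
      if p.1 = 0 then mul (mpow d.Ups p.2) (d.S₁Inv t) else 0 := by
    split_ifs
    · rw [mul_assoc_of_rowFinite (d.rowFinite_mpow_Ups _) (.of_colFinite _ (colFinite_S₂Inv t)),
        gt_mul_S₂Inv hg]
    · rw [zero_mul']
  rw [e, gt_mul_S₂Inv hg] at h
  exact fun k l => hasPartial_congr (h k l)
    ((eventually_det_ne_zero ht hg p (l + 1)).mono fun s hs => gaussS₁Inv_apply hs k)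

theorem hasPartialM_S₂ (p : Fin 2 × ℕ+) :
    HasPartialM d.S₂ p (mul (d.B p t) (d.S₂ t) +
      if p.1 = 0 then 0 else -mul (d.S₂ t) (mpow d.Upsᵀ p.2)) t := by
  have h := hasPartialM_S₁_mul ht hg (hasPartialM_gt (d := d) ht p)
  have e : mul (d.S₁ t) (if p.1 = 0 then 0 else -mul (d.gt t) (mpow d.Upsᵀ p.2)) =
      if p.1 = 0 then 0 else -mul (d.S₂ t) (mpow d.Upsᵀ p.2) := by
    split_ifs
    · rw [mul_zero']
    · rw [mul_neg', ← mul_assoc_of_rowFinite (rowFinite_S₁ t)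
        (.of_colFinite _ (d.colFinite_mpow_transpose_Ups _)), S₁_mul_gt hg]
  rw [e, S₁_mul_gt hg] at h
  exact fun l k => hasPartial_congr (h l k)
    ((eventually_det_ne_zero ht hg p l).mono fun s hs => gaussS₂_apply hs k)

/-! ### Lax and Zakharov--Shabat equations -/

/-- In $L_1=S_1(\Upsilon S_1^{-1})$ the right factor has the additional term $-\Upsilon S_1^{-1}B$,
which supplies the second half of the commutator. -/
theorem hasPartialM_L₁ (p : Fin 2 × ℕ+) : HasPartialM d.L₁ p (comm (d.B p t) (d.L₁ t)) t := by
  have hL : ∀ t, d.L₁ t = mul (d.S₁ t) (mul d.Ups (d.S₁Inv t)) := fun t =>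
    mul_assoc_of_rowFinite (rowFinite_S₁ t) (.of_rowFinite d.rowFinite_Ups _)
  have hR : HasPartialM (fun t' => mul d.Ups (d.S₁Inv t')) p
      ((if p.1 = 0 then mul (mpow d.Ups p.2) (mul d.Ups (d.S₁Inv t)) else 0) +
        -mul (mul d.Ups (d.S₁Inv t)) (d.B p t)) t := by
    intro i k
    have h := hasPartialM_S₁Inv ht hg p (d.shift 1 i) k
    have e : (-mul (d.S₁Inv t) (d.B p t) +
        if p.1 = 0 then mul (mpow d.Ups p.2) (d.S₁Inv t) else 0) (d.shift 1 i) k =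
        ((if p.1 = 0 then mul (mpow d.Ups p.2) (mul d.Ups (d.S₁Inv t)) else 0) +
        -mul (mul d.Ups (d.S₁Inv t)) (d.B p t)) i k := by
      rw [mul_assoc_of_rowFinite d.rowFinite_Ups (.of_rowFinite (rowFinite_S₁Inv t) _), add_comm,
        Matrix.add_apply, Matrix.add_apply, Matrix.neg_apply, Matrix.neg_apply, Ups_mul]
      congr 1
      split_ifs
      · rw [mpow_Ups_mul, mpow_Ups_mul, Ups_mul, shift_shift, shift_shift, add_comm]
      · rfl
    rw [e] at h
    exact hasPartial_congr h (Eventually.of_forall fun s => Ups_mul _ _ _)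
  have h := hasPartialM_S₁_mul ht hg hR
  simp only [← hL] at h
  rwa [mul_neg', ← mul_assoc_of_rowFinite (rowFinite_S₁ t)
    (.of_rowFinite (d.rowFinite_Ups.mul (rowFinite_S₁Inv t)) _), ← hL, ← comm_eq] at h

/-- In $L_2=(S_2\Upsilon^\top)S_2^{-1}$ the left factor has the additional term $BS_2\Upsilon^\top$,
which supplies the first half of the commutator. -/
theorem hasPartialM_L₂ (p : Fin 2 × ℕ+) : HasPartialM d.L₂ p (comm (d.B p t) (d.L₂ t)) t := by
  have hU : ColFinite d.Upsᵀ := colFinite_transpose.2 d.rowFinite_Ups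
  have hC : HasPartialM (fun t' => mul (d.S₂ t') d.Upsᵀ) p
      ((if p.1 = 0 then 0 else -mul (mul (d.S₂ t) d.Upsᵀ) (mpow d.Upsᵀ p.2)) +
        mul (d.B p t) (mul (d.S₂ t) d.Upsᵀ)) t := by
    intro i k
    have h := hasPartialM_S₂ ht hg p i (d.shift 1 k)
    have e : (mul (d.B p t) (d.S₂ t) +
        if p.1 = 0 then 0 else -mul (d.S₂ t) (mpow d.Upsᵀ p.2)) i (d.shift 1 k) =
        ((if p.1 = 0 then 0 else -mul (mul (d.S₂ t) d.Upsᵀ) (mpow d.Upsᵀ p.2)) +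
        mul (d.B p t) (mul (d.S₂ t) d.Upsᵀ)) i k := by
      rw [← mul_assoc_of_colFinite hU (.of_colFinite _ (colFinite_S₂ t)), add_comm,
        Matrix.add_apply, Matrix.add_apply, mul_transpose_Ups]
      congr 1
      split_ifs
      · rfl
      · rw [Matrix.neg_apply, Matrix.neg_apply, mul_mpow_transpose_Ups, mul_mpow_transpose_Ups,
          mul_transpose_Ups, shift_shift, shift_shift, add_comm]
    rw [e] at h
    exact hasPartial_congr h (Eventually.of_forall fun s => mul_transpose_Ups _ _ _)
  have h := hasPartialM_mul_S₂Inv ht hg hC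
  rw [mul_assoc_of_colFinite (colFinite_S₂Inv t)
    (.of_colFinite _ ((colFinite_S₂ t).mul hU)), add_comm] at h
  rw [comm_eq]
  exact h

theorem hasPartialM_mpow_L₁ (p : Fin 2 × ℕ+) (n : ℕ) :
    HasPartialM (fun t' => mpow (d.L₁ t') n) p (comm (d.B p t) (mpow (d.L₁ t) n)) t := by
  induction n with
  | zero =>
    intro i k
    simp only [mpow, comm_one]
    exact hasDerivAt_const _ _
  | succ n ih =>
    have h := ih.mul_of_rowFinite (hasPartialM_L₁ ht hg p) (exists_finset_L₁ n)
    rwa [comm_mul_of_rowFinite (rowFinite_B p t) ((rowFinite_L₁ t).mpow n) (rowFinite_L₁ t)] at h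

theorem hasPartialM_mpow_L₂ (p : Fin 2 × ℕ+) (n : ℕ) :
    HasPartialM (fun t' => mpow (d.L₂ t') n) p (comm (d.B p t) (mpow (d.L₂ t) n)) t := by
  induction n with
  | zero =>
    intro i k
    simp only [mpow, comm_one]
    exact hasDerivAt_const _ _
  | succ n ih =>
    have h := ih.mul_of_colFinite (hasPartialM_L₂ ht hg p) fun k => by
      simpa only [mpow, one_mul'] using exists_finset_L₂ (d := d) 1 k
    rwa [comm_mul_of_colFinite (colFinite_B p t) ((colFinite_L₂ t).mpow n) (colFinite_L₂ t)] at h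

theorem hasPartialM_B (p q : Fin 2 × ℕ+) :
    HasPartialM (d.B p) q (if p.1 = 0 then upper (comm (d.B q t) (mpow (d.L₁ t) p.2))
      else strictLower (comm (d.B q t) (mpow (d.L₂ t) p.2))) t := by
  have hzero : HasPartial (fun _ => 0) q 0 t := hasDerivAt_const _ _
  by_cases hp : p.1 = 0
  · rw [if_pos hp, show d.B p = fun t' => upper (mpow (d.L₁ t') p.2) from funext (B_of_eq hp)]
    intro i k
    by_cases h : i ≤ k
    · simpa [upper, h] using hasPartialM_mpow_L₁ ht hg q p.2 i k
    · simpa [upper, h] using hzero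
  · rw [if_neg hp, show d.B p = fun t' => strictLower (mpow (d.L₂ t') p.2) from funext (B_of_ne hp)]
    intro i k
    by_cases h : k < i
    · simpa [strictLower, h] using hasPartialM_mpow_L₂ ht hg q p.2 i k
    · simpa [strictLower, h] using hzero

end

end Data

namespace Data

variable {d : Data} {t : Times}

/-! ### Linear systems for the wave functions -/

theorem mulVecSummable_conjTranspose {A : Mat} {v : ℕ → ℂ}
    (h : MulSummable (constRow (star v)) A) : MulVecSummable Aᴴ v := fun i => by
  refine ((h 0 i).star).congr fun k => ?_
  simp [constRow, mul_comm]

theorem waveFunction_one (ht : Summable fun p => ‖t p‖) (hg : NonzeroMinors (d.gt t)) {z : ℂ}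
    (hz : z ≠ 0) (hzt : Summable fun j : ℕ+ => ‖t (0, j)‖ * ‖z‖ ^ (j : ℕ)) :
    MulVecSummable (d.W₁ t) (d.chi z) ∧
      ∀ p, HasPartialV (d.Ψ₁ z) p (mulVec (d.B p t) (d.Ψ₁ z t)) t := by
  obtain ⟨φ, hφ, -⟩ := d.exists_functional_chi
  refine ⟨fun l => MulSummable.mul_left_of_rowFinite (C := constCol (d.chi z)) (rowFinite_S₁ t)
    (fun i _ => (hφ z hz t ht hzt i).summable) l 0, fun p => ?_⟩
  refine hasPartialV_mulVec (R := d.W₁₀) ht hg (hasPartialM_of_row hz hzt p fun k =>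
    ⟨φ, fun s i => ?_⟩) (fun s i k => ?_) (fun l => Eventually.of_forall fun s k => rfl) rfl
  · exact (hφ z hz _ (summable_update ht p s) (summable_weight_update hzt p s) i).tsum_eq
  · exact (hφ z hz _ (summable_update ht p s) (summable_weight_update hzt p s) i).summable

theorem adjointWaveFunction_two (ht : Summable fun p => ‖t p‖) (hg : NonzeroMinors (d.gt t))
    {z : ℂ} (hz : z ≠ 0) (hzt : Summable fun j : ℕ+ => ‖t (1, j)‖ * ‖z‖ ^ (j : ℕ)) :
    MulVecSummable (d.W₂Inv t)ᴴ (d.chi z) ∧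
      ∀ p, HasConjPartialV (d.Ψ₂Star z) p (-mulVec (d.B p t)ᴴ (d.Ψ₂Star z t)) t := by
  obtain ⟨φ, -, hφ⟩ := d.exists_functional_chi
  have hv : star (d.chi z) = d.chi ((starRingEnd ℂ) z) := funext fun k => conj_chi z k
  have hw : (starRingEnd ℂ) z ≠ 0 := (map_ne_zero _).2 hz
  have hwt : Summable fun j : ℕ+ => ‖t (1, j)‖ * ‖(starRingEnd ℂ) z‖ ^ (j : ℕ) := by
    simpa only [RCLike.norm_conj] using hzt
  have hφ' := hφ _ hw
  refine ⟨mulVecSummable_conjTranspose (MulSummable.mul_right_of_colFinite (colFinite_S₂Inv t)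
    fun _ k => ?_), fun p => ?_⟩
  · rw [hv]
    exact (hφ' t ht hwt k).summable
  refine hasConjPartialV_mulVec (C := d.W₂₀Inv) ht hg (hasPartialM_of_col hw hwt p fun i =>
    ⟨φ, fun s k => ?_⟩) (fun s i k => ?_) (fun l => Eventually.of_forall fun s k => rfl) rfl
  · rw [hv]
    exact (hφ' _ (summable_update ht p s) (summable_weight_update hwt p s) k).tsum_eq
  · rw [hv]
    exact (hφ' _ (summable_update ht p s) (summable_weight_update hwt p s) k).summable

theorem adjointWaveFunction_one (ht : Summable fun p => ‖t p‖) (hg : NonzeroMinors (d.gt t))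
    {z : ℂ} (hz : z ≠ 0) (hzt : Summable fun j : ℕ+ => ‖t (1, j)‖ * ‖z⁻¹‖ ^ (j : ℕ))
    (hc : Summable fun n : ℤ => ‖d.fourierCoeff n‖ * ‖z‖ ^ n) :
    MulVecSummable (d.W₁Inv t)ᴴ (d.chiStar z) ∧
      ∀ p, HasConjPartialV (d.Ψ₁Star z) p (-mulVec (d.B p t)ᴴ (d.Ψ₁Star z t)) t := by
  -- The conjugate of $\chi^*(z)$ is $y\,\chi(y)$ for this `y`, which therefore also serves as the
  -- constant in `exists_functional_col`.
  set y : ℂ := ((starRingEnd ℂ) z)⁻¹ with hy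
  have hv : star (d.chiStar z) = d.chiStar ((starRingEnd ℂ) z) := funext fun k => conj_chiStar z k
  have hw : y ≠ 0 := inv_ne_zero ((map_ne_zero _).2 hz)
  have hny : ‖y‖ = ‖z⁻¹‖ := by rw [hy, norm_inv, norm_inv, RCLike.norm_conj]
  have hwt : Summable fun j : ℕ+ => ‖t (1, j)‖ * ‖y‖ ^ (j : ℕ) := by simpa only [hny] using hzt
  have hcy : Summable fun n : ℤ => ‖d.fourierCoeff n‖ * ‖y⁻¹‖ ^ n := by
    simpa only [norm_inv, hny, inv_inv] using hc
  obtain ⟨φ, hφ⟩ := exists_functional_col hw y hcy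
  refine ⟨mulVecSummable_conjTranspose ?_, fun p => ?_⟩
  · rw [W₁Inv_eq ht hg]
    refine MulSummable.mul_right_of_colFinite (colFinite_S₂Inv t) fun _ k => ?_
    rw [hv]
    exact (hφ t ht hwt k).summable
  refine hasConjPartialV_mulVec (C := fun t' => mul d.g (d.W₂₀Inv t')) ht hg
    (hasPartialM_of_col hw hwt p fun i => ⟨φ, fun s k => ?_⟩) (fun s i k => ?_)
    (fun l => (eventually_det_ne_zero ht hg p (l + 1)).mono fun s hs =>
      W₁Inv_apply (summable_update ht p s) hs) (W₁Inv_eq ht hg)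
  · rw [hv]
    exact (hφ _ (summable_update ht p s) (summable_weight_update hwt p s) k).tsum_eq
  · rw [hv]
    exact (hφ _ (summable_update ht p s) (summable_weight_update hwt p s) k).summable

theorem waveFunction_two (ht : Summable fun p => ‖t p‖) (hg : NonzeroMinors (d.gt t)) {z : ℂ}
    (hz : z ≠ 0) (hzt : Summable fun j : ℕ+ => ‖t (0, j)‖ * ‖z⁻¹‖ ^ (j : ℕ))
    (hc : Summable fun n : ℤ => ‖d.fourierCoeff n‖ * ‖z⁻¹‖ ^ n) :
    MulVecSummable (d.W₂ t) (d.chiStar z) ∧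
      ∀ p, HasPartialV (d.Ψ₂ z) p (mulVec (d.B p t) (d.Ψ₂ z t)) t := by
  have hw : z⁻¹ ≠ 0 := inv_ne_zero hz
  -- By definition $\chi^*(z)=z^{-1}\chi(z^{-1})$, so both the point and the constant are $z^{-1}$.
  obtain ⟨φ, hφ⟩ := exists_functional_row hw z⁻¹ hc
  refine ⟨fun l => ?_, fun p => ?_⟩
  · rw [W₂_eq ht hg]
    exact MulSummable.mul_left_of_rowFinite (C := constCol (d.chiStar z)) (rowFinite_S₁ t)
      (fun i _ => (hφ t ht hzt i).summable) l 0
  refine hasPartialV_mulVec (R := fun t' => mul (d.W₁₀ t') d.g) ht hg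
    (hasPartialM_of_row hw hzt p fun k => ⟨φ, fun s i => ?_⟩) (fun s i k => ?_)
    (fun l => (eventually_det_ne_zero ht hg p l).mono fun s hs =>
      W₂_apply (summable_update ht p s) hs) (W₂_eq ht hg)
  · exact (hφ _ (summable_update ht p s) (summable_weight_update hzt p s) i).tsum_eq
  · exact (hφ _ (summable_update ht p s) (summable_weight_update hzt p s) i).summable

end Data

end CMVToda

theorem mainTheorem8 (d : Data) (t : Times)
    (ht : Summable fun p => ‖t p‖) (hg : NonzeroMinors (d.gt t)) :
    -- the deformation matrices are well defined and invertible
    (∀ i k, Summable fun j : ℕ+ => t (0, j) * mpow d.Ups j i k) ∧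
    (∀ i k, Summable fun j : ℕ+ => t (1, j) * mpow d.Ups.transpose j i k) ∧
    ExpSummable (d.A₁ t) ∧ ExpSummable (d.A₂ t) ∧
    mul (d.W₁₀ t) (d.W₁₀Inv t) = 1 ∧ mul (d.W₁₀Inv t) (d.W₁₀ t) = 1 ∧
    mul (d.W₂₀ t) (d.W₂₀Inv t) = 1 ∧ mul (d.W₂₀Inv t) (d.W₂₀ t) = 1 ∧
    -- the deformed moment matrix is well defined; it has a unique Gauss--Borel factorization
    MulSummable (d.W₁₀ t) d.g ∧ MulSummable (mul (d.W₁₀ t) d.g) (d.W₂₀Inv t) ∧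
    IsGaussBorel (d.gt t) (d.S₁ t) (d.S₁Inv t) (d.S₂ t) (d.S₂Inv t) ∧
    (∀ T₁ T₁i T₂ T₂i, IsGaussBorel (d.gt t) T₁ T₁i T₂ T₂i →
      T₁ = d.S₁ t ∧ T₁i = d.S₁Inv t ∧ T₂ = d.S₂ t ∧ T₂i = d.S₂Inv t) ∧
    -- the wave matrices and their inverses are well defined
    MulSummable (d.S₂ t) (d.W₂₀ t) ∧ MulSummable (d.W₁₀Inv t) (d.S₁Inv t) ∧
    MulSummable (d.W₁ t) (d.W₁Inv t) ∧ mul (d.W₁ t) (d.W₁Inv t) = 1 ∧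
    MulSummable (d.W₂ t) (d.W₂Inv t) ∧ mul (d.W₂ t) (d.W₂Inv t) = 1 ∧
    -- the powers of the Lax matrices and all products with the matrices `B` are finite sums
    RowFinite (d.L₁ t) ∧ ColFinite (d.L₂ t) ∧
    (∀ p, RowFinite (d.B p t) ∧ ColFinite (d.B p t)) ∧
    -- (1) auxiliary linear systems for the wave matrices
    (∀ p, HasPartialM d.W₁ p (mul (d.B p t) (d.W₁ t)) t ∧
      HasPartialM d.W₂ p (mul (d.B p t) (d.W₂ t)) t) ∧
    -- (2) linear systems for the wave and adjoint wave functions: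
    -- for the coefficients of the adjoint ones
    (∀ p, HasConjPartialM (fun t' => (d.W₁Inv t').conjTranspose) p
        (-mul (d.B p t).conjTranspose (d.W₁Inv t).conjTranspose) t ∧
      HasConjPartialM (fun t' => (d.W₂Inv t').conjTranspose) p
        (-mul (d.B p t).conjTranspose (d.W₂Inv t).conjTranspose) t) ∧
    -- and for the functions at the points `z` of convergence
    (∀ z : ℂ, z ≠ 0 → (Summable fun j : ℕ+ => ‖t (0, j)‖ * ‖z‖ ^ (j : ℕ)) →
      MulVecSummable (d.W₁ t) (d.chi z) ∧
      ∀ p, HasPartialV (d.Ψ₁ z) p (mulVec (d.B p t) (d.Ψ₁ z t)) t) ∧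
    (∀ z : ℂ, z ≠ 0 → (Summable fun j : ℕ+ => ‖t (1, j)‖ * ‖z‖ ^ (j : ℕ)) →
      MulVecSummable (d.W₂Inv t).conjTranspose (d.chi z) ∧
      ∀ p, HasConjPartialV (d.Ψ₂Star z) p
        (-mulVec (d.B p t).conjTranspose (d.Ψ₂Star z t)) t) ∧
    (∀ z : ℂ, z ≠ 0 → (Summable fun j : ℕ+ => ‖t (1, j)‖ * ‖z⁻¹‖ ^ (j : ℕ)) →
      (Summable fun n : ℤ => ‖d.fourierCoeff n‖ * ‖z‖ ^ n) →
      MulVecSummable (d.W₁Inv t).conjTranspose (d.chiStar z) ∧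
      ∀ p, HasConjPartialV (d.Ψ₁Star z) p
        (-mulVec (d.B p t).conjTranspose (d.Ψ₁Star z t)) t) ∧
    (∀ z : ℂ, z ≠ 0 → (Summable fun j : ℕ+ => ‖t (0, j)‖ * ‖z⁻¹‖ ^ (j : ℕ)) →
      (Summable fun n : ℤ => ‖d.fourierCoeff n‖ * ‖z⁻¹‖ ^ n) →
      MulVecSummable (d.W₂ t) (d.chiStar z) ∧
      ∀ p, HasPartialV (d.Ψ₂ z) p (mulVec (d.B p t) (d.Ψ₂ z t)) t) ∧
    -- (3) Lax equations
    (∀ p, HasPartialM d.L₁ p (comm (d.B p t) (d.L₁ t)) t ∧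
      HasPartialM d.L₂ p (comm (d.B p t) (d.L₂ t)) t) ∧
    -- (4) Zakharov--Shabat equations
    (∀ p q, ∃ D E : Mat, HasPartialM (d.B p) q D t ∧ HasPartialM (d.B q) p E t ∧
      D - E + comm (d.B p t) (d.B q t) = 0) := by
  refine ⟨fun i k => ?_, fun i k => ?_, ?_, ?_, Data.W₁₀_mul_inv ht, Data.W₁₀_inv_mul ht,
    Data.W₂₀_mul_inv ht, Data.W₂₀_inv_mul ht, Data.mulSummable_W₁₀_g ht,
    Data.mulSummable_W₁₀_g_W₂₀Inv ht, Data.isGaussBorel hg,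
    fun _ _ _ _ h => (Data.isGaussBorel hg).unique h, Data.mulSummable_S₂_W₂₀ ht hg,
    Data.mulSummable_W₁₀Inv_S₁Inv ht hg, Data.mulSummable_W₁_W₁Inv ht hg, Data.W₁_mul_W₁Inv ht hg,
    Data.mulSummable_W₂_W₂Inv ht hg, Data.W₂_mul_W₂Inv ht hg, Data.rowFinite_L₁ t,
    Data.colFinite_L₂ t, fun p => ⟨Data.rowFinite_B p t, Data.colFinite_B p t⟩,
    fun p => ⟨Data.hasPartialM_W₁ ht hg p, Data.hasPartialM_W₂ ht hg p⟩,
    fun p => ⟨Data.hasConjPartialM_of_hasPartialM (Data.hasPartialM_W₁Inv ht hg p),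
      Data.hasConjPartialM_of_hasPartialM (Data.hasPartialM_W₂Inv ht hg p)⟩,
    fun z hz h => Data.waveFunction_one ht hg hz h,
    fun z hz h => Data.adjointWaveFunction_two ht hg hz h,
    fun z hz h hc => Data.adjointWaveFunction_one ht hg hz h hc,
    fun z hz h hc => Data.waveFunction_two ht hg hz h hc,
    fun p => ⟨Data.hasPartialM_L₁ ht hg p, Data.hasPartialM_L₂ ht hg p⟩,
    fun p q => ⟨_, _, Data.hasPartialM_B ht hg p q, Data.hasPartialM_B ht hg q p,
      Data.zakharovShabat p q t⟩⟩
  -- $\Upsilon^j$ is the transpose of the matrix of $U^j$, hence the exchanged indices.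
  · have h := (Data.hasSum_opMatrix_gen (d := d) (summable_times_one ht 0) k i).summable
    simpa [Data.mpow_transpose_Ups] using h
  · have h := (Data.hasSum_opMatrix_gen (d := d) (summable_times_one ht 1) i k).summable
    simpa using h
  · rw [Data.A₁_eq ht]
    exact expSummable_transpose_opMatrix _
  · rw [Data.A₂_eq ht]
    exact expSummable_opMatrix _
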